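/- Let $G$ be a finite group. Let $\Lambda_G$ be the commutative monoid (under juxtaposition) of unordered tuples $[\hat\gamma_1,\dots,\hat\gamma_q]$, $q\ge 0$, of conjugacy classes of $G$ with $\gamma_1\cdots\gamma_q\in[G,G]$, where entries equal to $1$ may be inserted or removed, and let $\mathbb B_G:=\Lambda_G/\langle[\hat\gamma,\hat\gamma^{-1}]:\gamma\in G\rangle$, which is an abelian group. Let $R_{\mathbb C}G$ be the additive group of the complex representation ring of $G$, let $\rho_0$ denote the trivial one-dimensional representation, let $E_G:=\langle \mathrm{Ind}_H^G\rho_0 : H\le G\rangle$ and $\widetilde{R_{\mathbb C}G}:=R_{\mathbb C}G/E_G$. Every surjective homomorphism $$p:\Bigl\langle a_1,b_1,\dots,a_h,b_h,\xi_1,\dots,\xi_q \Bigm| \prod_{i=1}^h[a_i,b_i]\cdot\xi_1\cdots\xi_q\Bigr\rangle\twoheadrightarrow G$$ determines an orientation-preserving action of $G$ on a closed connected oriented surface $S$: the branched Galois covering, with monodromy $p$, of the closed surface of genus $h$ with $q$ marked points. There is one orbit over the $j$-th marked point, and it contains a point with stabilizer $\langle\gamma_j\rangle$ at which $\gamma_j:=p(\xi_j)$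 acts on the tangent space as the rotation through $2\pi/|\langle\gamma_j\rangle|$. The singular orbit data of the action is $[\hat\gamma_1,\dots,\hat\gamma_q]\in\mathbb B_G$. The action of $G$ on $H_1(S;\mathbb R)$ preserves the intersection pairing, hence is a symplectic representation; up to isomorphism it comes from a unitary representation $\varphi(p):G\to U(n)\subset Sp_{2n}(\mathbb R)$, where $2n=\dim H_1(S;\mathbb R)$. Let $\theta$ be the map induced by $\varphi$, which sends the singular orbit data of the action given by $p$ to the class of $\varphi(p)$ in $\widetilde{R_{\mathbb C}G}$. If $G$ is a finite abelian group which contains no subgroup isomorphic to $\mathbb Z/2\mathbb Z\times\mathbb Z/2\mathbb Z$, then $\mathbb B_G$ is torsion-free, and $\theta$ is a well-defined injective homomorphism $\mathbb B_G\to\widetilde{R_{\mathbb C}G}$, defined on all of $\mathbb B_G$. -/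

import Mathlib

/-! ### The group `𝔹_G` of singular orbit data -/

namespace SingularOrbit

universe u

section OrbitData

variable (G : Type u) [Group G]

/-- The inverse of a conjugacy class: the class of `γ` is sent to the class of `γ⁻¹`. -/
def conjInv : ConjClasses G → ConjClasses G :=
  Quotient.map (fun g => g⁻¹) (by
    intro a b h
    obtain ⟨c, hc⟩ := isConj_iff.1 h
    exact isConj_iff.2 ⟨c, by rw [← hc]; group⟩)

/-- The class in `G / [G, G]` of a conjugacy class of `G`. -/
def conjAb : ConjClasses G → Additive (Abelianization G) :=
  Quotient.lift (fun g => Additive.ofMul (Abelianization.of g)) (by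
    intro a b h
    obtain ⟨c, hc⟩ := isConj_iff.1 h
    rw [← hc]
    simp [mul_comm])

/-- The map `Ψ` sending an unordered tuple of conjugacy classes to the product of its entries in
`G / [G, G]` (written additively). -/
def psi : Multiset (ConjClasses G) →+ Additive (Abelianization G) :=
  Multiset.sumAddMonoidHom.comp (Multiset.mapAddMonoidHom (conjAb G))

/-- Unordered tuples `[γ₁, …, γ_q]` of conjugacy classes with `γ₁ ⋯ γ_q ∈ [G, G]`, of all
lengths `q ≥ 0`. -/
abbrev Tuples : Type u := AddMonoidHom.mker (psi G)

/-- Insertion of an entry `1` in a tuple is identified with doing nothing. -/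
def unitRel (s t : Tuples G) : Prop :=
  (t : Multiset (ConjClasses G)) = 1 ::ₘ (s : Multiset (ConjClasses G))

/-- The commutative monoid `Λ_G`: unordered tuples of conjugacy classes with product in `[G, G]`,
up to insertion of entries equal to `1`, added by juxtaposition. -/
abbrev Lambda : Type u := (addConGen (unitRel G)).Quotient

/-- The cancelling pairs `[γ, γ⁻¹]` are to be zero. -/
def cancelRel (x y : Lambda G) : Prop :=
  y = 0 ∧ ∃ (γ : G) (s : Tuples G),
    (s : Multiset (ConjClasses G)) = {ConjClasses.mk γ, ConjClasses.mk γ⁻¹} ∧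
      x = (addConGen (unitRel G)).mk' s

/-- The group `𝔹_G` of singular orbit data, the quotient of `Λ_G` by the cancelling pairs. -/
def OrbitData : Type u := (addConGen (cancelRel G)).Quotient

instance : AddCommMonoid (OrbitData G) :=
  inferInstanceAs (AddCommMonoid (addConGen (cancelRel G)).Quotient)

/-- The element `[γ₁, …, γ_q]` of `𝔹_G`. -/
def OrbitData.mk : Tuples G →+ OrbitData G :=
  (addConGen (cancelRel G)).mk'.comp (addConGen (unitRel G)).mk'

theorem OrbitData.mk_surjective : Function.Surjective (OrbitData.mk G) :=
  AddCon.mk'_surjective.comp AddCon.mk'_surjective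

variable {G} in
theorem conjAb_conjInv (c : ConjClasses G) : conjAb G (conjInv G c) = - conjAb G c := by
  obtain ⟨a, rfl⟩ := ConjClasses.mk_surjective c
  rfl

variable {G} in
theorem psi_map_conjInv (s : Multiset (ConjClasses G)) :
    psi G (s.map (conjInv G)) = - psi G s := by
  induction s using Multiset.induction_on with
  | empty => simp
  | cons c s ih =>
    have h (d : ConjClasses G) (t : Multiset (ConjClasses G)) :
        psi G (d ::ₘ t) = conjAb G d + psi G t := by simp [psi]
    rw [Multiset.map_cons, h, h, ih, conjAb_conjInv, neg_add]

variable {G} in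
theorem psi_add_map_conjInv (s : Multiset (ConjClasses G)) :
    s + s.map (conjInv G) ∈ AddMonoidHom.mker (psi G) := by
  rw [AddMonoidHom.mem_mker, map_add, psi_map_conjInv, add_neg_cancel]

variable {G} in
theorem OrbitData.mk_pair (s : Multiset (ConjClasses G)) :
    OrbitData.mk G ⟨s + s.map (conjInv G), psi_add_map_conjInv s⟩ = 0 := by
  induction s using Multiset.induction_on with
  | empty => exact map_zero (OrbitData.mk G)
  | cons c s ih =>
    obtain ⟨a, rfl⟩ := ConjClasses.mk_surjective c
    have hp : ({ConjClasses.mk a, ConjClasses.mk a⁻¹} : Multiset (ConjClasses G)) ∈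
        AddMonoidHom.mker (psi G) := by
      have := psi_add_map_conjInv ({ConjClasses.mk a} : Multiset (ConjClasses G))
      rwa [Multiset.map_singleton] at this
    have h0 : OrbitData.mk G ⟨_, hp⟩ = 0 :=
      (AddCon.eq _).2 (AddConGen.Rel.of _ _ ⟨rfl, a, ⟨_, hp⟩, rfl, rfl⟩)
    have : (⟨(ConjClasses.mk a ::ₘ s) + (ConjClasses.mk a ::ₘ s).map (conjInv G),
        psi_add_map_conjInv _⟩ : Tuples G) =
        ⟨_, hp⟩ + ⟨s + s.map (conjInv G), psi_add_map_conjInv s⟩ := by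
      apply Subtype.ext
      change (ConjClasses.mk a ::ₘ s) + (ConjClasses.mk a ::ₘ s).map (conjInv G) =
        (ConjClasses.mk a ::ₘ {ConjClasses.mk a⁻¹}) + (s + s.map (conjInv G))
      rw [Multiset.map_cons, show conjInv G (ConjClasses.mk a) = ConjClasses.mk a⁻¹ from rfl,
        ← Multiset.singleton_add, ← Multiset.singleton_add, ← Multiset.singleton_add]
      abel
    rw [this, map_add, h0, ih, add_zero]

theorem OrbitData.exists_neg (x : OrbitData G) : ∃ y : OrbitData G, y + x = 0 := by
  obtain ⟨⟨s, hs⟩, rfl⟩ := OrbitData.mk_surjective G x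
  have hs' : s.map (conjInv G) ∈ AddMonoidHom.mker (psi G) := by
    rw [AddMonoidHom.mem_mker] at hs ⊢
    rw [psi_map_conjInv, hs, neg_zero]
  refine ⟨OrbitData.mk G ⟨_, hs'⟩, ?_⟩
  rw [add_comm, ← map_add]
  exact OrbitData.mk_pair s

noncomputable instance : Neg (OrbitData G) :=
  ⟨fun x => (OrbitData.exists_neg G x).choose⟩

noncomputable instance : AddCommGroup (OrbitData G) where
  zsmul := zsmulRec
  neg_add_cancel x := (OrbitData.exists_neg G x).choose_spec
  add_comm := add_comm

end OrbitData

/-! ### The complex representation ring modulo induced trivial representations -/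

section Representations

variable (G : Type u) [Group G]

/-- The additive group of the complex representation ring `R_ℂ G`: the group of virtual
characters, generated by the characters of the finite-dimensional complex representations. -/
def repRing : AddSubgroup (G → ℂ) :=
  AddSubgroup.closure {χ | ∃ (n : ℕ) (ρ : Representation ℂ G (EuclideanSpace ℂ (Fin n))),
    χ = ρ.character}

/-- The subgroup `E_G` generated by the representations `Ind_H^G ρ₀`, for all subgroups `H` of `G`.
Here `Ind_H^G ρ₀`, with `ρ₀` the trivial one-dimensional representation of `H`, is the permutation
representation of `G` on `ℂ[G / H]`. -/
def indTrivial : AddSubgroup (G → ℂ) :=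
  AddSubgroup.closure {χ | ∃ H : Subgroup G, χ = (Representation.ofMulAction ℂ G (G ⧸ H)).character}

/-- The quotient group `R_ℂ G / E_G`. -/
abbrev RepQuot : Type u := repRing G ⧸ (indTrivial G).addSubgroupOf (repRing G)

variable {G} in
/-- The class in `R_ℂ G / E_G` of a representation. -/
noncomputable def repClass {n : ℕ} (ρ : Representation ℂ G (EuclideanSpace ℂ (Fin n))) : RepQuot G :=
  QuotientAddGroup.mk ⟨ρ.character, AddSubgroup.subset_closure ⟨n, ρ, rfl⟩⟩

end Representations

/-! ### Actions on closed oriented surfaces -/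

/-- The generators `a_i, b_i` (`i < h`) and `ξ_j` (`j < q`) of the fundamental group of a surface of
genus `h` with `q` points removed. -/
inductive Gen (h q : ℕ) : Type
  | a (i : Fin h) : Gen h q
  | b (i : Fin h) : Gen h q
  | xi (j : Fin q) : Gen h q

/-- The word `∏ᵢ [a_i, b_i] · ξ_1 ⋯ ξ_q`; a letter `(x, true)` stands for `x`, and `(x, false)` for
`x⁻¹`. -/
def surfaceWord (h q : ℕ) : List (Gen h q × Bool) :=
  (List.finRange h).flatMap
      (fun i => [(Gen.a i, true), (Gen.b i, true), (Gen.a i, false), (Gen.b i, false)]) ++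
    (List.finRange q).map (fun j => (Gen.xi j, true))

/-- The group `⟨a_1, b_1, …, a_h, b_h, ξ_1, …, ξ_q | ∏ᵢ [a_i, b_i] · ξ_1 ⋯ ξ_q⟩`. -/
abbrev SurfaceGroup (h q : ℕ) : Type := PresentedGroup {FreeGroup.mk (surfaceWord h q)}

/-- An action of `G` on a closed connected oriented surface `S`, given by its monodromy: the genus
`h` of `S / G`, a number `q` of marked points of `S / G` containing all the branch points, and the
surjection `p` onto `G`.

The surface `S` is the `G`-equivariant cell complex which covers the evident cell structure of
`S / G` (one vertex, the loops `a_i, b_i, ξ_j`, a polygon `P` glued along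
`∏ᵢ [a_i, b_i] · ξ_1 ⋯ ξ_q`, and for each `j` a disc `D_j` around the `j`-th marked point with
boundary `ξ_j`). It has
* a vertex `g` for each `g : G`;
* an edge `(g, x)` from `g` to `g * p x`, for each `g : G` and each generator `x`;
* a polygon for each `g : G`, whose boundary is the path that starts at `g` and spells out the
  word `∏ᵢ [a_i, b_i] · ξ_1 ⋯ ξ_q`;
* for each `j`, with `γ_j = p ξ_j` of order `ν_j`, a disc for each coset `g ⟨γ_j⟩`, whose boundary
  is the path that starts at `g` and spells out the word `ξ_j ^ ν_j`.

The group `G` acts by left translation. The stabilizer of the disc of the coset `⟨γ_j⟩` is `⟨γ_j⟩`,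
and `γ_j` rotates this disc by one `ν_j`-th of a full turn in the direction of its boundary path.
The surface is oriented such that the boundary paths of the discs are positive; the boundary paths
of the polygons are then negative. So `γ_j` is a rotation by `2π / ν_j` on the tangent space at the
centre of the disc. -/
structure SurfaceAction (G : Type u) [Group G] where
  h : ℕ
  q : ℕ
  p : SurfaceGroup h q →* G
  surjective : Function.Surjective p

namespace SurfaceAction

variable {G : Type u} [Group G] (A : SurfaceAction G)

/-- The image in `G` of a generator. -/
def val (x : Gen A.h A.q) : G := A.p (PresentedGroup.of x)

/-- The rotation element `γ_j = p ξ_j`. -/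
def γ (j : Fin A.q) : G := A.val (Gen.xi j)

/-- The multiset of conjugacy classes of `γ_1, …, γ_q`. -/
def classes : Multiset (ConjClasses G) :=
  ((List.finRange A.q).map fun j => ConjClasses.mk (A.γ j) : List (ConjClasses G))

theorem psi_classes : A.classes ∈ AddMonoidHom.mker (psi G) := by
  rw [AddMonoidHom.mem_mker]
  have hrel : (PresentedGroup.mk {FreeGroup.mk (surfaceWord A.h A.q)})
      (FreeGroup.mk (surfaceWord A.h A.q)) = 1 :=
    PresentedGroup.one_of_mem rfl
  let f : FreeGroup (Gen A.h A.q) →* Abelianization G :=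
    (Abelianization.of.comp A.p).comp (PresentedGroup.mk {FreeGroup.mk (surfaceWord A.h A.q)})
  have h1 : f (FreeGroup.mk (surfaceWord A.h A.q)) = 1 := by
    change Abelianization.of (A.p _) = 1
    rw [hrel, map_one, map_one]
  have hf : f = FreeGroup.lift (fun x => Abelianization.of (A.val x)) := by
    apply FreeGroup.ext_hom
    intro x
    rw [FreeGroup.lift_apply_of]
    rfl
  rw [hf, FreeGroup.lift_mk, surfaceWord, List.map_append, List.prod_append] at h1
  have h2 : (List.map (fun x : Gen A.h A.q × Bool =>
      cond x.2 (Abelianization.of (A.val x.1)) (Abelianization.of (A.val x.1))⁻¹)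
      ((List.finRange A.h).flatMap (fun i =>
        [(Gen.a i, true), (Gen.b i, true), (Gen.a i, false), (Gen.b i, false)]))).prod = 1 := by
    generalize List.finRange A.h = l
    induction l with
    | nil => simp
    | cons i l ih =>
      rw [List.flatMap_cons, List.map_append, List.prod_append, ih, mul_one]
      simp only [List.map_cons, List.map_nil, cond_true, cond_false, List.prod_cons,
        List.prod_nil, mul_one]
      rw [mul_left_comm, mul_inv_cancel_left, mul_inv_cancel]
  rw [h2, one_mul, List.map_map] at h1
  have h3 := congrArg Additive.ofMul h1
  rw [ofMul_list_prod, List.map_map] at h3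
  change ((A.classes).map (conjAb G)).sum = 0
  rw [classes, Multiset.map_coe, Multiset.sum_coe, List.map_map]
  exact h3

/-- The singular orbit data `[γ_1, …, γ_q] ∈ 𝔹_G` of the action. -/
def data : OrbitData G := OrbitData.mk G ⟨A.classes, A.psi_classes⟩

/-- Cellular `1`-cochains of `S` with real coefficients. -/
abbrev Cochain : Type u := G × Gen A.h A.q → ℝ

/-- The end point of the path of length one that starts at `g` and follows the letter `s`. -/
def next (g : G) (s : Gen A.h A.q × Bool) : G :=
  cond s.2 (g * A.val s.1) (g * (A.val s.1)⁻¹)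

/-- The value of a cochain on the oriented edge that starts at `g` and follows the letter `s`. -/
def step (u : A.Cochain) (g : G) (s : Gen A.h A.q × Bool) : ℝ :=
  cond s.2 (u (g, s.1)) (-u (g * (A.val s.1)⁻¹, s.1))

/-- The value of a cochain on the path that starts at `g` and spells out the word `w`. -/
def pathSum (u : A.Cochain) : G → List (Gen A.h A.q × Bool) → ℝ
  | _, [] => 0
  | g, s :: w => A.step u g s + pathSum u (A.next g s) w

/-- `∑_{i < j} (u_i v_j - u_j v_i)`, where `u_i` and `v_i` are the values of the cochains `u` and
`v` on the `i`-th edge of the path that starts at `g` and spells out the word `w`. -/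
def crossSum (u v : A.Cochain) : G → List (Gen A.h A.q × Bool) → ℝ
  | _, [] => 0
  | g, s :: w =>
    (A.step u g s * A.pathSum v (A.next g s) w - A.step v g s * A.pathSum u (A.next g s) w) +
      crossSum u v (A.next g s) w

/-- The word `ξ_j ^ ν_j`, with `ν_j` the order of `γ_j`. -/
noncomputable def discWord (j : Fin A.q) : List (Gen A.h A.q × Bool) :=
  List.replicate (orderOf (A.γ j)) (Gen.xi j, true)

theorem pathSum_add (u v : A.Cochain) (g : G) (w : List (Gen A.h A.q × Bool)) :
    A.pathSum (u + v) g w = A.pathSum u g w + A.pathSum v g w := by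
  induction w generalizing g with
  | nil => simp [pathSum]
  | cons s w ih =>
    obtain ⟨x, _ | _⟩ := s <;> simp only [pathSum, ih, step, Pi.add_apply, cond] <;> ring

theorem pathSum_smul (c : ℝ) (u : A.Cochain) (g : G) (w : List (Gen A.h A.q × Bool)) :
    A.pathSum (c • u) g w = c * A.pathSum u g w := by
  induction w generalizing g with
  | nil => simp [pathSum]
  | cons s w ih =>
    obtain ⟨x, _ | _⟩ := s <;>
      simp only [pathSum, ih, step, Pi.smul_apply, smul_eq_mul, cond] <;> ring

/-- The space `Z¹(S; ℝ)` of cocycles: the cochains which vanish on the boundary of each polygon and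
of each disc. -/
def cocycles : Submodule ℝ A.Cochain where
  carrier := {u | (∀ g, A.pathSum u g (surfaceWord A.h A.q) = 0) ∧
    ∀ j g, A.pathSum u g (A.discWord j) = 0}
  zero_mem' := by
    have h (g : G) (w : List (Gen A.h A.q × Bool)) : A.pathSum 0 g w = 0 := by
      simpa using A.pathSum_smul 0 0 g w
    exact ⟨fun g => h g _, fun j g => h g _⟩
  add_mem' := by
    rintro u v ⟨hu, hu'⟩ ⟨hv, hv'⟩
    exact ⟨fun g => by rw [pathSum_add, hu, hv, add_zero],
      fun j g => by rw [pathSum_add, hu', hv', add_zero]⟩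
  smul_mem' := by
    rintro c u ⟨hu, hu'⟩
    exact ⟨fun g => by rw [pathSum_smul, hu, mul_zero],
      fun j g => by rw [pathSum_smul, hu', mul_zero]⟩

/-- The coboundary of a `0`-cochain. -/
def d : (G → ℝ) →ₗ[ℝ] A.Cochain where
  toFun f := fun e => f (e.1 * A.val e.2) - f e.1
  map_add' f f' := by funext e; simp only [Pi.add_apply]; ring
  map_smul' c f := by
    funext e
    simp only [Pi.smul_apply, smul_eq_mul, RingHom.id_apply]
    ring

/-- The first cohomology `H¹(S; ℝ) = Z¹(S; ℝ) / B¹(S; ℝ)`. -/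
abbrev H1 : Type u := A.cocycles ⧸ (LinearMap.range A.d).comap A.cocycles.subtype

theorem pathSum_translate (c : G) (u : A.Cochain) (g : G) (w : List (Gen A.h A.q × Bool)) :
    A.pathSum (fun e => u (c * e.1, e.2)) g w = A.pathSum u (c * g) w := by
  induction w generalizing g with
  | nil => rfl
  | cons s w ih =>
    obtain ⟨x, _ | _⟩ := s <;> simp [pathSum, ih, step, next, mul_assoc]

/-- The left action of `c : G` on cocycles, that is, pull-back along the action of `c⁻¹` on `S`. -/
def translate (c : G) (u : A.cocycles) : A.cocycles :=
  ⟨fun e => u.1 (c⁻¹ * e.1, e.2),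
    fun g => by rw [pathSum_translate]; exact u.2.1 _,
    fun j g => by rw [pathSum_translate]; exact u.2.2 j _⟩

/-- The intersection pairing: the cup product of two cocycles, evaluated on the fundamental class.
If `u = dU` and `v = dV` on a polygon, then the cup product `∫ u ∧ v` over the polygon is the signed
area of its image under `(U, V)`, which is half of the `crossSum` of its boundary path. Discs count
positively and polygons negatively. In the sum over `g : G`, each disc of type `j` occurs `ν_j`
times, once for each starting point of its boundary path. -/
noncomputable def pairing [Fintype G] (u v : A.cocycles) : ℝ :=
  (1 / 2) * (∑ j : Fin A.q, (1 / (orderOf (A.γ j) : ℝ)) *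
      ∑ g : G, A.crossSum u.1 v.1 g (A.discWord j) -
    ∑ g : G, A.crossSum u.1 v.1 g (surfaceWord A.h A.q))

/-- `ρ` is the unitary representation `φ` of the action: a unitary representation on `ℂⁿ` which,
as a symplectic representation with the form `Im ⟨·, ·⟩` (the standard symplectic form of
`ℂⁿ = ℝ²ⁿ`), is isomorphic to the representation of `G` on the first (co)homology of `S` with the
intersection pairing. Homology and cohomology are identified here by Poincaré duality, which
respects the action of `G` and the pairing. -/
def IsUnitaryRep [Fintype G] {n : ℕ} (ρ : Representation ℂ G (EuclideanSpace ℂ (Fin n))) : Prop :=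
  (∀ c x y, inner ℂ (ρ c x) (ρ c y) = inner ℂ x y) ∧
    ∃ e : A.H1 ≃ₗ[ℝ] EuclideanSpace ℂ (Fin n),
      (∀ (c : G) (u : A.cocycles),
        e (Submodule.Quotient.mk (A.translate c u)) = ρ c (e (Submodule.Quotient.mk u))) ∧
      ∀ u v : A.cocycles,
        A.pairing u v = (inner ℂ (e (Submodule.Quotient.mk u)) (e (Submodule.Quotient.mk v))).im

end SurfaceAction

/-- `θ : 𝔹_G → R_ℂ G / E_G` is the map induced by `φ`: its graph consists of the pairs of the
singular orbit data of an action and the class of the unitary representation of that action. -/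
def IsTheta {G : Type u} [Group G] [Fintype G] (θ : OrbitData G →+ RepQuot G) : Prop :=
  ∀ (α : OrbitData G) (c : RepQuot G), θ α = c ↔
    ∃ (A : SurfaceAction G) (n : ℕ) (ρ : Representation ℂ G (EuclideanSpace ℂ (Fin n))),
      A.IsUnitaryRep ρ ∧ A.data = α ∧ repClass ρ = c

end SingularOrbit

/-! ### Abel summation for Dirichlet series with bounded coefficient sums. -/

namespace SingularOrbit

open Filter Topology MeasureTheory Complex Asymptotics Finset

/-! ### Conditionally convergent values of `L`-functions at `1` -/

/-! For abelian `G` a tuple is a multiplicity function `m` on `G`, and everything is expressed by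
the rotation numbers `t_χ(γ) ∈ [0, 1)` with `χ(γ) = exp (2πi t_χ(γ))` (`turn`). The bridge to
surfaces is the Chevalley–Weil formula `multiplicity_inv_add`: the multiplicity of `χ⁻¹` in the
unitary representation of an action is `h - 1 + ∑_j t_χ(γ_j)`, plus one if `χ = 1`. The corrections
are multiples of the regular and the trivial character, which lie in `E_G`, so the class of the
representation is that of `∑_χ rotSum(χ) χ` and depends on the tuple only. Entries `1` contribute
nothing, and a pair `[γ, γ⁻¹]` contributes the sum of all `χ` with `χ(γ) ≠ 1`, which is the regular
character minus `Ind ρ₀` from `⟨γ⟩`. Hence `θ` exists (`exists_theta`).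

Injectivity is arithmetic. Elements of `E_G` are real, so a vanishing class gives `∑_g m(g) (t_χ(g)
- t_{χ⁻¹}(g)) = 0` for all `χ`. Up to the factor `-πi`, the bracket is the value at `1` of the
Dirichlet series with coefficients `χ(g)^n - χ(g)^(-n)`. Averaging over powers of `χ` against
Dirichlet characters `ψ` produces a factor `L(ψ⁻¹, 1)`, and its non-vanishing forces `m` to be even
(`sum_mul_sub_inv_eq_zero`). An even tuple cancels in pairs up to involutions. If there is only one
involution `σ`, the condition on the product makes its multiplicity even, and `[σ, σ] = [σ, σ⁻¹]` is
zero (`mk_eq_zero_of_symm`). The same argument embeds `𝔹_G` in a real vector space, so it is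
torsion-free.

The Chevalley–Weil formula is obtained by squeezing. A cochain on which `G` acts through a character
develops into a path in the plane, and the intersection pairing becomes a Hermitian form of signed
areas. A subspace of twisted cocycles of dimension at least `h + ∑_j t_χ(γ_j)` on which this form is
nonpositive (`exists_nonpos_subspace`) bounds each multiplicity from below (`le_multiplicity`). A
Fourier transform bounds the dimension of `H¹` from above (`finrank_H1_le`). As `t_χ + t_{χ⁻¹}` is
`1` or `0`, the bounds meet after summation over `χ`.

For `θ` to be the map induced by `φ` on all of `𝔹_G`, every class must come from an action
(`exists_surfaceAction_data`), and every action must have a unitary representation. The latter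
follows from the nondegeneracy of the pairing (`exists_d_eq_of_pairing_eq_zero`) and an equivariant
polar decomposition (`exists_unitary`). -/

theorem tendsto_sum_cpow_of_bounded {f : ℕ → ℂ} (hf : f 0 = 0) {C : ℝ}
    (hC : ∀ n, ‖∑ k ∈ Icc 0 n, f k‖ ≤ C) {s : ℂ} (hs : 0 < s.re) :
    Tendsto (fun n : ℕ => ∑ k ∈ Icc 0 n, (k : ℂ) ^ (-s) * f k) atTop
      (𝓝 (s * ∫ t in Set.Ioi (1 : ℝ), (∑ k ∈ Icc 0 ⌊t⌋₊, f k) * (t : ℂ) ^ (-(s + 1)))) := by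
  have hO : (fun n : ℕ => ∑ k ∈ Icc 0 n, f k) =O[atTop] fun n => (n : ℝ) ^ (0 : ℝ) :=
    IsBigO.of_bound C (Eventually.of_forall fun n => by simpa using hC n)
  have h₁ : (-s - 1).re + 0 < -1 := by
    simp only [add_zero, sub_re, neg_re, one_re]; linarith
  have h₂ : s ≠ 0 := ne_zero_of_re_pos hs
  have h₃ (t : ℝ) (ht : t ∈ Set.Ici 1) : DifferentiableAt ℝ (fun x : ℝ ↦ (x : ℂ) ^ (-s)) t :=
    differentiableAt_id.ofReal_cpow_const (zero_lt_one.trans_le ht).ne' (neg_ne_zero.mpr h₂)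
  rw [← integral_const_mul]
  -- Abel summation. The boundary term has limit `0`, since bounded partial sums are multiplied by
  -- `n ^ (-s)` with `0 < s.re`.
  convert!
    tendsto_sum_mul_atTop_nhds_one_sub_integral₀ (f := fun x ↦ (x : ℂ) ^ (-s)) (l := 0) ?_ hf h₃ ?_
      ?_ ?_ (integrableAtFilter_rpow_atTop_iff.mpr h₁)
  · rw [zero_sub, ← integral_neg]
    refine setIntegral_congr_fun measurableSet_Ioi fun t ht ↦ ?_
    rw [deriv_ofReal_cpow_const (zero_lt_one.trans ht).ne']
    · ring_nf
    · exact neg_ne_zero.mpr h₂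
  · refine (Iff.mpr integrableOn_Ici_iff_integrableOn_Ioi <|
      integrableOn_Ioi_deriv_ofReal_cpow zero_lt_one
        (by simpa using! hs)).locallyIntegrableOn
  · have hlim : Tendsto (fun n : ℕ ↦ (n : ℝ) ^ (-(s.re - 0))) atTop (𝓝 0) :=
      (tendsto_rpow_neg_atTop (by rwa [sub_pos])).comp tendsto_natCast_atTop_atTop
    refine (IsBigO.mul_atTop_rpow_natCast_of_isBigO_rpow (-s.re) _ _ ?_ hO ?_).trans_tendsto hlim
    · exact isBigO_norm_left.mp <| (norm_ofReal_cpow_eventually_eq_atTop _).isBigO.natCast_atTop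
    · linarith
  · refine .mul_atTop_rpow_of_isBigO_rpow (-(s + 1).re) 0 _ ?_ ?_ (by rw [← neg_re, neg_add'])
    · simpa [-neg_add_rev, neg_add'] using! isBigO_deriv_ofReal_cpow_const_atTop _
    · exact (hO.comp_tendsto tendsto_nat_floor_atTop).trans <|
        isEquivalent_nat_floor.isBigO.rpow le_rfl (eventually_ge_atTop 0)

/-- Dominated convergence with majorant `C * t ^ (-2)`, which works for all `s > 1`. It carries an
identity known for `s > 1` to the point `1`. -/
theorem tendsto_mul_integral_nhdsGT_one {S : ℕ → ℂ} {C : ℝ} (hC : ∀ n, ‖S n‖ ≤ C) :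
    Tendsto (fun s : ℝ => (s : ℂ) *
        ∫ t in Set.Ioi (1 : ℝ), S ⌊t⌋₊ * (t : ℂ) ^ (-((s : ℂ) + 1))) (𝓝[>] 1)
      (𝓝 (((1 : ℝ) : ℂ) * ∫ t in Set.Ioi (1 : ℝ), S ⌊t⌋₊ * (t : ℂ) ^ (-(((1 : ℝ) : ℂ) + 1)))) := by
  have hC0 : 0 ≤ C := (norm_nonneg _).trans (hC 0)
  refine Tendsto.mul ?_ ?_
  · exact (continuous_ofReal.tendsto 1).mono_left nhdsWithin_le_nhds
  refine tendsto_integral_filter_of_dominated_convergence (fun t : ℝ => C * t ^ (-2 : ℝ)) ?_ ?_ ?_ ?_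
  · refine Eventually.of_forall fun s => ?_
    have h1 : Measurable fun t : ℝ => S ⌊t⌋₊ := (measurable_from_nat (f := S)).comp Nat.measurable_floor
    have h2 : Measurable fun t : ℝ => (t : ℂ) ^ (-((s : ℂ) + 1)) :=
      Complex.measurable_ofReal.pow_const _
    exact (h1.mul h2).aestronglyMeasurable
  · filter_upwards [self_mem_nhdsWithin] with s hs
    refine (ae_restrict_iff' measurableSet_Ioi).2 (Eventually.of_forall fun t ht => ?_)
    have ht1 : (1 : ℝ) < t := ht
    have hs1 : (1 : ℝ) < s := hs
    rw [norm_mul, Complex.norm_cpow_eq_rpow_re_of_pos (zero_lt_one.trans ht1)]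
    gcongr
    · exact hC _
    · exact ht1.le
    · simp; linarith
  · exact (integrableOn_Ioi_rpow_of_lt (by norm_num) zero_lt_one).const_mul C
  · refine (ae_restrict_iff' measurableSet_Ioi).2 (Eventually.of_forall fun t ht => ?_)
    have ht1 : (1 : ℝ) < t := ht
    have ht0 : (t : ℂ) ≠ 0 := by exact_mod_cast (zero_lt_one.trans ht1).ne'
    have : Continuous fun s : ℝ => S ⌊t⌋₊ * (t : ℂ) ^ (-((s : ℂ) + 1)) := by
      refine continuous_const.mul (Continuous.const_cpow (by fun_prop) (Or.inl ht0))
    exact (this.tendsto 1).mono_left nhdsWithin_le_nhds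

section Periodic

variable {N : ℕ} [NeZero N]

/-- Complete periods cancel, so each partial sum reduces to one with fewer than `N` terms. -/
theorem exists_norm_sum_le_of_sum_eq_zero {Φ : ZMod N → ℂ} (hΦ : ∑ j, Φ j = 0) :
    ∃ C, ∀ n : ℕ, ‖∑ k ∈ Icc 0 n, Φ (k : ZMod N)‖ ≤ C := by
  have hper (m : ℕ) : ∑ k ∈ range (N * m), Φ (k : ZMod N) = 0 := by
    induction m with
    | zero => simp
    | succ m ih =>
      rw [Nat.mul_succ, sum_range_add, ih, zero_add]
      simp only [Nat.cast_add, Nat.cast_mul, CharP.cast_eq_zero, zero_mul, zero_add]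
      rw [← hΦ]
      refine sum_bij (fun k _ => (k : ZMod N)) (by simp) ?_ ?_ (by simp)
      · intro a ha b hb hab
        rw [ZMod.natCast_eq_natCast_iff'] at hab
        rwa [Nat.mod_eq_of_lt (mem_range.1 ha), Nat.mod_eq_of_lt (mem_range.1 hb)] at hab
      · exact fun b _ => ⟨b.val, mem_range.2 (ZMod.val_lt b), by simp⟩
  refine ⟨∑ j ∈ range N, ‖Φ (j : ZMod N)‖, fun n => ?_⟩
  rw [← Nat.range_succ_eq_Icc_zero, ← Nat.div_add_mod (n + 1) N, sum_range_add, hper, zero_add]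
  simp only [Nat.cast_add, Nat.cast_mul, CharP.cast_eq_zero, zero_mul, zero_add]
  refine (norm_sum_le _ _).trans (sum_le_sum_of_subset_of_nonneg ?_ fun _ _ _ => norm_nonneg _)
  exact range_subset_range.2 (Nat.mod_lt _ (NeZero.pos N)).le

/-- For `s > 1` the `L`-function equals the Abel integral. Both sides are continuous as `s`
decreases to `1`, where the integral is the sum of the conditionally convergent series. -/
theorem tendsto_sum_LFunction_one {Φ : ZMod N → ℂ} (hΦ : ∑ j, Φ j = 0) (h0 : Φ 0 = 0) :
    Tendsto (fun n : ℕ => ∑ k ∈ range n, Φ (k : ZMod N) / k) atTop (𝓝 (ZMod.LFunction Φ 1)) := by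
  obtain ⟨C, hC⟩ := exists_norm_sum_le_of_sum_eq_zero hΦ
  have hf : Φ ((0 : ℕ) : ZMod N) = 0 := by simpa using h0
  have h1 := tendsto_sum_cpow_of_bounded (f := fun k : ℕ => Φ k) hf hC (s := 1) (by simp)
  have h2 := tendsto_mul_integral_nhdsGT_one (S := fun n => ∑ k ∈ Icc 0 n, Φ (k : ZMod N)) hC
  have h3 : Tendsto (fun s : ℝ => ZMod.LFunction Φ s) (𝓝[>] 1) (𝓝 (ZMod.LFunction Φ 1)) := by
    have : Continuous fun s : ℝ => ZMod.LFunction Φ s :=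
      (ZMod.differentiable_LFunction_of_sum_zero hΦ).continuous.comp continuous_ofReal
    simpa using (this.tendsto 1).mono_left nhdsWithin_le_nhds
  have h4 : (fun s : ℝ => ZMod.LFunction Φ s) =ᶠ[𝓝[>] 1] fun s : ℝ => (s : ℂ) *
      ∫ t in Set.Ioi (1 : ℝ), (∑ k ∈ Icc 0 ⌊t⌋₊, Φ (k : ZMod N)) * (t : ℂ) ^ (-((s : ℂ) + 1)) := by
    filter_upwards [self_mem_nhdsWithin] with s hs
    have hs' : 1 < (s : ℂ).re := hs
    have hS := ZMod.LSeriesSummable_of_one_lt_re Φ hs'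
    rw [ZMod.LFunction_eq_LSeries Φ hs']
    refine tendsto_nhds_unique ((tendsto_add_atTop_iff_nat 1).mpr hS.hasSum.tendsto_sum_nat) ?_
    have := tendsto_sum_cpow_of_bounded (f := fun k : ℕ => Φ k) hf hC (zero_lt_one.trans hs')
    simpa only [Nat.range_succ_eq_Icc_zero, LSeries.term_def₀ (f := fun k : ℕ => Φ k) hf, mul_comm] using this
  have h5 := tendsto_nhds_unique (h3.congr' h4) h2
  rw [h5, ← tendsto_add_atTop_iff_nat 1]
  simp only [ofReal_one, Nat.range_succ_eq_Icc_zero]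
  refine h1.congr fun n => sum_congr rfl fun k _ => ?_
  rw [cpow_neg_one, div_eq_inv_mul]

end Periodic

end SingularOrbit

/-! ### Rotation numbers, cotangents and logarithms. -/

namespace SingularOrbit

open Filter Topology Complex
open scoped Real

/-! ### The rotation number of a complex number of modulus one -/

/-- The number `t ∈ [0, 1)` with `z = exp (2 π i t)`, for `z` of modulus one. -/
noncomputable def turn (z : ℂ) : ℝ := Int.fract (z.arg / (2 * π))

theorem turn_nonneg (z : ℂ) : 0 ≤ turn z := Int.fract_nonneg _

theorem turn_lt_one (z : ℂ) : turn z < 1 := Int.fract_lt_one _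

theorem turn_one : turn 1 = 0 := by simp [turn]

theorem exp_turn {z : ℂ} (hz : ‖z‖ = 1) : exp (2 * π * turn z * I) = z := by
  have h : (2 * π * turn z : ℝ) = z.arg - ⌊z.arg / (2 * π)⌋ * (2 * π) := by
    rw [turn, Int.fract]
    field_simp
  have h2 : (2 * π * turn z : ℂ) = z.arg - ⌊z.arg / (2 * π)⌋ * (2 * π) := by exact_mod_cast h
  rw [h2, sub_mul, exp_sub, show (⌊z.arg / (2 * π)⌋ * (2 * π) * I : ℂ) =
    ⌊z.arg / (2 * π)⌋ * (2 * π * I) by ring, exp_int_mul_two_pi_mul_I, div_one]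
  conv_rhs => rw [← norm_mul_exp_arg_mul_I z, hz]
  simp

theorem turn_exp (x : ℝ) : turn (exp (2 * π * x * I)) = Int.fract x := by
  have h : (2 * π * x * I : ℂ) = ((2 * π * x : ℝ) : ℂ) * I := by push_cast; ring
  rw [turn, h, Complex.arg_exp_mul_I, toIocMod, zsmul_eq_mul]
  have : (2 * π * x - (toIocDiv Real.two_pi_pos (-π) (2 * π * x)) * (2 * π)) / (2 * π) =
      x - (toIocDiv Real.two_pi_pos (-π) (2 * π * x) : ℤ) := by
    field_simp
  rw [this, Int.fract_sub_intCast]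

theorem turn_pos {z : ℂ} (hz : ‖z‖ = 1) (h1 : z ≠ 1) : 0 < turn z := by
  refine (turn_nonneg z).lt_of_ne fun h => h1 ?_
  rw [← exp_turn hz, ← h]
  simp

theorem turn_mul {z w : ℂ} (hz : ‖z‖ = 1) (hw : ‖w‖ = 1) :
    turn (z * w) = Int.fract (turn z + turn w) := by
  rw [← turn_exp]
  congr 1
  conv_lhs => rw [← exp_turn hz, ← exp_turn hw]
  rw [← exp_add]
  push_cast
  ring_nf

theorem turn_mul_of_lt {z w : ℂ} (hz : ‖z‖ = 1) (hw : ‖w‖ = 1) (h : turn z + turn w < 1) :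
    turn (z * w) = turn z + turn w := by
  rw [turn_mul hz hw]
  exact Int.fract_eq_self.2 ⟨add_nonneg (turn_nonneg z) (turn_nonneg w), h⟩

theorem turn_mul_of_le {z w : ℂ} (hz : ‖z‖ = 1) (hw : ‖w‖ = 1) (h : 1 ≤ turn z + turn w) :
    turn (z * w) = turn z + turn w - 1 := by
  rw [turn_mul hz hw, ← Int.fract_sub_one]
  exact Int.fract_eq_self.2 ⟨by linarith, by linarith [turn_lt_one z, turn_lt_one w]⟩

theorem turn_inv {z : ℂ} (hz : ‖z‖ = 1) (h1 : z ≠ 1) : turn z⁻¹ = 1 - turn z := by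
  have hz' : ‖z⁻¹‖ = 1 := by simp [hz]
  have h0 : z ≠ 0 := by rintro rfl; simp at hz
  have hp := turn_pos hz h1
  have hp' := turn_pos hz' (by simpa using h1)
  have h : turn (z * z⁻¹) = 0 := by rw [mul_inv_cancel₀ h0, turn_one]
  rcases lt_or_ge (turn z + turn z⁻¹) 1 with hlt | hge
  · rw [turn_mul_of_lt hz hz' hlt] at h
    linarith
  · rw [turn_mul_of_le hz hz' hge] at h
    linarith

/-- For `z = exp (2iα)` one has `1 - z = -2i sin α exp (iα)`, and `-i exp (iα) = exp (i(α - π/2))`.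
This polar form yields both the argument and the inverse of `1 - z`. -/
theorem one_sub_eq_turn {z : ℂ} (hz : ‖z‖ = 1) :
    1 - z = ((2 * Real.sin (π * turn z) : ℝ) : ℂ) *
      (Complex.cos ((π * (turn z - 1 / 2) : ℝ) : ℂ) +
        Complex.sin ((π * (turn z - 1 / 2) : ℝ) : ℂ) * I) := by
  have hc : Real.cos (π * (turn z - 1 / 2)) = Real.sin (π * turn z) := by
    rw [← Real.cos_sub_pi_div_two]; ring_nf
  have hs : Real.sin (π * (turn z - 1 / 2)) = - Real.cos (π * turn z) := by
    rw [← Real.sin_sub_pi_div_two]; ring_nf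
  conv_lhs => rw [← exp_turn hz]
  rw [show (2 * π * turn z * I : ℂ) = ((2 * (π * turn z) : ℝ) : ℂ) * I by push_cast; ring,
    exp_mul_I, ← ofReal_cos, ← ofReal_sin, ← ofReal_cos, ← ofReal_sin, hc, hs,
    Real.cos_two_mul, Real.sin_two_mul]
  have := Real.sin_sq_add_cos_sq (π * turn z)
  have h2 : ((Real.sin (π * turn z) : ℝ) : ℂ) ^ 2 + ((Real.cos (π * turn z) : ℝ) : ℂ) ^ 2 = 1 := by
    exact_mod_cast this
  push_cast at h2 ⊢
  linear_combination (-2 : ℂ) * h2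

theorem sin_turn_pos {z : ℂ} (hz : ‖z‖ = 1) (h1 : z ≠ 1) : 0 < Real.sin (π * turn z) := by
  refine Real.sin_pos_of_pos_of_lt_pi (mul_pos Real.pi_pos (turn_pos hz h1)) ?_
  have := mul_lt_mul_of_pos_left (turn_lt_one z) Real.pi_pos
  linarith

theorem arg_one_sub {z : ℂ} (hz : ‖z‖ = 1) (h1 : z ≠ 1) :
    (1 - z).arg = π * (turn z - 1 / 2) := by
  have hp := turn_pos hz h1
  have hl := turn_lt_one z
  rw [one_sub_eq_turn hz]
  refine Complex.arg_mul_cos_add_sin_mul_I (mul_pos two_pos (sin_turn_pos hz h1)) ⟨?_, ?_⟩ <;>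
    nlinarith [Real.pi_pos]

/-- Twice the signed area of the triangle with edge `1` whose apex, the centre of a rotation by
`z`, sees this edge. -/
noncomputable def apexArea (z : ℂ) : ℝ := ((1 - z)⁻¹).im

theorem apexArea_eq {z : ℂ} (hz : ‖z‖ = 1) (h1 : z ≠ 1) :
    apexArea z = Real.cos (π * turn z) / (2 * Real.sin (π * turn z)) := by
  have hs := sin_turn_pos hz h1
  have hsin : Real.sin (π * (turn z - 1 / 2)) = - Real.cos (π * turn z) := by
    rw [← Real.sin_sub_pi_div_two]; ring_nf
  have hsq := Real.sin_sq_add_cos_sq (π * (turn z - 1 / 2))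
  rw [apexArea, one_sub_eq_turn hz, ← ofReal_cos, ← ofReal_sin, Complex.inv_im]
  have him : (((2 * Real.sin (π * turn z) : ℝ) : ℂ) *
      ((Real.cos (π * (turn z - 1 / 2)) : ℝ) + (Real.sin (π * (turn z - 1 / 2)) : ℝ) * I)).im =
      2 * Real.sin (π * turn z) * Real.sin (π * (turn z - 1 / 2)) := by
    have aux (a b c : ℝ) : ((a : ℂ) * (b + c * I)).im = a * c := by simp
    exact aux _ _ _
  have hn : Complex.normSq (((2 * Real.sin (π * turn z) : ℝ) : ℂ) *
      ((Real.cos (π * (turn z - 1 / 2)) : ℝ) + (Real.sin (π * (turn z - 1 / 2)) : ℝ) * I)) =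
      (2 * Real.sin (π * turn z)) ^ 2 := by
    rw [Complex.normSq_mul, Complex.normSq_ofReal, Complex.normSq_add_mul_I]
    rw [show Real.cos (π * (turn z - 1 / 2)) ^ 2 + Real.sin (π * (turn z - 1 / 2)) ^ 2 = 1 by
      linarith]
    ring
  rw [him, hn, hsin]
  field_simp

/-- Here `apexArea` is half a cotangent. The numerator shows that the sign of the sum depends only
on whether the rotation numbers add up to less or more than `1`; this decides the cases in
`exists_subspace_prefix`. -/
theorem apexArea_add {z w : ℂ} (hz : ‖z‖ = 1) (h1 : z ≠ 1) (hw : ‖w‖ = 1) (h1' : w ≠ 1) :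
    apexArea z + apexArea w = Real.sin (π * (turn z + turn w)) /
      (2 * Real.sin (π * turn z) * Real.sin (π * turn w)) := by
  have hs := sin_turn_pos hz h1
  have hs' := sin_turn_pos hw h1'
  rw [apexArea_eq hz h1, apexArea_eq hw h1', mul_add, Real.sin_add]
  field_simp
  ring

theorem apexArea_add_pos {z w : ℂ} (hz : ‖z‖ = 1) (h1 : z ≠ 1) (hw : ‖w‖ = 1) (h1' : w ≠ 1)
    (h : turn z + turn w < 1) : 0 < apexArea z + apexArea w := by
  rw [apexArea_add hz h1 hw h1']
  have hs := sin_turn_pos hz h1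
  have hs' := sin_turn_pos hw h1'
  refine div_pos (Real.sin_pos_of_pos_of_lt_pi ?_ ?_) (by positivity)
  · exact mul_pos Real.pi_pos (add_pos (turn_pos hz h1) (turn_pos hw h1'))
  · have := mul_lt_mul_of_pos_left h Real.pi_pos
    linarith

theorem apexArea_add_neg {z w : ℂ} (hz : ‖z‖ = 1) (h1 : z ≠ 1) (hw : ‖w‖ = 1) (h1' : w ≠ 1)
    (h : 1 < turn z + turn w) : apexArea z + apexArea w < 0 := by
  rw [apexArea_add hz h1 hw h1']
  have hs := sin_turn_pos hz h1
  have hs' := sin_turn_pos hw h1'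
  refine div_neg_of_neg_of_pos ?_ (by positivity)
  have h2 : Real.sin (π * (turn z + turn w) - π) = - Real.sin (π * (turn z + turn w)) :=
    Real.sin_sub_pi _
  have h3 : 0 < Real.sin (π * (turn z + turn w) - π) := by
    refine Real.sin_pos_of_pos_of_lt_pi ?_ ?_
    · nlinarith [Real.pi_pos]
    · nlinarith [Real.pi_pos, turn_lt_one z, turn_lt_one w]
  linarith

theorem apexArea_add_eq_zero {z w : ℂ} (hz : ‖z‖ = 1) (h1 : z ≠ 1) (hw : ‖w‖ = 1) (h1' : w ≠ 1)
    (h : turn z + turn w = 1) : apexArea z + apexArea w = 0 := by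
  rw [apexArea_add hz h1 hw h1', h]
  simp

/-- The map `z ↦ 1 / (1 - z)` sends the unit circle without `1` to the line of real part `1 / 2`. -/
theorem inv_one_sub_eq {z : ℂ} (hz : ‖z‖ = 1) (h1 : z ≠ 1) :
    (1 - z)⁻¹ = 1 / 2 + apexArea z * I := by
  have h0 : 1 - z ≠ 0 := sub_ne_zero.2 h1.symm
  have h0' : (starRingEnd ℂ) (1 - z) ≠ 0 := (map_ne_zero _).2 h0
  have hzz : z * (starRingEnd ℂ) z = 1 := by
    rw [Complex.mul_conj, Complex.normSq_eq_norm_sq, hz]; simp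
  have hre : ((1 - z)⁻¹).re = 1 / 2 := by
    have h2 : (((1 - z)⁻¹).re : ℂ) = 1 / 2 := by
      rw [Complex.re_eq_add_conj, map_inv₀]
      field_simp
      simp only [map_sub, map_one]
      linear_combination -hzz
    exact_mod_cast (by simpa using congrArg Complex.re h2)
  apply Complex.ext
  · simp [hre]
  · simp [apexArea]

/-! ### Values at `1` of the `L`-functions of odd characters -/

section

variable {N : ℕ}

/-- The odd function `k ↦ z ^ k - z ^ (-k)` on `ZMod N`, for `z ^ N = 1`. -/
noncomputable def oddPow (N : ℕ) (z : ℂ) (k : ZMod N) : ℂ := z ^ k.val - z⁻¹ ^ k.val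

theorem pow_val_natCast {z : ℂ} (hz : z ^ N = 1) (n : ℕ) : z ^ (n : ZMod N).val = z ^ n := by
  rw [ZMod.val_natCast, ← pow_eq_pow_mod n hz]

theorem oddPow_natCast {z : ℂ} (hz : z ^ N = 1) (n : ℕ) :
    oddPow N z (n : ZMod N) = z ^ n - z⁻¹ ^ n := by
  rw [oddPow, pow_val_natCast hz, pow_val_natCast (by rw [inv_pow, hz, inv_one])]

variable [NeZero N]

theorem sum_oddPow {z : ℂ} (hz : z ^ N = 1) : ∑ k, oddPow N z k = 0 := by
  have h0 : z ≠ 0 := by rintro rfl; simp [NeZero.ne N] at hz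
  have hneg (k : ZMod N) : oddPow N z (-k) = - oddPow N z k := by
    have h1 : z ^ ((-k).val + k.val) = 1 := by
      rw [← pow_val_natCast hz]; simp
    have h2 : z ^ (-k).val = z⁻¹ ^ k.val := by
      rw [inv_pow, eq_comm, inv_eq_iff_eq_inv, eq_comm, inv_eq_iff_eq_inv]
      rw [pow_add] at h1
      exact eq_inv_of_mul_eq_one_left h1
    have h3 : z⁻¹ ^ (-k).val = z ^ k.val := by
      rw [inv_pow, h2, inv_pow, inv_inv]
    rw [oddPow, oddPow, h2, h3]; ring
  have := Equiv.sum_comp (Equiv.neg (ZMod N)) (oddPow N z)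
  simp only [Equiv.neg_apply, hneg, Finset.sum_neg_distrib] at this
  linear_combination (-1 / 2 : ℂ) * this

/-- Inside the disc the series is `-log (1 - r z)`, and the logarithm is continuous at `1 - z`,
whose argument `π (turn z - 1 / 2)` stays off the branch cut. -/
theorem tendsto_tsum_pow_div {z : ℂ} (hz : ‖z‖ = 1) (h1 : z ≠ 1) :
    Tendsto (fun r : ℝ => ∑' n : ℕ, z ^ n / n * (r : ℂ) ^ n) (𝓝[<] 1) (𝓝 (-log (1 - z))) := by
  have hev : (fun r : ℝ => -log (1 - r * z)) =ᶠ[𝓝[<] (1 : ℝ)]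
      fun r : ℝ => ∑' n : ℕ, z ^ n / n * (r : ℂ) ^ n := by
    have hnhds : Set.Ioo (0 : ℝ) 1 ∈ 𝓝[<] (1 : ℝ) := Ioo_mem_nhdsLT zero_lt_one
    filter_upwards [hnhds] with r hr
    have hn : ‖(r : ℂ) * z‖ < 1 := by
      rw [norm_mul, hz, mul_one, norm_real, Real.norm_of_nonneg hr.1.le]; exact hr.2
    rw [← (hasSum_taylorSeries_neg_log hn).tsum_eq]
    refine tsum_congr fun n => ?_
    rw [mul_pow]; ring
  refine Tendsto.congr' hev ?_
  have hslit : 1 - z ∈ slitPlane := by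
    rw [Complex.mem_slitPlane_iff_arg]
    refine ⟨?_, sub_ne_zero.2 h1.symm⟩
    rw [arg_one_sub hz h1]
    have := turn_lt_one z
    nlinarith [Real.pi_pos]
  have hc : ContinuousAt (fun r : ℝ => -log (1 - r * z)) 1 := by
    refine ContinuousAt.neg (ContinuousAt.clog (by fun_prop) ?_)
    simpa using hslit
  have := hc.tendsto.mono_left (nhdsWithin_le_nhds (s := Set.Iio 1))
  simpa using this

theorem summable_pow_div_mul {z : ℂ} (hz : ‖z‖ = 1) {r : ℝ} (hr : r ∈ Set.Ioo (0 : ℝ) 1) :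
    Summable fun n : ℕ => z ^ n / n * (r : ℂ) ^ n := by
  have hn : ‖(r : ℂ) * z‖ < 1 := by
    rw [norm_mul, hz, mul_one, norm_real, Real.norm_of_nonneg hr.1.le]; exact hr.2
  refine (hasSum_taylorSeries_neg_log hn).summable.congr fun n => ?_
  rw [mul_pow]; ring

/-- The series at `1` converges, so by Abel's limit theorem its sum is the radial limit of `-log (1
- r z) + log (1 - r z⁻¹)`. The moduli cancel, and the arguments `π (turn - 1 / 2)` remain. -/
theorem LFunction_oddPow {z : ℂ} (hz : z ^ N = 1) :
    ZMod.LFunction (oddPow N z) 1 = - (π * I) * ((turn z - turn z⁻¹ : ℝ) : ℂ) := by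
  have hn : ‖z‖ = 1 := Complex.norm_eq_one_of_pow_eq_one hz (NeZero.ne N)
  have hn' : ‖z⁻¹‖ = 1 := by simp [hn]
  rcases eq_or_ne z 1 with rfl | h1
  · have : oddPow N 1 = 0 := by funext k; simp [oddPow]
    rw [this]
    simp [ZMod.LFunction]
  have h1' : z⁻¹ ≠ 1 := by simpa using h1
  have hs := tendsto_sum_LFunction_one (sum_oddPow hz) (by simp [oddPow])
  have ha := Complex.tendsto_tsum_powerSeries_nhdsWithin_lt hs
  rw [tendsto_map'_iff] at ha
  have hb := (tendsto_tsum_pow_div hn h1).sub (tendsto_tsum_pow_div hn' h1')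
  have hab : (fun r : ℝ => ∑' n : ℕ, z ^ n / n * (r : ℂ) ^ n - ∑' n : ℕ, z⁻¹ ^ n / n * (r : ℂ) ^ n)
      =ᶠ[𝓝[<] (1 : ℝ)] (fun w : ℂ => ∑' n : ℕ, oddPow N z (n : ZMod N) / n * w ^ n) ∘ ofReal := by
    have hnhds : Set.Ioo (0 : ℝ) 1 ∈ 𝓝[<] (1 : ℝ) := Ioo_mem_nhdsLT zero_lt_one
    filter_upwards [hnhds] with r hr
    rw [← (summable_pow_div_mul hn hr).tsum_sub (summable_pow_div_mul hn' hr)]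
    refine tsum_congr fun n => ?_
    rw [oddPow_natCast hz]
    ring
  have hlim := tendsto_nhds_unique (ha.congr' hab.symm) hb
  rw [hlim]
  have harg := arg_one_sub hn h1
  have harg' := arg_one_sub hn' h1'
  have hnorm : ‖1 - z⁻¹‖ = ‖1 - z‖ := by
    have h0 : z ≠ 0 := by rintro rfl; simp at hn
    have : 1 - z⁻¹ = -(z⁻¹ * (1 - z)) := by field_simp; ring
    rw [this, norm_neg, norm_mul, hn', one_mul]
  rw [Complex.log, Complex.log, harg, harg', hnorm]
  push_cast
  ring

end

end SingularOrbit

/-! ### Non-vanishing of `L(ψ, 1)` detects odd functions on a finite abelian group. -/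

namespace SingularOrbit

open Filter Topology Complex
open scoped Real

theorem LFunction_sum_mul {N : ℕ} [NeZero N] {ι : Type*} (s : Finset ι) (c : ι → ℂ)
    (Φ : ι → ZMod N → ℂ) (w : ℂ) :
    ZMod.LFunction (fun k => ∑ i ∈ s, c i * Φ i k) w = ∑ i ∈ s, c i * ZMod.LFunction (Φ i) w := by
  simp only [ZMod.LFunction, Finset.sum_mul, Finset.mul_sum]
  rw [Finset.sum_comm]
  exact Finset.sum_congr rfl fun i _ => Finset.sum_congr rfl fun j _ => by ring

/-- The rotation numbers of the values of all characters determine the odd part of a function on a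
finite abelian group. -/
theorem sum_mul_sub_inv_eq_zero {A : Type*} [AddCommGroup A] [Fintype A] (m : A → ℂ)
    (H : ∀ χ : AddChar A ℂ, ∑ g, m g * ((turn (χ g) - turn (χ g)⁻¹ : ℝ) : ℂ) = 0)
    (χ : AddChar A ℂ) : ∑ g, m g * (χ g - (χ g)⁻¹) = 0 := by
  -- Powers `χ ^ k` with `k` not prime to the order `N` have smaller order, so their sums are
  -- already known to vanish.
  induction hN : orderOf χ using Nat.strong_induction_on generalizing χ with
  | _ N ih =>
  have hN0 : N ≠ 0 := by rw [← hN]; exact (orderOf_pos χ).ne'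
  have : NeZero N := ⟨hN0⟩
  have hpow (g : A) : χ g ^ N = 1 := by
    rw [← AddChar.pow_apply, ← hN, pow_orderOf_eq_one, AddChar.one_apply]
  -- `Φ k` is the sum in question for `χ ^ k`, so that the goal is `Φ 1 = 0`.
  set Φ : ZMod N → ℂ := fun k => ∑ g, m g * oddPow N (χ g) k with hΦ
  have hΦnat (n : ℕ) : Φ n = ∑ g, m g * ((χ ^ n) g - ((χ ^ n) g)⁻¹) := by
    refine Finset.sum_congr rfl fun g _ => ?_
    rw [oddPow_natCast (hpow g), AddChar.pow_apply, inv_pow]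
  -- This is the hypothesis `H` for `χ ^ a`, translated into an `L`-value.
  have hL (a : ℕ) : ZMod.LFunction (fun k : ZMod N => Φ (a * k)) 1 = 0 := by
    have h1 : (fun k : ZMod N => Φ (a * k)) = fun k => ∑ g, m g * oddPow N (χ g ^ a) k := by
      funext k
      obtain ⟨n, rfl⟩ := ZMod.natCast_zmod_surjective k
      rw [← Nat.cast_mul, hΦnat]
      refine Finset.sum_congr rfl fun g _ => ?_
      rw [oddPow_natCast (by rw [pow_right_comm, hpow, one_pow]), AddChar.pow_apply, pow_mul,
        inv_pow]
    rw [h1, LFunction_sum_mul]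
    have h2 := H (χ ^ a)
    simp only [AddChar.pow_apply] at h2
    calc _ = -(π * I) * ∑ g, m g * ((turn (χ g ^ a) - turn (χ g ^ a)⁻¹ : ℝ) : ℂ) := by
          rw [Finset.mul_sum]
          refine Finset.sum_congr rfl fun g _ => ?_
          rw [LFunction_oddPow (by rw [pow_right_comm, hpow, one_pow])]
          ring
      _ = 0 := by rw [h2, mul_zero]
  have hnonunit (k : ZMod N) (hk : ¬ IsUnit k) : Φ k = 0 := by
    obtain ⟨n, rfl⟩ := ZMod.natCast_zmod_surjective k
    rw [hΦnat]
    refine ih _ ?_ _ rfl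
    rw [orderOf_pow, hN]
    rw [ZMod.isUnit_iff_coprime, Nat.coprime_comm] at hk
    have hg : N.gcd n ≠ 0 := by simp [hN0]
    have hg1 : N.gcd n ≠ 1 := hk
    exact Nat.div_lt_self (Nat.pos_of_ne_zero hN0) (by omega)
  have hodd (k : ZMod N) : Φ (-k) = - Φ k := by
    obtain ⟨n, rfl⟩ := ZMod.natCast_zmod_surjective k
    have hn : (-(n : ZMod N)) = ((n * (N - 1) : ℕ) : ZMod N) := by
      rw [Nat.cast_mul, Nat.cast_sub (Nat.pos_of_ne_zero hN0)]
      simp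
    have hinv (g : A) : (χ g ^ n) ^ (N - 1) = (χ g ^ n)⁻¹ := by
      have h : (χ g ^ n) ^ (N - 1) * (χ g ^ n) = 1 := by
        rw [← pow_succ, Nat.sub_add_cancel (Nat.pos_of_ne_zero hN0), pow_right_comm, hpow, one_pow]
      exact eq_inv_of_mul_eq_one_left h
    rw [hn, hΦnat, hΦnat, ← Finset.sum_neg_distrib]
    refine Finset.sum_congr rfl fun g _ => ?_
    rw [AddChar.pow_apply, AddChar.pow_apply, pow_mul, hinv, inv_inv]
    ring
  have hG (ψ : DirichletCharacter ℂ N) : ∑ a, ψ a * Φ a = 0 := by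
    -- The trivial character gives no usable `L`-value at `1`; it is even while `Φ` is odd, so its
    -- sum vanishes anyway.
    rcases eq_or_ne ψ 1 with rfl | hψ
    · have h := Equiv.sum_comp (Equiv.neg (ZMod N)) fun a => (1 : DirichletCharacter ℂ N) a * Φ a
      have h1 (a : ZMod N) : (1 : DirichletCharacter ℂ N) (-a) = (1 : DirichletCharacter ℂ N) a := by
        rw [← neg_one_mul, map_mul, MulChar.one_apply (isUnit_one.neg), one_mul]
      simp only [Equiv.neg_apply, h1, hodd, mul_neg, Finset.sum_neg_distrib] at h
      linear_combination (-1 / 2 : ℂ) * h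
    · have hψ' : ψ⁻¹ ≠ 1 := by simpa using hψ
      -- For a unit `k` this is a substitution; for a nonunit all `a * k` are nonunits, where `Φ`
      -- vanishes. Averaging against `ψ` thus turns `Φ` into a multiple of `ψ⁻¹`, whose `L`-value at
      -- `1` is not zero.
      have h1 (k : ZMod N) : ∑ a : ZMod N, ψ a * Φ (a * k) = (∑ a, ψ a * Φ a) * ψ⁻¹ k := by
        by_cases hk : IsUnit k
        · obtain ⟨u, rfl⟩ := hk
          rw [← Equiv.sum_comp (Units.mulRight u) fun a => ψ a * Φ a, Finset.sum_mul]
          refine Finset.sum_congr rfl fun a _ => ?_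
          simp only [Units.mulRight_apply, map_mul]
          have h2 : ψ u * ψ⁻¹ u = 1 := by
            rw [← MulChar.mul_apply, mul_inv_cancel, MulChar.one_apply u.isUnit]
          linear_combination (-(ψ a * Φ (a * u))) * h2
        · rw [MulChar.map_nonunit _ hk, mul_zero]
          refine Finset.sum_eq_zero fun a _ => ?_
          rw [hnonunit _ fun h => hk (isUnit_of_mul_isUnit_right h), mul_zero]
      have h2 : ZMod.LFunction (fun k => ∑ a : ZMod N, ψ a * Φ (a * k)) 1 = 0 := by
        rw [LFunction_sum_mul Finset.univ (fun a => ψ a) (fun a k => Φ (a * k))]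
        refine Finset.sum_eq_zero fun a _ => ?_
        obtain ⟨n, rfl⟩ := ZMod.natCast_zmod_surjective a
        rw [hL, mul_zero]
      have h3 := LFunction_sum_mul {()} (fun _ => ∑ a, ψ a * Φ a) (fun _ k => (ψ⁻¹ : DirichletCharacter ℂ N) k) 1
      simp only [Finset.sum_singleton] at h3
      simp only [h1] at h2
      rw [h2] at h3
      exact (mul_eq_zero.1 h3.symm).resolve_right
        (DirichletCharacter.LFunction_apply_one_ne_zero hψ')
  -- By orthogonality the sum over all `ψ` is `Φ 1` times the totient of `N`.
  have h := Finset.sum_eq_zero fun ψ (_ : ψ ∈ (Finset.univ : Finset (DirichletCharacter ℂ N))) =>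
    hG ψ
  rw [Finset.sum_comm] at h
  simp only [← Finset.sum_mul, DirichletCharacter.sum_characters_eq, ite_mul, zero_mul,
    Finset.sum_ite_eq', Finset.mem_univ, if_true] at h
  have h1 : Φ 1 = 0 := (mul_eq_zero.1 h).resolve_left (by
    exact_mod_cast (Nat.totient_pos.2 (Nat.pos_of_ne_zero hN0)).ne')
  have := hΦnat 1
  rw [Nat.cast_one, h1] at this
  simpa using this.symm

end SingularOrbit

/-! ### Character orthogonality and permutation characters. -/

namespace SingularOrbit

open Filter Topology Complex
open scoped Real

universe u

/-! ### Characters of a finite abelian group -/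

section Dual

variable (G : Type u) [CommGroup G]

/-- The characters of a commutative group. -/
abbrev Dual : Type u := AddChar (Additive G) ℂ

variable {G}

/-- A character as a homomorphism to `ℂ`. -/
def Dual.hom (χ : Dual G) : G →* ℂ where
  toFun g := χ (Additive.ofMul g)
  map_one' := χ.map_zero_eq_one
  map_mul' _ _ := χ.map_add_eq_mul _ _

theorem Dual.inv_hom (χ : Dual G) (g : G) : (χ⁻¹).hom g = (χ.hom g)⁻¹ :=
  AddChar.inv_apply' χ _

theorem Dual.one_hom (g : G) : (1 : Dual G).hom g = 1 := rfl

theorem Dual.hom_ne_zero (χ : Dual G) (g : G) : χ.hom g ≠ 0 :=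
  ((Group.isUnit g).map χ.hom).ne_zero

theorem Dual.hom_inv (χ : Dual G) (g : G) : χ.hom g⁻¹ = (χ.hom g)⁻¹ := by
  exact eq_inv_of_mul_eq_one_left (by rw [← map_mul, inv_mul_cancel, map_one])

variable [Fintype G]

theorem Dual.norm_hom (χ : Dual G) (g : G) : ‖χ.hom g‖ = 1 := AddChar.norm_apply χ _

theorem Dual.conj_hom (χ : Dual G) (g : G) : (starRingEnd ℂ) (χ.hom g) = (χ.hom g)⁻¹ :=
  (Complex.inv_eq_conj (χ.norm_hom g)).symm

open Classical in
theorem sum_dual_hom (g : G) :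
    ∑ χ : Dual G, χ.hom g = if g = 1 then (Fintype.card G : ℂ) else 0 := by
  have h := AddChar.sum_apply_eq_ite (Additive.ofMul g)
  rw [Fintype.card_congr (Additive.toMul (α := G))] at h
  exact h

open Classical in
theorem sum_hom (χ : Dual G) : ∑ g, χ.hom g = if χ = 1 then (Fintype.card G : ℂ) else 0 := by
  have h := AddChar.sum_eq_ite χ
  rw [Fintype.card_congr (Additive.toMul (α := G))] at h
  exact (Fintype.sum_equiv Additive.ofMul _ _ fun _ => rfl).trans h

/-- Fourier inversion: weighting by `(χ g)⁻¹` and summing over `χ` isolates `d g` times the order of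
`G`. -/
theorem eq_zero_of_sum_mul_hom {d : G → ℂ} (h : ∀ χ : Dual G, ∑ g, d g * χ.hom g = 0) (g : G) :
    d g = 0 := by
  classical
  have h1 : ∑ χ : Dual G, (χ.hom g)⁻¹ * ∑ x, d x * χ.hom x = 0 := by simp [h]
  simp only [Finset.mul_sum] at h1
  rw [Finset.sum_comm] at h1
  have h2 (x : G) : ∑ χ : Dual G, (χ.hom g)⁻¹ * (d x * χ.hom x) =
      if x = g then d x * (Fintype.card G : ℂ) else 0 := by
    calc _ = d x * ∑ χ : Dual G, χ.hom (x * g⁻¹) := by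
          rw [Finset.mul_sum]
          refine Finset.sum_congr rfl fun χ _ => ?_
          rw [map_mul, χ.hom_inv]; ring
      _ = _ := by rw [sum_dual_hom]; simp [mul_inv_eq_one]
  simp only [h2, Finset.sum_ite_eq', Finset.mem_univ, if_true] at h1
  exact (mul_eq_zero.1 h1).resolve_right (by simp)

theorem eq_zero_of_sum_mul_dual {d : Dual G → ℂ} (h : ∀ g, ∑ χ : Dual G, d χ * χ.hom g = 0)
    (χ : Dual G) : d χ = 0 := by
  classical
  have h1 : ∑ g, (χ.hom g)⁻¹ * ∑ ψ : Dual G, d ψ * ψ.hom g = 0 := by simp [h]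
  simp only [Finset.mul_sum] at h1
  rw [Finset.sum_comm] at h1
  have h2 (ψ : Dual G) : ∑ g, (χ.hom g)⁻¹ * (d ψ * ψ.hom g) =
      if ψ = χ then d ψ * (Fintype.card G : ℂ) else 0 := by
    calc _ = d ψ * ∑ g, (ψ * χ⁻¹).hom g := by
          rw [Finset.mul_sum]
          refine Finset.sum_congr rfl fun g _ => ?_
          rw [show (ψ * χ⁻¹).hom g = ψ.hom g * χ⁻¹.hom g from rfl, χ.inv_hom]; ring
      _ = _ := by rw [sum_hom]; simp [mul_inv_eq_one]
  simp only [h2, Finset.sum_ite_eq', Finset.mem_univ, if_true] at h1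
  exact (mul_eq_zero.1 h1).resolve_right (by simp)

end Dual

/-! ### The group generated by permutation characters -/

section Permutation

theorem character_ofMulAction {G : Type*} [Group G] {X : Type*} [MulAction G X] [Fintype X]
    [DecidableEq X] (g : G) :
    (Representation.ofMulAction ℂ G X).character g =
      ((Finset.univ.filter fun x : X => g • x = x).card : ℂ) := by
  rw [Representation.character, LinearMap.trace_eq_matrix_trace ℂ (MonoidAlgebra.basis X ℂ),
    Matrix.trace]
  simp only [Matrix.diag_apply, LinearMap.toMatrix_apply, MonoidAlgebra.basis_apply,
    Representation.ofMulAction_single]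
  rw [← Finset.sum_boole]
  refine Finset.sum_congr rfl fun x _ => ?_
  simp [MonoidAlgebra.basis, Finsupp.single_apply]

variable {G : Type u} [CommGroup G] [Fintype G]

/-- Permutation characters count fixed points. Reality is the only property of `E_G` that
injectivity needs. -/
theorem conj_of_mem_indTrivial {f : G → ℂ} (hf : f ∈ indTrivial G) (g : G) :
    (starRingEnd ℂ) (f g) = f g := by
  classical
  induction hf using AddSubgroup.closure_induction with
  | mem f hf =>
    obtain ⟨H, rfl⟩ := hf
    rw [character_ofMulAction]
    simp
  | zero => simp
  | add f f' _ _ h h' => simp [h, h']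
  | neg f _ h => simp [h]

open Classical in
/-- The sum of the characters that are trivial on `γ`. -/
noncomputable def sumTrivialOn (γ g : G) : ℂ :=
  ∑ χ : Dual G, if χ.hom γ = 1 then χ.hom g else 0

/-- The characters trivial on `γ` are those of `G / ⟨γ⟩`, and their sum is the permutation character
on the cosets of `⟨γ⟩`. For `γ = 1` it is the regular character. -/
theorem sumTrivialOn_mem (γ : G) : sumTrivialOn γ ∈ indTrivial G := by
  classical
  refine AddSubgroup.subset_closure ⟨Subgroup.zpowers γ, ?_⟩
  funext g
  have hγ : 0 < orderOf γ := orderOf_pos γ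
  rw [character_ofMulAction]
  have hfix (x : G ⧸ Subgroup.zpowers γ) : g • x = x ↔ g ∈ Subgroup.zpowers γ := by
    induction x using QuotientGroup.induction_on with
    | H x =>
      rw [MulAction.Quotient.smul_mk, QuotientGroup.eq, smul_eq_mul, mul_comm g x, mul_inv_rev,
        mul_assoc, inv_mul_cancel, mul_one, inv_mem_iff]
  -- The condition `χ γ = 1` is replaced by an average over the powers of `γ`, after which
  -- orthogonality in `χ` applies.
  have hgeom (χ : Dual G) : (if χ.hom γ = 1 then χ.hom g else 0) =
      (orderOf γ : ℂ)⁻¹ * ∑ k ∈ Finset.range (orderOf γ), χ.hom (γ ^ k * g) := by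
    have h0 : (orderOf γ : ℂ) ≠ 0 := by exact_mod_cast hγ.ne'
    simp only [map_mul, map_pow, ← Finset.sum_mul]
    split_ifs with h
    · rw [h]; simp [h0]
    · rw [geom_sum_eq h, ← map_pow, pow_orderOf_eq_one, map_one]; simp
  rw [sumTrivialOn, Finset.sum_congr rfl fun χ _ => hgeom χ, ← Finset.mul_sum, Finset.sum_comm]
  simp only [sum_dual_hom, hfix]
  have hcard : (Nat.card G : ℂ) = Fintype.card (G ⧸ Subgroup.zpowers γ) * orderOf γ := by
    rw [← Nat.cast_mul, (Subgroup.zpowers γ).card_eq_card_quotient_mul_card_subgroup,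
      Nat.card_zpowers, Nat.card_eq_fintype_card]
  rw [Nat.card_eq_fintype_card] at hcard
  have h0 : (orderOf γ : ℂ) ≠ 0 := by exact_mod_cast hγ.ne'
  by_cases hg : g ∈ Subgroup.zpowers γ
  · obtain ⟨n, hn, hng⟩ : ∃ n < orderOf γ, γ ^ n = g⁻¹ :=
      (mem_zpowers_iff_mem_range_orderOf.1 (inv_mem hg)) |> Finset.mem_image.1 |>.imp
        fun n hn => ⟨Finset.mem_range.1 hn.1, hn.2⟩
    rw [Finset.sum_eq_single_of_mem n (Finset.mem_range.2 hn), hng, inv_mul_cancel, if_pos rfl,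
      hcard]
    · simp only [hg, Finset.filter_true, Finset.card_univ]
      field_simp
    · intro k hk hkn
      refine if_neg fun h => hkn ?_
      rw [mul_eq_one_iff_eq_inv, ← hng] at h
      exact pow_injOn_Iio_orderOf (Finset.mem_range.1 hk) hn h
  · rw [Finset.sum_eq_zero, mul_zero]
    · simp [hg]
    · intro k _
      refine if_neg fun h => hg ?_
      rw [mul_eq_one_iff_inv_eq] at h
      rw [← h]
      exact inv_mem (pow_mem (Subgroup.mem_zpowers γ) k)

end Permutation

end SingularOrbit

/-! ### Construction of `θ` from rotation numbers. -/

namespace SingularOrbit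

open Complex
open scoped Real

universe u

/-! ### Homomorphisms out of the group of singular orbit data -/

theorem exists_orbitData_hom {G : Type u} [Group G] {B : Type*} [AddCommMonoid B]
    (φ : Tuples G →+ B) (h1 : ∀ s t, unitRel G s t → φ s = φ t)
    (h2 : ∀ (γ : G) (s : Tuples G),
      (s : Multiset (ConjClasses G)) = {ConjClasses.mk γ, ConjClasses.mk γ⁻¹} → φ s = 0) :
    ∃ θ : OrbitData G →+ B, ∀ s, θ (OrbitData.mk G s) = φ s := by
  have hle : addConGen (unitRel G) ≤ AddCon.ker φ := AddCon.addConGen_le.2 fun s t h => h1 s t h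
  have hle2 : addConGen (cancelRel G) ≤ AddCon.ker (AddCon.lift _ φ hle) :=
    AddCon.addConGen_le.2 (by
      rintro x y ⟨rfl, γ, s, hs, rfl⟩
      change AddCon.lift _ φ hle _ = AddCon.lift _ φ hle 0
      rw [map_zero]
      exact h2 γ s hs)
  exact ⟨AddCon.lift _ _ hle2, fun s => rfl⟩

variable {G : Type u} [CommGroup G]

/-- The element of a conjugacy class of a commutative group. -/
def conjElt : ConjClasses G ≃ G := ConjClasses.mkEquiv.symm

theorem conjElt_mk (g : G) : conjElt (ConjClasses.mk g) = g := rfl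

theorem mk_conjElt (c : ConjClasses G) : ConjClasses.mk (conjElt c) = c :=
  ConjClasses.mkEquiv.apply_symm_apply c

/-- The sum of the rotation numbers of `χ⁻¹` on the entries of a tuple. -/
noncomputable def rotSum : Multiset (ConjClasses G) →+ (Dual G → ℝ) :=
  Multiset.sumAddMonoidHom.comp
    (Multiset.mapAddMonoidHom fun c (χ : Dual G) => turn (χ⁻¹.hom (conjElt c)))

theorem rotSum_cons (c : ConjClasses G) (s : Multiset (ConjClasses G)) (χ : Dual G) :
    rotSum (c ::ₘ s) χ = turn (χ⁻¹.hom (conjElt c)) + rotSum s χ := by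
  simp [rotSum]

theorem psi_eq_zero_iff (s : Multiset (ConjClasses G)) :
    psi G s = 0 ↔ (s.map conjElt).prod = 1 := by
  have h : psi G s = Additive.ofMul (Abelianization.of (s.map conjElt).prod) := by
    induction s using Multiset.induction_on with
    | empty => simp
    | cons c s ih =>
      rw [← Multiset.singleton_add, map_add, ih, Multiset.map_add, Multiset.prod_add, map_mul,
        ofMul_mul]
      congr 1
      obtain ⟨a, rfl⟩ := ConjClasses.mk_surjective c
      simp [psi, conjElt_mk]
      rfl
  rw [h, ofMul_eq_zero]
  exact (Abelianization.equivOfComm (H := G)).map_eq_one_iff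

theorem hom_mem_repRing (χ : Dual G) : (χ.hom : G → ℂ) ∈ repRing G := by
  refine AddSubgroup.subset_closure ⟨1,
    ((algebraMap ℂ (Module.End ℂ (EuclideanSpace ℂ (Fin 1)))) : _ →* _).comp χ.hom, ?_⟩
  funext g
  have : ((((algebraMap ℂ (Module.End ℂ (EuclideanSpace ℂ (Fin 1)))) : _ →* _).comp χ.hom) g) =
      χ.hom g • (1 : Module.End ℂ (EuclideanSpace ℂ (Fin 1))) :=
    Algebra.algebraMap_eq_smul_one (χ.hom g)
  rw [Representation.character, this, map_smul, LinearMap.trace_one]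
  simp

variable [Fintype G]

/-- Rotation numbers are additive modulo integers. When the product is `1` the sum is an integer, as
a multiplicity in a virtual character has to be. -/
theorem exists_rotSum_sub_eq (s : Multiset (ConjClasses G)) (χ : Dual G) :
    ∃ k : ℤ, rotSum s χ = turn (χ⁻¹.hom (s.map conjElt).prod) + k := by
  induction s using Multiset.induction_on with
  | empty => exact ⟨0, by simp [turn_one]⟩
  | cons c s ih =>
    obtain ⟨k, hk⟩ := ih
    rw [rotSum_cons, hk, Multiset.map_cons, Multiset.prod_cons, map_mul,
      turn_mul (Dual.norm_hom _ _) (Dual.norm_hom _ _), Int.fract]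
    exact ⟨⌊turn (χ⁻¹.hom (conjElt c)) + turn (χ⁻¹.hom (s.map conjElt).prod)⌋ + k, by
      push_cast; ring⟩

theorem exists_rotSum_eq (s : Tuples G) (χ : Dual G) : ∃ k : ℤ, rotSum s.1 χ = k := by
  obtain ⟨k, hk⟩ := exists_rotSum_sub_eq s.1 χ
  refine ⟨k, ?_⟩
  rw [hk, (psi_eq_zero_iff _).1 (AddMonoidHom.mem_mker.1 s.2), map_one, turn_one, zero_add]

/-- The virtual character with given multiplicities. -/
noncomputable def charSum : (Dual G → ℝ) →+ (G → ℂ) where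
  toFun n g := ∑ χ : Dual G, (n χ : ℂ) * χ.hom g
  map_zero' := by funext g; simp
  map_add' n m := by funext g; simp [add_mul, Finset.sum_add_distrib]

theorem charSum_mem_repRing {n : Dual G → ℝ} (hn : ∀ χ, ∃ k : ℤ, n χ = k) :
    charSum n ∈ repRing G := by
  choose k hk using hn
  have : charSum n = ∑ χ : Dual G, k χ • (χ.hom : G → ℂ) := by
    funext g
    simp [charSum, hk]
  rw [this]
  exact sum_mem fun χ _ => zsmul_mem (hom_mem_repRing χ) _

/-- Rotation numbers of inverse values add up to `1` unless the value is `1`, so this is the regular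
character minus the one induced from `⟨γ⟩`. It is what kills the cancelling pairs. -/
theorem charSum_boole_mem_indTrivial (γ : G) :
    charSum (fun χ => turn (χ⁻¹.hom γ) + turn (χ.hom γ)) ∈ indTrivial G := by
  classical
  have : charSum (fun χ => turn (χ⁻¹.hom γ) + turn (χ.hom γ)) =
      sumTrivialOn 1 - sumTrivialOn γ := by
    funext g
    simp only [charSum, sumTrivialOn, AddMonoidHom.coe_mk, ZeroHom.coe_mk, Pi.sub_apply,
      ← Finset.sum_sub_distrib, map_one, if_true]
    refine Finset.sum_congr rfl fun χ _ => ?_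
    by_cases h : χ.hom γ = 1
    · simp [χ.inv_hom, h, turn_one]
    · rw [χ.inv_hom, turn_inv (χ.norm_hom γ) h]
      simp [h]
  rw [this]
  exact sub_mem (sumTrivialOn_mem 1) (sumTrivialOn_mem γ)

/-- Complex conjugation exchanges `χ` and `χ⁻¹`, and it fixes the elements of `E_G`. -/
theorem symm_of_charSum_mem_indTrivial {n : Dual G → ℝ} (h : charSum n ∈ indTrivial G)
    (χ : Dual G) : n χ = n χ⁻¹ := by
  have h1 (g : G) : ∑ ψ : Dual G, ((n ψ - n ψ⁻¹ : ℝ) : ℂ) * ψ.hom g = 0 := by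
    have h2 := conj_of_mem_indTrivial h g
    simp only [charSum, AddMonoidHom.coe_mk, ZeroHom.coe_mk, map_sum, map_mul, conj_ofReal,
      Dual.conj_hom, ← Dual.inv_hom] at h2
    rw [← Equiv.sum_comp (Equiv.inv (Dual G))] at h2
    simp only [Equiv.inv_apply, inv_inv] at h2
    simp only [ofReal_sub, sub_mul, Finset.sum_sub_distrib, h2, sub_self]
  have := eq_zero_of_sum_mul_dual h1 χ
  exact sub_eq_zero.1 (by exact_mod_cast this)

/-- The class of the virtual character with the given integral multiplicities. -/
theorem exists_theta : ∃ θ : OrbitData G →+ RepQuot G, ∀ s : Tuples G,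
    ∃ h : charSum (rotSum s.1) ∈ repRing G,
      θ (OrbitData.mk G s) = QuotientAddGroup.mk ⟨charSum (rotSum s.1), h⟩ := by
  let φ₀ : Tuples G →+ repRing G :=
    ((charSum.comp rotSum).comp (AddMonoidHom.mker (psi G)).subtype).codRestrict (repRing G)
      fun s => charSum_mem_repRing (exists_rotSum_eq s)
  let φ : Tuples G →+ RepQuot G := (QuotientAddGroup.mk' _).comp φ₀
  suffices h : ∃ θ : OrbitData G →+ RepQuot G, ∀ s, θ (OrbitData.mk G s) = φ s by
    obtain ⟨θ, hθ⟩ := h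
    exact ⟨θ, fun s => ⟨charSum_mem_repRing (exists_rotSum_eq s), hθ s⟩⟩
  refine exists_orbitData_hom φ ?_ ?_
  · intro s t h
    have : rotSum s.1 = rotSum t.1 := by
      funext χ
      rw [show t.1 = 1 ::ₘ s.1 from h, rotSum_cons, show (1 : ConjClasses G) = ConjClasses.mk 1 from
        rfl, conjElt_mk, map_one, turn_one, zero_add]
    have h2 : φ₀ s = φ₀ t := Subtype.ext (congrArg charSum this)
    exact congrArg (QuotientAddGroup.mk' _) h2
  · intro γ s h
    refine (QuotientAddGroup.eq_zero_iff _).2 ?_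
    rw [AddSubgroup.mem_addSubgroupOf]
    change charSum (rotSum s.1) ∈ _
    convert charSum_boole_mem_indTrivial γ using 2
    funext χ
    rw [h, Multiset.insert_eq_cons, rotSum_cons, ← Multiset.cons_zero, rotSum_cons, conjElt_mk,
      conjElt_mk, map_zero, Dual.hom_inv, ← Dual.inv_hom, inv_inv]
    simp

end SingularOrbit

/-! ### Even tuples vanish when there is at most one involution. -/

namespace SingularOrbit

open Complex
open scoped Real

universe u

/-! ### Torsion-freeness and injectivity -/

section Involution

variable {G : Type*} [CommGroup G]

theorem exists_injective_of_involutions {σ τ : G} (hσ : σ ^ 2 = 1) (hτ : τ ^ 2 = 1) (hσ1 : σ ≠ 1)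
    (hτ1 : τ ≠ 1) (hne : σ ≠ τ) :
    ∃ f : Multiplicative (ZMod 2 × ZMod 2) →* G, Function.Injective f := by
  have hsm (x : G) (hx : x ^ 2 = 1) : 2 • Additive.ofMul x = 0 := by
    rw [← ofMul_pow, hx, ofMul_one]
  let lft (x : G) (hx : x ^ 2 = 1) : ZMod 2 →+ Additive G :=
    ZMod.lift 2 ⟨(zmultiplesHom (Additive G)) (Additive.ofMul x), by
      simpa [← natCast_zsmul] using hsm x hx⟩
  have hl1 (x : G) (hx : x ^ 2 = 1) : lft x hx 1 = Additive.ofMul x := by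
    have := ZMod.lift_coe 2 ⟨(zmultiplesHom (Additive G)) (Additive.ofMul x), by
      simpa [← natCast_zsmul] using hsm x hx⟩ 1
    simpa using this
  have h2 (a : ZMod 2) : a = 0 ∨ a = 1 := by revert a; decide
  let F : ZMod 2 × ZMod 2 →+ Additive G := (lft σ hσ).coprod (lft τ hτ)
  have hF : Function.Injective F := by
    rw [injective_iff_map_eq_zero]
    rintro ⟨a, b⟩ h
    simp only [F, AddMonoidHom.coprod_apply] at h
    rcases h2 a with rfl | rfl <;> rcases h2 b with rfl | rfl
    · rfl
    · rw [map_zero, zero_add, hl1 τ hτ] at h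
      exact absurd (ofMul_eq_zero.1 h) hτ1
    · rw [map_zero, add_zero, hl1 σ hσ] at h
      exact absurd (ofMul_eq_zero.1 h) hσ1
    · rw [hl1 σ hσ, hl1 τ hτ, ← ofMul_mul, ofMul_eq_zero] at h
      refine absurd ?_ hne
      calc σ = σ * (τ ^ 2) := by rw [hτ, mul_one]
        _ = (σ * τ) * τ := by rw [pow_two, mul_assoc]
        _ = τ := by rw [h, one_mul]
  exact ⟨AddMonoidHom.toMultiplicativeLeft F, fun x y h => hF h⟩

end Involution

variable {G : Type u} [CommGroup G]

theorem conjElt_conjInv (c : ConjClasses G) : conjElt (conjInv G c) = (conjElt c)⁻¹ := by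
  obtain ⟨a, rfl⟩ := ConjClasses.mk_surjective c
  rfl

theorem conjInv_conjInv (c : ConjClasses G) : conjInv G (conjInv G c) = c := by
  apply conjElt.injective
  rw [conjElt_conjInv, conjElt_conjInv, inv_inv]

/-- In a commutative group with at most one involution, a tuple that is invariant under inversion is
trivial in the group of singular orbit data. -/
theorem mk_eq_zero_of_symm [DecidableEq (ConjClasses G)]
    (hinv : ∀ σ τ : G, σ ^ 2 = 1 → τ ^ 2 = 1 → σ ≠ 1 → τ ≠ 1 → σ = τ) (s : Tuples G)
    (hs : ∀ c, s.1.count (conjInv G c) = s.1.count c) : OrbitData.mk G s = 0 := by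
  induction hn : s.1.card using Nat.strong_induction_on generalizing s with
  | _ n ih =>
  -- remove a trivial part
  have key (t r : Multiset (ConjClasses G)) (hst : s.1 = t + r)
      (ht : t ∈ AddMonoidHom.mker (psi G)) (ht0 : t ≠ 0) (hmk : OrbitData.mk G ⟨t, ht⟩ = 0)
      (hsym : ∀ c, t.count (conjInv G c) = t.count c) : OrbitData.mk G s = 0 := by
    have hr : r ∈ AddMonoidHom.mker (psi G) := by
      have h1 := AddMonoidHom.mem_mker.1 s.2
      rw [hst, map_add, AddMonoidHom.mem_mker.1 ht, zero_add] at h1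
      exact h1
    have hs2 : s = ⟨t, ht⟩ + ⟨r, hr⟩ := Subtype.ext hst
    rw [hs2, map_add, hmk, zero_add]
    refine ih r.card ?_ ⟨r, hr⟩ (fun c => ?_) rfl
    · rw [← hn, hst, Multiset.card_add]
      have := Multiset.card_pos.2 ht0
      omega
    · have h1 := hs c
      have h2 := hsym c
      simp only [hst, Multiset.count_add] at h1
      change r.count _ = r.count _
      omega
  have hone : ({1} : Multiset (ConjClasses G)) ∈ AddMonoidHom.mker (psi G) := by
    rw [AddMonoidHom.mem_mker, psi_eq_zero_iff]
    rw [Multiset.map_singleton, Multiset.prod_singleton]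
    exact conjElt_mk (1 : G)
  have hpair (γ : G) : ({ConjClasses.mk γ, ConjClasses.mk γ⁻¹} : Multiset (ConjClasses G)) ∈
      AddMonoidHom.mker (psi G) := by
    rw [AddMonoidHom.mem_mker, psi_eq_zero_iff]
    simp [conjElt_mk]
  have hpair0 (γ : G) : OrbitData.mk G ⟨_, hpair γ⟩ = 0 :=
    (AddCon.eq _).2 (AddConGen.Rel.of _ _ ⟨rfl, γ, ⟨_, hpair γ⟩, rfl, rfl⟩)
  have hone0 : OrbitData.mk G ⟨{1}, hone⟩ = 0 := by
    have h : (addConGen (unitRel G)).mk' 0 = (addConGen (unitRel G)).mk' ⟨{1}, hone⟩ :=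
      (AddCon.eq _).2 (AddConGen.Rel.of _ _ rfl)
    change (addConGen (cancelRel G)).mk' ((addConGen (unitRel G)).mk' ⟨{1}, hone⟩) = 0
    rw [← h, map_zero, map_zero]
  have hpairsym (γ : G) (c : ConjClasses G) :
      ({ConjClasses.mk γ, ConjClasses.mk γ⁻¹} : Multiset (ConjClasses G)).count (conjInv G c) =
      ({ConjClasses.mk γ, ConjClasses.mk γ⁻¹} : Multiset (ConjClasses G)).count c := by
    have h1 : conjInv G (ConjClasses.mk γ) = ConjClasses.mk γ⁻¹ := rfl
    have h2 : conjInv G (ConjClasses.mk γ⁻¹) = ConjClasses.mk γ := by rw [← h1, conjInv_conjInv]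
    have hi : Function.Injective (conjInv G) :=
      Function.LeftInverse.injective conjInv_conjInv
    have h3 : ({ConjClasses.mk γ, ConjClasses.mk γ⁻¹} : Multiset (ConjClasses G)).map (conjInv G) =
        {ConjClasses.mk γ, ConjClasses.mk γ⁻¹} := by
      rw [Multiset.insert_eq_cons, Multiset.map_cons, Multiset.map_singleton, h1, h2]
      exact Multiset.pair_comm _ _
    conv_lhs => rw [← h3]
    exact Multiset.count_map_eq_count' _ _ hi c
  -- An entry `1`, or an entry different from its inverse together with that inverse, can be split
  -- off. Otherwise all entries are the unique involution.
  by_cases h : ∃ c ∈ s.1, conjElt c = 1 ∨ (conjElt c)⁻¹ ≠ conjElt c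
  · obtain ⟨c, hc, hc'⟩ := h
    rcases hc' with hc1 | hci
    · obtain rfl : c = 1 := by rw [← mk_conjElt c, hc1]; rfl
      refine key {1} (s.1.erase 1) ?_ hone (by simp) hone0 fun c => ?_
      · rw [Multiset.singleton_add, Multiset.cons_erase hc]
      · rw [Multiset.count_singleton, Multiset.count_singleton]
        refine if_congr ⟨fun h => ?_, fun h => ?_⟩ rfl rfl
        · rw [← conjInv_conjInv c, h]; exact congrArg ConjClasses.mk inv_one
        · rw [h]; exact congrArg ConjClasses.mk inv_one
    · have hmem : conjInv G c ∈ s.1.erase c := by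
        rw [Multiset.mem_erase_of_ne, ← Multiset.count_pos, hs, Multiset.count_pos]
        · exact hc
        · intro h
          rw [← conjElt_conjInv, h] at hci
          exact hci rfl
      refine key _ ((s.1.erase c).erase (conjInv G c)) ?_ (hpair (conjElt c)) (by simp)
        (hpair0 _) (hpairsym _)
      rw [Multiset.insert_eq_cons, Multiset.cons_add, Multiset.singleton_add, mk_conjElt,
        ← conjElt_conjInv, mk_conjElt, Multiset.cons_erase hmem, Multiset.cons_erase hc]
  · push Not at h
    rcases Multiset.empty_or_exists_mem s.1 with h0 | ⟨c, hc⟩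
    · rw [show s = 0 from Subtype.ext h0, map_zero]
    have hsq (g : G) (hg : g⁻¹ = g) : g ^ 2 = 1 := by
      rw [pow_two]; nth_rewrite 1 [← hg]; exact inv_mul_cancel g
    have hrep : s.1 = Multiset.replicate s.1.card c := by
      refine Multiset.eq_replicate_card.2 fun b hb => ?_
      apply conjElt.injective
      exact hinv _ _ (hsq _ (h b hb).2) (hsq _ (h c hc).2) (h b hb).1 (h c hc).1
    have hprod := (psi_eq_zero_iff _).1 (AddMonoidHom.mem_mker.1 s.2)
    rw [hrep, Multiset.map_replicate, Multiset.prod_replicate] at hprod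
    -- The product condition `c ^ card = 1` with `c ≠ 1` excludes a single entry, and two copies of
    -- an involution form a cancelling pair.
    have hcard : 2 ≤ s.1.card := by
      have h1 : s.1.card ≠ 0 := by
        rw [Ne, Multiset.card_eq_zero]; rintro h0; rw [h0] at hc; simp at hc
      have h2 : s.1.card ≠ 1 := by
        intro h1; rw [h1, pow_one] at hprod; exact (h c hc).1 hprod
      omega
    refine key _ (Multiset.replicate (s.1.card - 2) c) ?_ (hpair (conjElt c)) (by simp)
      (hpair0 _) (hpairsym _)
    rw [(h c hc).2, mk_conjElt, Multiset.insert_eq_cons, Multiset.cons_add, Multiset.singleton_add,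
      ← Multiset.replicate_succ, ← Multiset.replicate_succ]
    conv_lhs => rw [hrep]
    congr 1
    omega

variable [Fintype G]

theorem rotSum_eq_sum [DecidableEq (ConjClasses G)] (s : Multiset (ConjClasses G)) (χ : Dual G) :
    rotSum s χ = ∑ g : G, (s.count (ConjClasses.mk g) : ℝ) * turn (χ⁻¹.hom g) := by
  induction s using Multiset.induction_on with
  | empty => simp
  | cons c s ih =>
    rw [rotSum_cons, ih]
    simp only [Multiset.count_cons, Nat.cast_add, add_mul, Finset.sum_add_distrib]
    rw [add_comm]
    congr 1
    have (g : G) : ConjClasses.mk g = c ↔ g = conjElt c := by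
      rw [← conjElt.injective.eq_iff, conjElt_mk]
    rw [Finset.sum_eq_single (conjElt c)]
    · simp [mk_conjElt]
    · intro g _ hg
      simp [this, hg]
    · simp

/-- A function on a finite abelian group is even if its sums against the rotation numbers of `χ`
and `χ⁻¹` agree for all characters `χ`. -/
theorem apply_inv_eq_of_sum_turn {m : G → ℝ}
    (h : ∀ χ : Dual G, ∑ g, m g * turn (χ⁻¹.hom g) = ∑ g, m g * turn (χ.hom g)) (g : G) :
    m g⁻¹ = m g := by
  have h1 (χ : Dual G) : ∑ g : G, (m g : ℂ) * (χ.hom g - (χ.hom g)⁻¹) = 0 := by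
    refine (Fintype.sum_equiv Additive.ofMul _ _ fun _ => rfl).trans
      (sum_mul_sub_inv_eq_zero (A := Additive G) (fun g => (m g.toMul : ℂ)) (fun χ => ?_) χ)
    refine (Fintype.sum_equiv Additive.toMul _
      (fun g => (m g : ℂ) * ((turn (Dual.hom χ g) - turn (Dual.hom χ g)⁻¹ : ℝ) : ℂ))
      fun _ => rfl).trans ?_
    have h2 := h χ
    rw [← sub_eq_zero, ← Finset.sum_sub_distrib] at h2
    rw [← ofReal_zero, ← neg_zero, ← h2, ofReal_neg, ofReal_sum, ← Finset.sum_neg_distrib]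
    refine Finset.sum_congr rfl fun g _ => ?_
    rw [Dual.inv_hom]
    push_cast; ring
  have h2 (χ : Dual G) : ∑ g : G, ((m g : ℂ) - m g⁻¹) * χ.hom g = 0 := by
    have h3 := h1 χ
    simp only [mul_sub, Finset.sum_sub_distrib] at h3
    rw [← Equiv.sum_comp (Equiv.inv G) (fun g => (m g : ℂ) * (χ.hom g)⁻¹)] at h3
    simpa only [sub_mul, Finset.sum_sub_distrib, Equiv.inv_apply, χ.hom_inv, inv_inv] using h3
  have h4 := eq_zero_of_sum_mul_hom h2 g
  exact_mod_cast (sub_eq_zero.1 h4).symm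

theorem mk_eq_zero_of_rotSum_symm
    (hinv : ∀ σ τ : G, σ ^ 2 = 1 → τ ^ 2 = 1 → σ ≠ 1 → τ ≠ 1 → σ = τ) (s : Tuples G)
    (hs : ∀ χ : Dual G, rotSum s.1 χ = rotSum s.1 χ⁻¹) : OrbitData.mk G s = 0 := by
  let _ : DecidableEq (ConjClasses G) := Classical.decEq _
  refine mk_eq_zero_of_symm hinv s fun c => ?_
  have h (χ : Dual G) := hs χ
  simp only [rotSum_eq_sum, inv_inv] at h
  have h4 := apply_inv_eq_of_sum_turn h (conjElt c)
  rw [← conjElt_conjInv, mk_conjElt, mk_conjElt] at h4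
  exact Nat.cast_injective h4

/-- The odd part in `χ` of `rotSum` kills the cancelling pairs exactly, without passing to a
quotient, and it embeds `𝔹_G` in a real vector space. -/
theorem isAddTorsionFree_orbitData
    (hinv : ∀ σ τ : G, σ ^ 2 = 1 → τ ^ 2 = 1 → σ ≠ 1 → τ ≠ 1 → σ = τ) :
    IsAddTorsionFree (OrbitData G) := by
  let δ : (Dual G → ℝ) →+ (Dual G → ℝ) :=
    { toFun := fun n χ => n χ - n χ⁻¹
      map_zero' := by funext χ; simp
      map_add' := fun n m => by funext χ; simp; ring }
  suffices h : ∃ θ : OrbitData G →+ (Dual G → ℝ), ∀ s, θ (OrbitData.mk G s) =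
      ((δ.comp rotSum).comp (AddMonoidHom.mker (psi G)).subtype) s by
    obtain ⟨θ, hθ⟩ := h
    refine Function.Injective.isAddTorsionFree (f := θ) ?_
    rw [injective_iff_map_eq_zero]
    intro α hα
    obtain ⟨s, rfl⟩ := OrbitData.mk_surjective G α
    rw [hθ] at hα
    exact mk_eq_zero_of_rotSum_symm hinv s fun χ => sub_eq_zero.1 (congrFun hα χ)
  refine exists_orbitData_hom _ ?_ ?_
  · intro s t h
    have : rotSum s.1 = rotSum t.1 := by
      funext χ
      rw [show t.1 = 1 ::ₘ s.1 from h, rotSum_cons, show (1 : ConjClasses G) = ConjClasses.mk 1 from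
        rfl, conjElt_mk, map_one, turn_one, zero_add]
    exact congrArg δ this
  · intro γ s h
    funext χ
    change rotSum s.1 χ - rotSum s.1 χ⁻¹ = 0
    rw [h, Multiset.insert_eq_cons, rotSum_cons, ← Multiset.cons_zero, rotSum_cons, conjElt_mk,
      conjElt_mk, map_zero, Dual.hom_inv, ← Dual.inv_hom, rotSum_cons, rotSum_cons, conjElt_mk,
      conjElt_mk, map_zero, Dual.hom_inv, ← Dual.inv_hom]
    simp [add_comm]

end SingularOrbit

/-! ### Isotypic cochains developed as paths in the plane. -/

namespace SingularOrbit

open Complex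
open scoped Real ComplexConjugate

universe u

/-! ### Twisted cochains -/

namespace SurfaceAction

variable {G : Type u} [CommGroup G] (A : SurfaceAction G)

/-- The complex cochain with values `z` on the edges at the vertex `1` on which `G` acts through the
character `χ⁻¹`. -/
def twist (χ : Dual G) (z : Gen A.h A.q → ℂ) : G × Gen A.h A.q → ℂ := fun e => χ.hom e.1 * z e.2

/-- The value in `G` of a letter. -/
def letterVal (s : Gen A.h A.q × Bool) : G := cond s.2 (A.val s.1) (A.val s.1)⁻¹

/-- The value in `G` of a word. -/
def wordVal (w : List (Gen A.h A.q × Bool)) : G := (w.map A.letterVal).prod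

/-- The value of the twisted cochain on the edge starting at `1` that follows a letter. -/
noncomputable def stepC (χ : Dual G) (z : Gen A.h A.q → ℂ) (s : Gen A.h A.q × Bool) : ℂ :=
  cond s.2 (z s.1) (-((χ.hom (A.val s.1))⁻¹ * z s.1))

/-- The value of the twisted cochain on the path starting at `1` that spells out a word. -/
noncomputable def disp (χ : Dual G) (z : Gen A.h A.q → ℂ) : List (Gen A.h A.q × Bool) → ℂ
  | [] => 0
  | s :: w => A.stepC χ z s + χ.hom (A.letterVal s) * disp χ z w

/-- Twice the signed area enclosed by the path starting at `1` that spells out a word. -/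
noncomputable def area (χ : Dual G) (z : Gen A.h A.q → ℂ) : List (Gen A.h A.q × Bool) → ℝ
  | [] => 0
  | s :: w => (conj (A.stepC χ z s) * (χ.hom (A.letterVal s) * A.disp χ z w)).im + area χ z w

/-- The real part of a complex cochain. -/
def reC (Z : G × Gen A.h A.q → ℂ) : A.Cochain := fun e => (Z e).re

/-- The imaginary part of a complex cochain. -/
def imC (Z : G × Gen A.h A.q → ℂ) : A.Cochain := fun e => (Z e).im

variable {A} {χ : Dual G} {z : Gen A.h A.q → ℂ}

theorem next_eq (g : G) (s : Gen A.h A.q × Bool) : A.next g s = g * A.letterVal s := by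
  obtain ⟨x, _ | _⟩ := s <;> rfl

theorem wordVal_cons (s : Gen A.h A.q × Bool) (w) :
    A.wordVal (s :: w) = A.letterVal s * A.wordVal w := by
  simp [wordVal]

theorem wordVal_append (w w') : A.wordVal (w ++ w') = A.wordVal w * A.wordVal w' := by
  simp [wordVal]

theorem step_reC_twist (g : G) (s) :
    A.step (A.reC (A.twist χ z)) g s = (χ.hom g * A.stepC χ z s).re := by
  obtain ⟨x, _ | _⟩ := s
  · simp only [step, reC, twist, stepC, cond, map_mul, Dual.hom_inv, mul_neg, neg_re, mul_assoc]
  · rfl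

theorem step_imC_twist (g : G) (s) :
    A.step (A.imC (A.twist χ z)) g s = (χ.hom g * A.stepC χ z s).im := by
  obtain ⟨x, _ | _⟩ := s
  · simp only [step, imC, twist, stepC, cond, map_mul, Dual.hom_inv, mul_neg, neg_im, mul_assoc]
  · rfl

theorem pathSum_reC_twist (g : G) (w) :
    A.pathSum (A.reC (A.twist χ z)) g w = (χ.hom g * A.disp χ z w).re := by
  induction w generalizing g with
  | nil => simp [pathSum, disp]
  | cons s w ih =>
    rw [pathSum, step_reC_twist, ih, next_eq, disp, map_mul, ← add_re, mul_add, mul_assoc]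

theorem pathSum_imC_twist (g : G) (w) :
    A.pathSum (A.imC (A.twist χ z)) g w = (χ.hom g * A.disp χ z w).im := by
  induction w generalizing g with
  | nil => simp [pathSum, disp]
  | cons s w ih =>
    rw [pathSum, step_imC_twist, ih, next_eq, disp, map_mul, ← add_im, mul_add, mul_assoc]

theorem disp_append (w w') :
    A.disp χ z (w ++ w') = A.disp χ z w + χ.hom (A.wordVal w) * A.disp χ z w' := by
  induction w with
  | nil => simp [disp, wordVal]
  | cons s w ih => rw [List.cons_append, disp, ih, disp, wordVal_cons, map_mul]; ring

theorem disp_congr {z' : Gen A.h A.q → ℂ} {w} (h : ∀ s ∈ w, z s.1 = z' s.1) :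
    A.disp χ z w = A.disp χ z' w := by
  induction w with
  | nil => rfl
  | cons s w ih =>
    rw [disp, disp, ih fun t ht => h t (List.mem_cons_of_mem _ ht), stepC, stepC,
      h s List.mem_cons_self]

theorem area_congr {z' : Gen A.h A.q → ℂ} {w} (h : ∀ s ∈ w, z s.1 = z' s.1) :
    A.area χ z w = A.area χ z' w := by
  induction w with
  | nil => rfl
  | cons s w ih =>
    have h' := fun t ht => h t (List.mem_cons_of_mem s ht)
    rw [area, area, ih h', disp_congr h', stepC, stepC, h s List.mem_cons_self]

theorem disp_add (z z' : Gen A.h A.q → ℂ) (w) :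
    A.disp χ (z + z') w = A.disp χ z w + A.disp χ z' w := by
  induction w with
  | nil => simp [disp]
  | cons s w ih =>
    obtain ⟨x, _ | _⟩ := s <;> simp only [disp, ih, stepC, cond, Pi.add_apply] <;> ring

theorem disp_smul (c : ℂ) (z : Gen A.h A.q → ℂ) (w) :
    A.disp χ (c • z) w = c * A.disp χ z w := by
  induction w with
  | nil => simp [disp]
  | cons s w ih =>
    obtain ⟨x, _ | _⟩ := s <;> simp only [disp, ih, stepC, cond, Pi.smul_apply, smul_eq_mul] <;> ring

variable (A χ) in
/-- The value on a path as a linear functional on twisted cochains. -/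
noncomputable def dispL (w : List (Gen A.h A.q × Bool)) : (Gen A.h A.q → ℂ) →ₗ[ℂ] ℂ where
  toFun z := A.disp χ z w
  map_add' z z' := disp_add z z' w
  map_smul' c z := disp_smul c z w

theorem area_smul (c : ℂ) (z : Gen A.h A.q → ℂ) (w) :
    A.area χ (c • z) w = ‖c‖ ^ 2 * A.area χ z w := by
  induction w with
  | nil => simp [area]
  | cons s w ih =>
    have hs : A.stepC χ (c • z) s = c * A.stepC χ z s := by
      obtain ⟨x, _ | _⟩ := s <;> simp only [stepC, cond, Pi.smul_apply, smul_eq_mul]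
      ring
    rw [area, area, ih, disp_smul, hs, map_mul, mul_add]
    have hc : conj c * c = ((‖c‖ ^ 2 : ℝ) : ℂ) := by
      rw [mul_comm, Complex.mul_conj, Complex.normSq_eq_norm_sq]
    rw [show conj c * conj (A.stepC χ z s) * (χ.hom (A.letterVal s) * (c * A.disp χ z w)) =
      conj c * c * (conj (A.stepC χ z s) * (χ.hom (A.letterVal s) * A.disp χ z w)) by ring, hc,
      Complex.im_ofReal_mul]

/-! #### Handles -/

/-- The commutator of the `i`-th pair of generators. -/
def handleWord {h q : ℕ} (i : Fin h) : List (Gen h q × Bool) :=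
  [(Gen.a i, true), (Gen.b i, true), (Gen.a i, false), (Gen.b i, false)]

theorem wordVal_handleWord (i : Fin A.h) : A.wordVal (handleWord i) = 1 := by
  simp [wordVal, handleWord, letterVal, mul_comm]

theorem wordVal_handles (l : List (Fin A.h)) : A.wordVal (l.flatMap handleWord) = 1 := by
  induction l with
  | nil => simp [wordVal]
  | cons i l ih => rw [List.flatMap_cons, wordVal_append, ih, wordVal_handleWord, one_mul]

theorem disp_handleWord (i : Fin A.h) :
    A.disp χ z (handleWord i) = (1 - χ.hom (A.val (Gen.b i))) * z (Gen.a i) -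
      (1 - χ.hom (A.val (Gen.a i))) * z (Gen.b i) := by
  have h1 := χ.hom_ne_zero (A.val (Gen.a i))
  have h2 := χ.hom_ne_zero (A.val (Gen.b i))
  simp only [disp, handleWord, stepC, letterVal, cond, Dual.hom_inv]
  field_simp
  ring

/-- The word `ξ_{j₁} ⋯ ξ_{j_r}`. -/
def xiWord {h q : ℕ} (l : List (Fin q)) : List (Gen h q × Bool) := l.map fun j => (Gen.xi j, true)

theorem surfaceWord_eq (h q : ℕ) : surfaceWord h q =
    (List.finRange h).flatMap handleWord ++ xiWord (List.finRange q) := rfl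

theorem wordVal_xiWord (l : List (Fin A.q)) : A.wordVal (xiWord l) = (l.map A.γ).prod := by
  simp only [wordVal, xiWord, List.map_map]
  rfl

theorem wordVal_surfaceWord : A.wordVal (surfaceWord A.h A.q) = 1 := by
  have hrel : (PresentedGroup.mk {FreeGroup.mk (surfaceWord A.h A.q)})
      (FreeGroup.mk (surfaceWord A.h A.q)) = 1 :=
    PresentedGroup.one_of_mem rfl
  let f : FreeGroup (Gen A.h A.q) →* G :=
    A.p.comp (PresentedGroup.mk {FreeGroup.mk (surfaceWord A.h A.q)})
  have h1 : f (FreeGroup.mk (surfaceWord A.h A.q)) = 1 := by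
    change A.p _ = 1
    rw [hrel, map_one]
  have hf : f = FreeGroup.lift A.val := by
    apply FreeGroup.ext_hom
    intro x
    rw [FreeGroup.lift_apply_of]
    rfl
  rw [hf, FreeGroup.lift_mk] at h1
  exact h1

theorem prod_γ : ((List.finRange A.q).map A.γ).prod = 1 := by
  have h := wordVal_surfaceWord (A := A)
  rwa [surfaceWord_eq, wordVal_append, wordVal_handles, one_mul, wordVal_xiWord] at h

theorem eq_top_of_val_mem {K : Subgroup G} (h : ∀ x, A.val x ∈ K) : K = ⊤ := by
  rw [eq_top_iff]
  intro g _
  obtain ⟨w, rfl⟩ := A.surjective g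
  have : K.comap A.p = ⊤ := by
    rw [eq_top_iff, ← PresentedGroup.closure_range_of, Subgroup.closure_le]
    rintro _ ⟨x, rfl⟩
    exact h x
  exact (this ▸ Subgroup.mem_top w : w ∈ K.comap A.p)

theorem disp_replicate (x : Gen A.h A.q) (n : ℕ) :
    A.disp χ z (List.replicate n (x, true)) =
      (∑ k ∈ Finset.range n, χ.hom (A.val x) ^ k) * z x := by
  induction n with
  | zero => simp [disp]
  | succ n ih =>
    rw [List.replicate_succ, disp, ih, geom_sum_succ]
    simp only [stepC, letterVal, cond]
    ring

theorem area_replicate_of_eq_zero {x : Gen A.h A.q} (h : z x = 0) (n : ℕ) :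
    A.area χ z (List.replicate n (x, true)) = 0 := by
  induction n with
  | zero => simp [area]
  | succ n ih =>
    rw [List.replicate_succ, area, ih]
    simp [stepC, h]

/-- Edges of equal length, each turned by `χ (γ j)` against the previous one, close up after `ν_j`
steps unless `χ (γ j) = 1`. -/
theorem disp_discWord (j : Fin A.q) (h : χ.hom (A.γ j) = 1 → z (Gen.xi j) = 0) :
    A.disp χ z (A.discWord j) = 0 := by
  rw [discWord, disp_replicate]
  change (∑ k ∈ Finset.range (orderOf (A.γ j)), χ.hom (A.γ j) ^ k) * _ = 0
  by_cases h1 : χ.hom (A.γ j) = 1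
  · rw [h h1, mul_zero]
  · rw [geom_sum_eq h1, ← map_pow, pow_orderOf_eq_one, map_one, sub_self, zero_div, zero_mul]

/-! #### Areas -/

theorem area_replicate {x : Gen A.h A.q} (h : χ.hom (A.val x) ≠ 1) (n : ℕ) :
    A.area χ z (List.replicate n (x, true)) = ‖z x‖ ^ 2 *
      (χ.hom (A.val x) * (1 - χ.hom (A.val x))⁻¹ *
        (n - ∑ k ∈ Finset.range n, χ.hom (A.val x) ^ k)).im := by
  set ζ := χ.hom (A.val x) with hζ
  have h0 : 1 - ζ ≠ 0 := sub_ne_zero.2 (Ne.symm h)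
  induction n with
  | zero => simp [area]
  | succ n ih =>
    rw [List.replicate_succ, area, ih, disp_replicate]
    simp only [stepC, letterVal, cond, ← hζ]
    have hz : conj (z x) * z x = ((‖z x‖ ^ 2 : ℝ) : ℂ) := by
      rw [mul_comm, Complex.mul_conj, Complex.normSq_eq_norm_sq]
    rw [show conj (z x) * (ζ * ((∑ k ∈ Finset.range n, ζ ^ k) * z x)) =
      conj (z x) * z x * (ζ * ∑ k ∈ Finset.range n, ζ ^ k) by ring, hz, Complex.im_ofReal_mul,
      ← mul_add, ← add_im]
    congr 2
    rw [Finset.sum_range_succ]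
    have hg : (∑ k ∈ Finset.range n, ζ ^ k) * (1 - ζ) = 1 - ζ ^ n := geom_sum_mul_neg ζ n
    rw [Nat.cast_succ, show ζ * ∑ k ∈ Finset.range n, ζ ^ k =
      ζ * (1 - ζ)⁻¹ * ((∑ k ∈ Finset.range n, ζ ^ k) * (1 - ζ)) by field_simp, hg]
    ring

/-- The boundary of the disc becomes a regular, possibly star-shaped or repeated polygon. It splits
into `ν_j` congruent triangles with their apex at its centre. -/
theorem area_discWord (j : Fin A.q) (h : χ.hom (A.γ j) ≠ 1) :
    A.area χ z (A.discWord j) =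
      orderOf (A.γ j) * (apexArea (χ.hom (A.γ j)) * ‖z (Gen.xi j)‖ ^ 2) := by
  have hs : ∑ k ∈ Finset.range (orderOf (A.γ j)), χ.hom (A.γ j) ^ k = 0 := by
    rw [geom_sum_eq h, ← map_pow, pow_orderOf_eq_one, map_one, sub_self, zero_div]
  have h0 : 1 - χ.hom (A.γ j) ≠ 0 := sub_ne_zero.2 (Ne.symm h)
  have hk : χ.hom (A.γ j) * (1 - χ.hom (A.γ j))⁻¹ = (1 - χ.hom (A.γ j))⁻¹ - 1 := by
    field_simp
    ring
  rw [discWord, area_replicate (by exact h)]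
  change _ * (χ.hom (A.γ j) * (1 - χ.hom (A.γ j))⁻¹ *
    (_ - ∑ k ∈ Finset.range (orderOf (A.γ j)), χ.hom (A.γ j) ^ k)).im = _
  rw [hs, hk, sub_zero, apexArea]
  simp
  ring

variable [Fintype G]

/-- The extra term is twice the area of the triangle spanned by the chords of the two paths. -/
theorem area_append (w w') :
    A.area χ z (w ++ w') = A.area χ z w + A.area χ z w' +
      (conj (A.disp χ z w) * (χ.hom (A.wordVal w) * A.disp χ z w')).im := by
  induction w with
  | nil => simp [disp, area, wordVal]
  | cons s w ih =>
    have h1 : conj (χ.hom (A.letterVal s)) * χ.hom (A.letterVal s) = 1 := by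
      rw [χ.conj_hom, inv_mul_cancel₀ (χ.hom_ne_zero _)]
    rw [List.cons_append, area, ih, area, disp_append, disp, wordVal_cons, map_mul, map_add,
      map_mul]
    have h2 : (conj (A.stepC χ z s) + conj (χ.hom (A.letterVal s)) * conj (A.disp χ z w)) *
        (χ.hom (A.letterVal s) * χ.hom (A.wordVal w) * A.disp χ z w') =
        conj (A.stepC χ z s) * (χ.hom (A.letterVal s) * (χ.hom (A.wordVal w) * A.disp χ z w')) +
        conj (A.disp χ z w) * (χ.hom (A.wordVal w) * A.disp χ z w') := by
      linear_combination (conj (A.disp χ z w) * (χ.hom (A.wordVal w) * A.disp χ z w')) * h1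
    rw [h2, mul_add, mul_add, add_im, add_im]
    ring

/-- Starting at `g` rotates the whole path by `χ g`, which preserves areas. -/
theorem crossSum_twist (g : G) (w) :
    A.crossSum (A.reC (A.twist χ z)) (A.imC (A.twist χ z)) g w = A.area χ z w := by
  induction w generalizing g with
  | nil => rfl
  | cons s w ih =>
    have h1 : (χ.hom g).re ^ 2 + (χ.hom g).im ^ 2 = 1 := by
      have := χ.norm_hom g
      rw [← one_pow 2, ← this, Complex.sq_norm, Complex.normSq_apply]; ring
    rw [crossSum, ih, area, step_reC_twist, step_imC_twist, pathSum_reC_twist, pathSum_imC_twist,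
      next_eq, map_mul, mul_assoc]
    congr 1
    generalize χ.hom (A.letterVal s) * A.disp χ z w = d
    generalize A.stepC χ z s = a
    simp only [mul_re, mul_im, conj_re, conj_im]
    linear_combination (a.re * d.im - a.im * d.re) * h1

end SurfaceAction

end SingularOrbit

/-! ### Building blocks of the area form: triangles and handles. -/

namespace SingularOrbit

open Complex
open scoped Real ComplexConjugate

universe u

/-! ### Nonpositive subspaces of twisted cocycles -/

section LinearAlgebra

variable {K V : Type*} [Field K] [AddCommGroup V] [Module K V] [FiniteDimensional K V]

theorem finrank_sup_span_singleton_of_notMem {Q : Submodule K V} {v : V} (hv : v ∉ Q) :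
    Module.finrank K (Q ⊔ K ∙ v : Submodule K V) = Module.finrank K Q + 1 := by
  have hv0 : v ≠ 0 := fun h => hv (h ▸ Q.zero_mem)
  have h := Submodule.finrank_sup_add_finrank_inf_eq Q (K ∙ v)
  rw [(Submodule.disjoint_span_singleton' hv0).2 hv |>.eq_bot, finrank_bot, add_zero,
    finrank_span_singleton hv0] at h
  exact h

theorem finrank_le_finrank_inf_ker_add_one (Q : Submodule K V) (f : V →ₗ[K] K) :
    Module.finrank K Q ≤ Module.finrank K (Q ⊓ LinearMap.ker f : Submodule K V) + 1 := by
  have h := LinearMap.finrank_range_add_finrank_ker (f.domRestrict Q)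
  have h1 : Module.finrank K (LinearMap.range (f.domRestrict Q)) ≤ 1 :=
    (Submodule.finrank_le _).trans (Module.finrank_self K).le
  have h2 : Module.finrank K (LinearMap.ker (f.domRestrict Q)) ≤
      Module.finrank K (Q ⊓ LinearMap.ker f : Submodule K V) := by
    rw [← LinearMap.finrank_range_of_inj (f := Q.subtype.domRestrict
      (LinearMap.ker (f.domRestrict Q))) (fun x y h => Subtype.ext (Subtype.ext h))]
    refine Submodule.finrank_mono ?_
    rintro _ ⟨x, rfl⟩
    exact ⟨x.1.2, x.2⟩
  omega

end LinearAlgebra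

/-- With `apexArea` half a cotangent this is the addition formula for cotangents, read off from a
rational identity in `1 / (1 - z)`. -/
theorem apexArea_mul {z w : ℂ} (hz : ‖z‖ = 1) (h1 : z ≠ 1) (hw : ‖w‖ = 1) (h1' : w ≠ 1)
    (h : z * w ≠ 1) : 4 * apexArea (z * w) * (apexArea z + apexArea w) =
      4 * apexArea z * apexArea w - 1 := by
  have hzw : ‖z * w‖ = 1 := by rw [norm_mul, hz, hw, one_mul]
  have e1 := inv_one_sub_eq hz h1
  have e2 := inv_one_sub_eq hw h1'
  have e3 := inv_one_sub_eq hzw h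
  have n1 : 1 - z ≠ 0 := sub_ne_zero.2 h1.symm
  have n2 : 1 - w ≠ 0 := sub_ne_zero.2 h1'.symm
  have n3 : 1 - z * w ≠ 0 := sub_ne_zero.2 h.symm
  have key : (1 - z * w)⁻¹ * ((1 - z)⁻¹ + (1 - w)⁻¹ - 1) = (1 - z)⁻¹ * (1 - w)⁻¹ := by
    field_simp
    ring
  rw [e1, e2, e3] at key
  have hre := congrArg Complex.re key
  simp at hre
  linarith

/-- Two apex triangles over consecutive chords `s` and `e` are traded for one over `s + e`. The
error is a square with the sign of `a + b`. -/
theorem apex_completion {a b c : ℝ} (hab : a + b ≠ 0) (hc : 4 * c * (a + b) = 4 * a * b - 1)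
    (s e : ℂ) : a * ‖s‖ ^ 2 + b * ‖e‖ ^ 2 - (conj s * e).im = c * ‖s + e‖ ^ 2 +
      ‖(2 * a + I) * s - (2 * b - I) * e‖ ^ 2 / (4 * (a + b)) := by
  obtain rfl : c = (4 * a * b - 1) / (4 * (a + b)) := by field_simp; linarith
  simp only [Complex.sq_norm, Complex.normSq_apply]
  simp
  field_simp
  ring

namespace SurfaceAction

variable {G : Type u} [CommGroup G] {A : SurfaceAction G} {χ : Dual G}

instance {h q : ℕ} : Finite (Gen h q) :=
  Finite.of_injective (β := Fin h ⊕ Fin h ⊕ Fin q)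
    (fun x => match x with
      | .a i => .inl i
      | .b i => .inr (.inl i)
      | .xi j => .inr (.inr j))
    (by rintro (_ | _ | _) (_ | _ | _) h <;> simp_all)

theorem fst_ne_of_mem_handles {h q : ℕ} {l : List (Fin h)} {s : Gen h q × Bool}
    (hs : s ∈ l.flatMap handleWord) : ∃ i ∈ l, s.1 = Gen.a i ∨ s.1 = Gen.b i := by
  obtain ⟨i, hi, hs⟩ := List.mem_flatMap.1 hs
  refine ⟨i, hi, ?_⟩
  simp only [handleWord, List.mem_cons, List.not_mem_nil, or_false] at hs
  rcases hs with rfl | rfl | rfl | rfl <;> simp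

/-- If `χ b ≠ 1`, the values of a twisted coboundary, up to sign, give a closed path of area zero.
If `χ b = 1`, the coboundary might vanish, but then an edge at `a` alone is traversed forth and
back. -/
theorem exists_isotropic_handle [Fintype G] (A : SurfaceAction G) (χ : Dual G) (i : Fin A.h) :
    ∃ k : Gen A.h A.q → ℂ, k ≠ 0 ∧ (∀ x, x ≠ Gen.a i → x ≠ Gen.b i → k x = 0) ∧
      A.disp χ k (handleWord i) = 0 ∧ A.area χ k (handleWord i) = 0 := by
  classical
  set α := χ.hom (A.val (Gen.a i)) with hα
  set β := χ.hom (A.val (Gen.b i)) with hβ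
  have hαn : conj α * α = 1 := by
    rw [χ.conj_hom, inv_mul_cancel₀ (χ.hom_ne_zero _)]
  have hβn : conj β * β = 1 := by
    rw [χ.conj_hom, inv_mul_cancel₀ (χ.hom_ne_zero _)]
  have hα0 : α ≠ 0 := χ.hom_ne_zero _
  have hβ0 : β ≠ 0 := χ.hom_ne_zero _
  have hα1 : conj α = α⁻¹ := χ.conj_hom _
  have hβ1 : conj β = β⁻¹ := χ.conj_hom _
  have harea (k : Gen A.h A.q → ℂ) : A.area χ k (handleWord i) =
      (conj (k (Gen.a i)) * (α * k (Gen.b i) - β * k (Gen.a i) - k (Gen.b i)) +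
      conj (k (Gen.b i)) * (- α⁻¹ * β * k (Gen.a i) - α⁻¹ * k (Gen.b i)) +
      conj (k (Gen.a i)) * β⁻¹ * k (Gen.b i)).im := by
    simp only [area, disp, handleWord, stepC, letterVal, cond, Dual.hom_inv, ← hα, ← hβ, map_neg,
      map_mul, map_inv₀, hα1, hβ1, inv_inv, ← add_im, mul_zero, add_zero]
    congr 1
    field_simp
    ring
  by_cases hβe : β = 1
  · refine ⟨Pi.single (Gen.a i) 1, by simp, fun x hx _ => Pi.single_eq_of_ne hx _, ?_, ?_⟩
    · rw [disp_handleWord]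
      simp [← hβ, hβe]
    · rw [harea]
      simp [hβe]
  · refine ⟨Pi.single (Gen.a i) (1 - α) + Pi.single (Gen.b i) (1 - β), ?_, ?_, ?_, ?_⟩
    · intro h
      have := congrFun h (Gen.b i)
      simp [sub_eq_zero] at this
      exact hβe this.symm
    · intro x hx hx'
      simp [hx, hx']
    · rw [disp_handleWord]
      simp [← hα, ← hβ]
      ring
    · rw [harea]
      simp only [Pi.add_apply, Pi.single_eq_same, ne_eq, reduceCtorEq, not_false_eq_true,
        Pi.single_eq_of_ne, add_zero, zero_add, map_sub, map_one, hα1, hβ1]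
      have h2 : ((1 - α⁻¹) * (α * (1 - β) - β * (1 - α) - (1 - β)) +
        (1 - β⁻¹) * (-α⁻¹ * β * (1 - α) - α⁻¹ * (1 - β)) + (1 - α⁻¹) * β⁻¹ * (1 - β)) =
          (α + conj α) + (β + conj β) - 4 := by
        rw [hα1, hβ1]
        field_simp
        ring
      rw [h2, Complex.add_conj, Complex.add_conj]
      simp

/-- The word of all handles followed by some of the boundary loops. -/
def prefixWord {h q : ℕ} (l : List (Fin q)) : List (Gen h q × Bool) :=
  (List.finRange h).flatMap handleWord ++ xiWord l

/-- The Hermitian form given by the areas of discs minus the area of a polygon. -/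
noncomputable def discForm (A : SurfaceAction G) (χ : Dual G) (l : List (Fin A.q))
    (z : Gen A.h A.q → ℂ) : ℝ :=
  (l.map fun j => apexArea (χ.hom (A.γ j)) * ‖z (Gen.xi j)‖ ^ 2).sum -
    A.area χ z (prefixWord l)

theorem wordVal_prefixWord (l : List (Fin A.q)) :
    A.wordVal (prefixWord l) = (l.map A.γ).prod := by
  rw [prefixWord, wordVal_append, wordVal_handles, one_mul, wordVal_xiWord]

theorem prefixWord_append {h q : ℕ} (l : List (Fin q)) (j : Fin q) :
    prefixWord (h := h) (l ++ [j]) = prefixWord l ++ [(Gen.xi j, true)] := by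
  simp [prefixWord, xiWord]

theorem disp_prefixWord_append (z : Gen A.h A.q → ℂ) (l : List (Fin A.q)) (j : Fin A.q) :
    A.disp χ z (prefixWord (l ++ [j])) =
      A.disp χ z (prefixWord l) + χ.hom (l.map A.γ).prod * z (Gen.xi j) := by
  rw [prefixWord_append, disp_append, wordVal_prefixWord]
  simp [disp, stepC]

theorem discForm_congr {z z' : Gen A.h A.q → ℂ} {l : List (Fin A.q)}
    (h : ∀ j ∈ l, z (Gen.xi j) = z' (Gen.xi j)) (h' : ∀ s ∈ prefixWord l, z s.1 = z' s.1) :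
    A.discForm χ l z = A.discForm χ l z' := by
  rw [discForm, discForm, area_congr h']
  congr 2
  exact List.map_congr_left fun j hj => by rw [h j hj]

theorem fst_ne_of_mem_prefixWord {h q : ℕ} {l : List (Fin q)} {s : Gen h q × Bool}
    (hs : s ∈ prefixWord l) {j : Fin q} (hj : j ∉ l) : s.1 ≠ Gen.xi j := by
  rcases List.mem_append.1 hs with hs | hs
  · obtain ⟨i, -, h | h⟩ := fst_ne_of_mem_handles hs <;> simp [h]
  · obtain ⟨k, hk, rfl⟩ := List.mem_map.1 hs
    have : k ≠ j := fun h => hj (h ▸ hk)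
    simpa using this

variable [Fintype G]

theorem exists_isotropic_handles (A : SurfaceAction G) (χ : Dual G) (l : List (Fin A.h))
    (hl : l.Nodup) :
    ∃ Q : Submodule ℂ (Gen A.h A.q → ℂ), Module.finrank ℂ Q = l.length ∧ ∀ z ∈ Q,
      (∀ x, (∀ i ∈ l, x ≠ Gen.a i ∧ x ≠ Gen.b i) → z x = 0) ∧
      A.disp χ z (l.flatMap handleWord) = 0 ∧ A.area χ z (l.flatMap handleWord) = 0 := by
  induction l with
  | nil =>
    refine ⟨⊥, by simp, fun z hz => ?_⟩
    rw [(Submodule.mem_bot ℂ).1 hz]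
    simp [disp, area]
  | cons i l ih =>
    obtain ⟨hil, hl⟩ := List.nodup_cons.1 hl
    obtain ⟨Q, hQ, hQz⟩ := ih hl
    obtain ⟨k, hk0, hk, hkd, hka⟩ := exists_isotropic_handle A χ i
    have hnot (z) (hz : z ∈ Q) : z (Gen.a i) = 0 ∧ z (Gen.b i) = 0 := by
      refine ⟨(hQz z hz).1 _ fun j hj => ?_, (hQz z hz).1 _ fun j hj => ?_⟩ <;>
      · have : i ≠ j := fun h => hil (h ▸ hj)
        simp [this]
    have hkQ : k ∉ Q := by
      intro h
      obtain ⟨h1, h2⟩ := hnot k h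
      refine hk0 (funext fun x => ?_)
      by_cases hx : x = Gen.a i
      · rw [hx, h1]; rfl
      by_cases hx' : x = Gen.b i
      · rw [hx', h2]; rfl
      exact hk x hx hx'
    refine ⟨Q ⊔ ℂ ∙ k, ?_, fun z hz => ?_⟩
    · rw [finrank_sup_span_singleton_of_notMem hkQ, hQ, List.length_cons]
    obtain ⟨q, hq, y, hy, rfl⟩ := Submodule.mem_sup.1 hz
    obtain ⟨c, rfl⟩ := Submodule.mem_span_singleton.1 hy
    obtain ⟨h1, h2⟩ := hnot q hq
    have e1 : ∀ s ∈ handleWord (q := A.q) i, (q + c • k) s.1 = (c • k) s.1 := by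
      intro s hs
      simp only [handleWord, List.mem_cons, List.not_mem_nil, or_false] at hs
      rcases hs with rfl | rfl | rfl | rfl <;> simp [h1, h2]
    have e2 : ∀ s ∈ l.flatMap (handleWord (q := A.q)), (q + c • k) s.1 = q s.1 := by
      intro s hs
      obtain ⟨j, hj, hs⟩ := fst_ne_of_mem_handles hs
      have : j ≠ i := fun h => hil (h ▸ hj)
      have : k s.1 = 0 := by
        refine hk _ ?_ ?_ <;> rcases hs with h | h <;> simp [h, this]
      simp [this]
    have hd : A.disp χ (q + c • k) (handleWord i) = 0 := by
      rw [disp_congr e1, disp_smul, hkd, mul_zero]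
    refine ⟨fun x hx => ?_, ?_, ?_⟩
    · have hx1 := hx i List.mem_cons_self
      rw [Pi.add_apply, (hQz q hq).1 x fun j hj => hx j (List.mem_cons_of_mem _ hj), Pi.smul_apply,
        hk x hx1.1 hx1.2]
      simp
    · rw [List.flatMap_cons, disp_append, hd, disp_congr e2, (hQz q hq).2.1]
      simp
    · rw [List.flatMap_cons, area_append, hd, area_congr e1, area_smul, hka, area_congr e2,
        (hQz q hq).2.2]
      simp

theorem discForm_append (z : Gen A.h A.q → ℂ) (l : List (Fin A.q)) (j : Fin A.q) :
    A.discForm χ (l ++ [j]) z = A.discForm χ l z + apexArea (χ.hom (A.γ j)) * ‖z (Gen.xi j)‖ ^ 2 -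
      (conj (A.disp χ z (prefixWord l)) * (χ.hom (l.map A.γ).prod * z (Gen.xi j))).im := by
  rw [discForm, prefixWord_append, area_append, wordVal_prefixWord, discForm]
  simp [disp, area, stepC]
  ring

end SurfaceAction

end SingularOrbit

/-! ### Induction over the boundary loops. -/

namespace SingularOrbit

open Complex
open scoped Real ComplexConjugate

universe u

namespace SurfaceAction

variable {G : Type u} [CommGroup G] [Fintype G]

open Classical in
-- The chord closing a prefix is treated as an edge with rotation `ζ`, the product of the rotations
-- so far. A new loop with rotation `η ≠ 1` adds one coordinate. By `apex_completion` the bound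
-- passes from `ζ` to `ζ * η` up to a square. If the rotation numbers add up to more than `1`, the
-- square has a negative coefficient and the coordinate is kept; if they add up to at most `1`, one
-- linear condition is imposed. The lower bound for the dimension grows by one in the first case
-- only, because `turn (ζ * η)` drops an integer there. For `ζ = 1` the coordinate is free, and the
-- bound grows through its last summand.
theorem exists_subspace_prefix (A : SurfaceAction G) (χ : Dual G) (l : List (Fin A.q))
    (hl : l.Nodup) :
    ∃ Q : Submodule ℂ (Gen A.h A.q → ℂ),
      (A.h : ℝ) + (l.map fun j => turn (χ.hom (A.γ j))).sum - turn (χ.hom (l.map A.γ).prod) +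
        (if χ.hom (l.map A.γ).prod = 1 then 0 else 1) ≤ Module.finrank ℂ Q ∧
      ∀ z ∈ Q, (∀ j ∉ l, z (Gen.xi j) = 0) ∧ (∀ j, χ.hom (A.γ j) = 1 → z (Gen.xi j) = 0) ∧
        (χ.hom (l.map A.γ).prod = 1 → A.disp χ z (prefixWord l) = 0) ∧
        A.discForm χ l z ≤
          apexArea (χ.hom (l.map A.γ).prod) * ‖A.disp χ z (prefixWord l)‖ ^ 2 := by
  induction l using List.reverseRecOn with
  | nil =>
    obtain ⟨Q, hQ, hQz⟩ := exists_isotropic_handles A χ (List.finRange A.h) (List.nodup_finRange _)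
    refine ⟨Q, by simp [hQ, turn_one], fun z hz => ?_⟩
    obtain ⟨h1, h2, h3⟩ := hQz z hz
    have h4 (j : Fin A.q) : z (Gen.xi j) = 0 := h1 _ fun i _ => by simp
    refine ⟨fun j _ => h4 j, fun j _ => h4 j, fun _ => ?_, ?_⟩
    · simpa [prefixWord, xiWord] using h2
    · simp [discForm, prefixWord, xiWord, h2, h3]
  | append_singleton l j ih =>
    rw [List.nodup_append] at hl
    obtain ⟨hl, -, hjl⟩ := hl
    replace hjl : j ∉ l := fun h => hjl j h j (by simp) rfl
    obtain ⟨Q, hdim, hQ⟩ := ih hl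
    set ζ := χ.hom (l.map A.γ).prod with hζ
    set η := χ.hom (A.γ j) with hη
    have hζn : ‖ζ‖ = 1 := χ.norm_hom _
    have hηn : ‖η‖ = 1 := χ.norm_hom _
    have hprod : χ.hom ((l ++ [j]).map A.γ).prod = ζ * η := by simp [hζ, hη]
    have hsum : ((l ++ [j]).map fun j => turn (χ.hom (A.γ j))).sum =
        (l.map fun j => turn (χ.hom (A.γ j))).sum + turn η := by simp [hη]
    rw [hprod, hsum]
    simp only [disp_prefixWord_append, discForm_append, ← hζ, ← hη]
    by_cases hη1 : η = 1
    · refine ⟨Q, ?_, fun z hz => ?_⟩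
      · simpa [hη1, turn_one] using hdim
      obtain ⟨h1, h2, h3, h4⟩ := hQ z hz
      have hj0 := h1 j hjl
      refine ⟨fun k hk => h1 k (by simp at hk; exact hk.1), h2, ?_, ?_⟩
      · rw [hj0, hη1]; simpa using h3
      · rw [hj0, hη1]; simpa using h4
    -- enlarge by the new generator
    have hδQ : (Pi.single (Gen.xi j) 1 : Gen A.h A.q → ℂ) ∉ Q := by
      intro h
      have := (hQ _ h).1 j hjl
      simp at this
    set R := Q ⊔ ℂ ∙ (Pi.single (Gen.xi j) 1 : Gen A.h A.q → ℂ) with hR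
    have hRdim : Module.finrank ℂ R = Module.finrank ℂ Q + 1 :=
      finrank_sup_span_singleton_of_notMem hδQ
    have hRz (z) (hz : z ∈ R) : (∀ k ∉ l ++ [j], z (Gen.xi k) = 0) ∧
        (∀ k, χ.hom (A.γ k) = 1 → z (Gen.xi k) = 0) ∧
        (ζ = 1 → A.disp χ z (prefixWord l) = 0) ∧
        A.discForm χ l z ≤ apexArea ζ * ‖A.disp χ z (prefixWord l)‖ ^ 2 := by
      obtain ⟨q, hq, y, hy, rfl⟩ := Submodule.mem_sup.1 hz
      obtain ⟨c, rfl⟩ := Submodule.mem_span_singleton.1 hy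
      obtain ⟨h1, h2, h3, h4⟩ := hQ q hq
      have hne (x) (hx : x ≠ Gen.xi j) :
          (q + c • (Pi.single (Gen.xi j) 1 : Gen A.h A.q → ℂ)) x = q x := by simp [hx]
      have e1 : ∀ s ∈ prefixWord l,
          (q + c • (Pi.single (Gen.xi j) 1 : Gen A.h A.q → ℂ)) s.1 = q s.1 :=
        fun s hs => hne _ (fst_ne_of_mem_prefixWord hs hjl)
      have e2 : ∀ k ∈ l, (q + c • (Pi.single (Gen.xi j) 1 : Gen A.h A.q → ℂ)) (Gen.xi k) =
          q (Gen.xi k) := by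
        intro k hk
        refine hne _ fun h => hjl ?_
        obtain rfl : k = j := by simpa using h
        exact hk
      rw [disp_congr e1, discForm_congr e2 e1]
      refine ⟨fun k hk => ?_, fun k hk => ?_, h3, h4⟩
      · simp only [List.mem_append, List.mem_singleton, not_or] at hk
        rw [hne _ (by simpa using hk.2), h1 k hk.1]
      · have : k ≠ j := fun h => hη1 (by rw [hη, ← h, hk])
        rw [hne _ (by simpa using this), h2 k hk]
    have hnormz (z : Gen A.h A.q → ℂ) : ‖ζ * z (Gen.xi j)‖ = ‖z (Gen.xi j)‖ := by
      rw [norm_mul, hζn, one_mul]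
    have hpe := turn_pos hηn hη1
    -- The prefix closes up, so the new edge itself is the new chord and no square has to be
    -- completed.
    by_cases hζ1 : ζ = 1
    · refine ⟨R, ?_, fun z hz => ?_⟩
      · rw [hRdim, hζ1, one_mul, if_neg hη1]
        rw [hζ1, turn_one, if_pos rfl] at hdim
        push_cast
        linarith
      obtain ⟨h1, h2, h3, h4⟩ := hRz z hz
      have hs := h3 hζ1
      refine ⟨h1, h2, fun h => absurd h (by rw [hζ1, one_mul]; exact hη1), ?_⟩
      rw [hs] at h4 ⊢
      rw [hζ1]
      simp only [norm_zero, map_zero, zero_mul, zero_im, one_mul, zero_add, sub_zero, ne_eq,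
        OfNat.ofNat_ne_zero, not_false_eq_true, zero_pow, mul_zero] at h4 ⊢
      linarith
    have hpz := turn_pos hζn hζ1
    rw [if_neg hζ1] at hdim
    by_cases hζη : ζ * η = 1
    · have ht : turn ζ + turn η = 1 := by
        have h0 : turn (ζ * η) = 0 := by rw [hζη, turn_one]
        rcases lt_or_ge (turn ζ + turn η) 1 with h | h
        · rw [turn_mul_of_lt hζn hηn h] at h0
          linarith
        · rw [turn_mul_of_le hζn hηn h] at h0
          linarith
      have hap := apexArea_add_eq_zero hζn hζ1 hηn hη1 ht
      -- The condition imposed is that the longer path closes up.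
      let f : (Gen A.h A.q → ℂ) →ₗ[ℂ] ℂ :=
        A.dispL χ (prefixWord l) + ζ • LinearMap.proj (Gen.xi j)
      refine ⟨R ⊓ LinearMap.ker f, ?_, fun z hz => ?_⟩
      · have := finrank_le_finrank_inf_ker_add_one R f
        have h5 : ((Module.finrank ℂ Q + 1 : ℕ) : ℝ) ≤ Module.finrank ℂ
            (R ⊓ LinearMap.ker f : Submodule ℂ (Gen A.h A.q → ℂ)) + 1 := by
          rw [← hRdim]; exact_mod_cast this
        rw [hζη, turn_one, if_pos rfl]
        push_cast at h5
        linarith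
      obtain ⟨h1, h2, h3, h4⟩ := hRz z hz.1
      have hf : A.disp χ z (prefixWord l) + ζ * z (Gen.xi j) = 0 := hz.2
      refine ⟨h1, h2, fun _ => hf, ?_⟩
      rw [hf, hζη, ← hnormz z]
      have he : ζ * z (Gen.xi j) = - A.disp χ z (prefixWord l) := by
        linear_combination hf
      rw [he, norm_neg, mul_neg, neg_im, mul_comm (conj _), Complex.mul_conj, ofReal_im, neg_zero,
        sub_zero, norm_zero]
      have : apexArea ζ * ‖A.disp χ z (prefixWord l)‖ ^ 2 +
          apexArea η * ‖A.disp χ z (prefixWord l)‖ ^ 2 = 0 := by rw [← add_mul, hap, zero_mul]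
      simp only [ne_eq, OfNat.ofNat_ne_zero, not_false_eq_true, zero_pow, mul_zero]
      linarith
    have hmul := apexArea_mul hζn hζ1 hηn hη1 hζη
    rcases lt_trichotomy (turn ζ + turn η) 1 with ht | ht | ht
    · have hap := apexArea_add_pos hζn hζ1 hηn hη1 ht
      -- The linear form whose squared norm is the positive error term in `apex_completion`.
      let f : (Gen A.h A.q → ℂ) →ₗ[ℂ] ℂ :=
        (2 * apexArea ζ + I : ℂ) • A.dispL χ (prefixWord l) -
          ((2 * apexArea η - I : ℂ) * ζ) • LinearMap.proj (Gen.xi j)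
      refine ⟨R ⊓ LinearMap.ker f, ?_, fun z hz => ?_⟩
      · have := finrank_le_finrank_inf_ker_add_one R f
        have h5 : ((Module.finrank ℂ Q + 1 : ℕ) : ℝ) ≤ Module.finrank ℂ
            (R ⊓ LinearMap.ker f : Submodule ℂ (Gen A.h A.q → ℂ)) + 1 := by
          rw [← hRdim]; exact_mod_cast this
        rw [turn_mul_of_lt hζn hηn ht, if_neg hζη]
        push_cast at h5
        linarith
      obtain ⟨h1, h2, h3, h4⟩ := hRz z hz.1
      have hf : (2 * apexArea ζ + I : ℂ) * A.disp χ z (prefixWord l) -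
          ((2 * apexArea η - I : ℂ) * ζ) * z (Gen.xi j) = 0 := hz.2
      refine ⟨h1, h2, fun h => absurd h hζη, ?_⟩
      have hc := apex_completion hap.ne' hmul (A.disp χ z (prefixWord l)) (ζ * z (Gen.xi j))
      rw [show (2 * apexArea ζ + I : ℂ) * A.disp χ z (prefixWord l) -
          (2 * apexArea η - I : ℂ) * (ζ * z (Gen.xi j)) = 0 by rw [← hf]; ring, norm_zero,
          hnormz] at hc
      simp only [ne_eq, OfNat.ofNat_ne_zero, not_false_eq_true, zero_pow, zero_div,
        add_zero] at hc
      linarith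
    · exfalso
      have h0 := turn_mul_of_le hζn hηn ht.ge
      rw [ht, sub_self] at h0
      exact (turn_pos (by rw [norm_mul, hζn, hηn, one_mul]) hζη).ne' h0
    · have hap := apexArea_add_neg hζn hζ1 hηn hη1 ht
      refine ⟨R, ?_, fun z hz => ?_⟩
      · rw [hRdim, turn_mul_of_le hζn hηn ht.le, if_neg hζη]
        push_cast
        linarith
      obtain ⟨h1, h2, h3, h4⟩ := hRz z hz
      refine ⟨h1, h2, fun h => absurd h hζη, ?_⟩
      have hc := apex_completion hap.ne hmul (A.disp χ z (prefixWord l)) (ζ * z (Gen.xi j))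
      have hneg : ‖(2 * apexArea ζ + I : ℂ) * A.disp χ z (prefixWord l) -
          (2 * apexArea η - I : ℂ) * (ζ * z (Gen.xi j))‖ ^ 2 / (4 * (apexArea ζ + apexArea η)) ≤ 0 :=
        div_nonpos_of_nonneg_of_nonpos (by positivity) (by linarith)
      rw [hnormz] at hc
      linarith

/-- A subspace of twisted cocycles of the expected dimension on which the Hermitian form of the
intersection pairing is nonpositive. -/
theorem exists_nonpos_subspace (A : SurfaceAction G) (χ : Dual G) :
    ∃ Q : Submodule ℂ (Gen A.h A.q → ℂ),
      (A.h : ℝ) + ∑ j, turn (χ.hom (A.γ j)) ≤ Module.finrank ℂ Q ∧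
      ∀ z ∈ Q, (∀ j, χ.hom (A.γ j) = 1 → z (Gen.xi j) = 0) ∧
        A.disp χ z (surfaceWord A.h A.q) = 0 ∧ A.discForm χ (List.finRange A.q) z ≤ 0 := by
  obtain ⟨Q, hdim, hQ⟩ := exists_subspace_prefix A χ (List.finRange A.q) (List.nodup_finRange _)
  have h1 : χ.hom ((List.finRange A.q).map A.γ).prod = 1 := by rw [prod_γ, map_one]
  have hs : ((List.finRange A.q).map fun j => turn (χ.hom (A.γ j))).sum =
      ∑ j, turn (χ.hom (A.γ j)) := by
    rw [← List.ofFn_eq_map, List.sum_ofFn]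
  refine ⟨Q, ?_, fun z hz => ?_⟩
  · rw [h1, hs, turn_one, if_pos rfl] at hdim
    linarith
  · obtain ⟨-, h2, h3, h4⟩ := hQ z hz
    refine ⟨h2, h3 h1, ?_⟩
    rwa [h3 h1, norm_zero, zero_pow two_ne_zero, mul_zero] at h4

end SurfaceAction

end SingularOrbit

/-! ### Isotypic components and a lower bound for each multiplicity. -/

namespace SingularOrbit

open Complex
open scoped Real ComplexConjugate

universe u

/-! ### Multiplicities of characters -/

section Multiplicity

variable {G : Type u} [CommGroup G] {V : Type*} [AddCommGroup V] [Module ℂ V]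

/-- The isotypic component of a character. -/
def isotypic (ρ : Representation ℂ G V) (χ : Dual G) : Submodule ℂ V where
  carrier := {x | ∀ c, ρ c x = χ.hom c • x}
  zero_mem' c := by simp
  add_mem' hx hy c := by rw [map_add, hx c, hy c, smul_add]
  smul_mem' a x hx c := by rw [map_smul, hx c, smul_comm]

variable [Fintype G]

/-- The projection to the isotypic component of a character. -/
noncomputable def isotypicProj (ρ : Representation ℂ G V) (χ : Dual G) : Module.End ℂ V :=
  (Fintype.card G : ℂ)⁻¹ • ∑ g, (χ.hom g)⁻¹ • ρ g

theorem isProj_isotypicProj (ρ : Representation ℂ G V) (χ : Dual G) :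
    LinearMap.IsProj (isotypic ρ χ) (isotypicProj ρ χ) where
  map_mem x c := by
    simp only [isotypicProj, LinearMap.smul_apply, LinearMap.sum_apply, map_smul, map_sum]
    rw [smul_comm]
    congr 1
    rw [Finset.smul_sum, ← Equiv.sum_comp (Equiv.mulLeft c) (fun g => χ.hom c • (χ.hom g)⁻¹ • ρ g x)]
    refine Finset.sum_congr rfl fun g _ => ?_
    rw [Equiv.coe_mulLeft, map_mul, map_mul, smul_smul, mul_inv, mul_inv_cancel_left₀
      (χ.hom_ne_zero c)]
    rfl
  map_id x hx := by
    have h (g : G) : (χ.hom g)⁻¹ • ρ g x = x := by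
      rw [hx g, smul_smul, inv_mul_cancel₀ (χ.hom_ne_zero g), one_smul]
    simp only [isotypicProj, LinearMap.smul_apply, LinearMap.sum_apply, h, Finset.sum_const,
      Finset.card_univ]
    rw [← Nat.cast_smul_eq_nsmul ℂ, smul_smul, inv_mul_cancel₀ (by simp), one_smul]

/-- The multiplicity of a character in a representation. -/
noncomputable def multiplicity (ρ : Representation ℂ G V) (χ : Dual G) : ℕ :=
  Module.finrank ℂ (isotypic ρ χ)

theorem multiplicity_eq [FiniteDimensional ℂ V] (ρ : Representation ℂ G V) (χ : Dual G) :
    (multiplicity ρ χ : ℂ) = (Fintype.card G : ℂ)⁻¹ * ∑ g, (χ.hom g)⁻¹ * ρ.character g := by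
  rw [multiplicity, ← (isProj_isotypicProj ρ χ).trace, isotypicProj, map_smul, map_sum]
  simp [Representation.character]

theorem character_eq_charSum [FiniteDimensional ℂ V] (ρ : Representation ℂ G V) :
    ρ.character = charSum fun χ => (multiplicity ρ χ : ℝ) := by
  classical
  funext g
  simp only [charSum, AddMonoidHom.coe_mk, ZeroHom.coe_mk, ofReal_natCast, multiplicity_eq,
    mul_assoc, ← Finset.mul_sum, Finset.sum_mul]
  rw [Finset.sum_comm]
  have h (x : G) : ∑ χ : Dual G, (χ.hom x)⁻¹ * (ρ.character x * χ.hom g) =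
      if x = g then (Fintype.card G : ℂ) * ρ.character x else 0 := by
    calc _ = ρ.character x * ∑ χ : Dual G, χ.hom (g * x⁻¹) := by
          rw [Finset.mul_sum]
          refine Finset.sum_congr rfl fun χ _ => ?_
          rw [map_mul, χ.hom_inv]; ring
      _ = _ := by rw [sum_dual_hom]; simp [mul_inv_eq_one, eq_comm, mul_comm]
  simp only [h, Finset.sum_ite_eq', Finset.mem_univ, if_true]
  rw [inv_mul_cancel_left₀ (by simp)]

theorem sum_multiplicity [FiniteDimensional ℂ V] (ρ : Representation ℂ G V) :
    ∑ χ, multiplicity ρ χ = Module.finrank ℂ V := by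
  have h := congrFun (character_eq_charSum ρ) 1
  rw [Representation.char_one] at h
  simp only [charSum, AddMonoidHom.coe_mk, ZeroHom.coe_mk, map_one, mul_one, ofReal_natCast] at h
  exact_mod_cast h.symm

end Multiplicity

/-! ### The lower bound for the multiplicities -/

/-- The complex linear part of a real linear map. -/
def complexPart {V W : Type*} [AddCommGroup V] [Module ℂ V] [AddCommGroup W] [Module ℂ W]
    (r : W →ₗ[ℝ] V) : W →ₗ[ℂ] V where
  toFun w := r w - I • r (I • w)
  map_add' w w' := by simp only [smul_add, map_add]; abel
  map_smul' c w := by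
    have h (c : ℂ) (w : W) : r (c • w) = (c.re : ℂ) • r w + (c.im : ℂ) • r (I • w) := by
      conv_lhs => rw [← Complex.re_add_im c, add_smul, mul_smul, map_add]
      rw [Complex.coe_smul, map_smul, Complex.coe_smul, map_smul, Complex.coe_smul, Complex.coe_smul]
    rw [smul_comm I c w, h c w, h c (I • w), RingHom.id_apply, smul_smul I I w, I_mul_I,
      neg_one_smul, map_neg, smul_sub, smul_smul c I]
    conv_rhs => rw [← Complex.re_add_im c]
    simp only [smul_add, smul_neg, smul_smul, add_smul, add_mul]
    rw [show (c.im : ℂ) * I * I = -(c.im : ℂ) by rw [mul_assoc, I_mul_I]; ring,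
      show I * (c.im : ℂ) = c.im * I by ring, show I * (c.re : ℂ) = c.re * I by ring]
    rw [neg_smul]
    abel

namespace SurfaceAction

variable {G : Type u} [CommGroup G] (A : SurfaceAction G) (χ : Dual G)

/-- The twisted cocycles. -/
noncomputable def twistedCocycles : Submodule ℂ (Gen A.h A.q → ℂ) where
  carrier := {z | (∀ j, χ.hom (A.γ j) = 1 → z (Gen.xi j) = 0) ∧
    A.disp χ z (surfaceWord A.h A.q) = 0}
  zero_mem' := ⟨fun _ _ => rfl, (A.dispL χ _).map_zero⟩
  add_mem' hz hz' := ⟨fun j hj => by rw [Pi.add_apply, hz.1 j hj, hz'.1 j hj, add_zero],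
    by rw [disp_add, hz.2, hz'.2, add_zero]⟩
  smul_mem' c z hz := ⟨fun j hj => by rw [Pi.smul_apply, hz.1 j hj, smul_zero],
    by rw [disp_smul, hz.2, mul_zero]⟩

variable {A χ}

/-- The real part of a twisted cocycle. -/
noncomputable def reCocycle : A.twistedCocycles χ →ₗ[ℝ] A.cocycles where
  toFun z := ⟨A.reC (A.twist χ z.1),
    fun g => by rw [pathSum_reC_twist, z.2.2, mul_zero, zero_re],
    fun j g => by rw [pathSum_reC_twist, disp_discWord j (z.2.1 j), mul_zero, zero_re]⟩
  map_add' z z' := by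
    apply Subtype.ext; funext e
    simp [reC, twist]
    ring
  map_smul' c z := by
    apply Subtype.ext; funext e
    simp [reC, twist]
    ring

theorem coe_reCocycle (z : A.twistedCocycles χ) : (reCocycle z).1 = A.reC (A.twist χ z.1) := rfl

theorem coe_reCocycle_I_smul (z : A.twistedCocycles χ) :
    (reCocycle (-(I • z))).1 = A.imC (A.twist χ z.1) := by
  funext e
  simp [coe_reCocycle, reC, imC, twist]
  ring

theorem translate_reCocycle (c : G) (z : A.twistedCocycles χ) :
    A.translate c (reCocycle z) = reCocycle ((χ.hom c)⁻¹ • z) := by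
  apply Subtype.ext
  funext e
  simp [translate, coe_reCocycle, reC, twist, Dual.hom_inv, mul_comm, mul_left_comm]

variable [Fintype G]

/-- All starting points in `G` contribute equal areas, and the weight `1 / ν_j` cancels the number
of triangles in a disc. -/
theorem pairing_reCocycle (z : A.twistedCocycles χ) :
    A.pairing (reCocycle z) (reCocycle (-(I • z))) =
      (Fintype.card G : ℝ) / 2 * A.discForm χ (List.finRange A.q) z.1 := by
  have hdisc (j : Fin A.q) : A.area χ z.1 (A.discWord j) =
      orderOf (A.γ j) * (apexArea (χ.hom (A.γ j)) * ‖z.1 (Gen.xi j)‖ ^ 2) := by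
    by_cases h : χ.hom (A.γ j) = 1
    · rw [z.2.1 j h, discWord, area_replicate_of_eq_zero (z.2.1 j h)]
      simp
    · exact area_discWord j h
  have hν (j : Fin A.q) : (orderOf (A.γ j) : ℝ) ≠ 0 := by
    exact_mod_cast (orderOf_pos (A.γ j)).ne'
  have hs : ((List.finRange A.q).map fun j =>
      apexArea (χ.hom (A.γ j)) * ‖z.1 (Gen.xi j)‖ ^ 2).sum =
      ∑ j, apexArea (χ.hom (A.γ j)) * ‖z.1 (Gen.xi j)‖ ^ 2 := by
    rw [← List.ofFn_eq_map, List.sum_ofFn]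
  rw [pairing, coe_reCocycle, coe_reCocycle_I_smul, discForm, hs]
  simp only [crossSum_twist, Finset.sum_const, Finset.card_univ, nsmul_eq_mul, hdisc]
  rw [show prefixWord (List.finRange A.q) = surfaceWord A.h A.q from rfl]
  have h2 (j : Fin A.q) : 1 / (orderOf (A.γ j) : ℝ) * ((Fintype.card G : ℝ) *
      (orderOf (A.γ j) * (apexArea (χ.hom (A.γ j)) * ‖z.1 (Gen.xi j)‖ ^ 2))) =
      Fintype.card G * (apexArea (χ.hom (A.γ j)) * ‖z.1 (Gen.xi j)‖ ^ 2) := by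
    have := hν j
    field_simp
  simp only [h2, ← Finset.mul_sum]
  ring

/-- A twisted cocycle whose real and imaginary parts are coboundaries is a twisted coboundary. -/
theorem mem_span_of_coboundary (z : A.twistedCocycles χ) (f f' : G → ℝ)
    (hf : A.d f = A.reC (A.twist χ z.1)) (hf' : A.d f' = A.imC (A.twist χ z.1)) :
    z.1 ∈ ℂ ∙ (fun x => χ.hom (A.val x) - 1) := by
  let F : G → ℂ := fun g => f g + f' g * I
  have hF (g : G) (x) : χ.hom g * z.1 x = F (g * A.val x) - F g := by
    have h1 : f (g * A.val x) - f g = (χ.hom g * z.1 x).re := congrFun hf (g, x)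
    have h2 : f' (g * A.val x) - f' g = (χ.hom g * z.1 x).im := congrFun hf' (g, x)
    rw [← Complex.re_add_im (χ.hom g * z.1 x), ← h1, ← h2]
    simp only [F]
    push_cast
    ring
  -- The coefficient is the `χ`-component of the complex primitive `F`.
  refine Submodule.mem_span_singleton.2 ⟨(Fintype.card G : ℂ)⁻¹ * ∑ g, (χ.hom g)⁻¹ * F g, ?_⟩
  funext x
  have h1 : ∑ g, (χ.hom g)⁻¹ * (χ.hom g * z.1 x) = Fintype.card G * z.1 x := by
    simp [inv_mul_cancel_left₀ (χ.hom_ne_zero _)]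
  have h2 : ∑ g, (χ.hom g)⁻¹ * F (g * A.val x) = χ.hom (A.val x) * ∑ g, (χ.hom g)⁻¹ * F g := by
    rw [← Equiv.sum_comp (Equiv.mulRight (A.val x)) (fun g => (χ.hom g)⁻¹ * F g), Finset.mul_sum]
    refine Finset.sum_congr rfl fun g _ => ?_
    rw [Equiv.coe_mulRight, map_mul, mul_inv]
    field_simp [χ.hom_ne_zero]
  simp only [hF, mul_sub, Finset.sum_sub_distrib, h2] at h1
  have h0 : (Fintype.card G : ℂ) ≠ 0 := by simp
  rw [Pi.smul_apply, smul_eq_mul, mul_assoc, inv_mul_eq_iff_eq_mul₀ h0]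
  linear_combination h1

open Classical in
-- The real linear map `r` to `ℂⁿ` need not be complex linear, but its complex linear part maps to
-- the isotypic component of `χ⁻¹`. On the kernel of that part `r` is antilinear and the area form
-- is a squared norm, whereas it is nonpositive on `Q`. So `r` vanishes there, and only twisted
-- coboundaries survive: at most a line, and zero for `χ = 1`.
theorem le_multiplicity {n : ℕ} {ρ : Representation ℂ G (EuclideanSpace ℂ (Fin n))}
    (hρ : A.IsUnitaryRep ρ) (χ : Dual G) :
    (A.h : ℝ) + ∑ j, turn (χ.hom (A.γ j)) ≤
      multiplicity ρ χ⁻¹ + (if χ = 1 then 0 else 1 : ℕ) := by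
  obtain ⟨-, e, he, hpair⟩ := hρ
  obtain ⟨Q, hdim, hQ⟩ := A.exists_nonpos_subspace χ
  refine hdim.trans ?_
  have hQZ : Q ≤ A.twistedCocycles χ := fun z hz => ⟨(hQ z hz).1, (hQ z hz).2.1⟩
  let r : A.twistedCocycles χ →ₗ[ℝ] EuclideanSpace ℂ (Fin n) :=
    e.toLinearMap ∘ₗ (Submodule.mkQ _) ∘ₗ reCocycle
  have hr (z) : r z = e (Submodule.Quotient.mk (reCocycle z)) := rfl
  let E : Q →ₗ[ℂ] EuclideanSpace ℂ (Fin n) := complexPart r ∘ₗ Submodule.inclusion hQZ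
  have hrange : LinearMap.range E ≤ isotypic ρ χ⁻¹ := by
    rintro _ ⟨z, rfl⟩ c
    have hc (w : A.twistedCocycles χ) : ρ c (r w) = r ((χ.hom c)⁻¹ • w) := by
      rw [hr, hr, ← he, translate_reCocycle]
    have : ρ c (complexPart r (Submodule.inclusion hQZ z)) =
        complexPart r ((χ.hom c)⁻¹ • Submodule.inclusion hQZ z) := by
      change ρ c (r _ - I • r _) = r _ - I • r _
      rw [map_sub, map_smul, hc, hc, smul_comm I]
    change ρ c (complexPart r _) = _ • complexPart r _
    rw [this, map_smul, Dual.inv_hom]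
  have hker (z : Q) (hz : E z = 0) : z.1 ∈ ℂ ∙ (fun x => χ.hom (A.val x) - 1) := by
    set w := Submodule.inclusion hQZ z with hw
    have h1 : r w - I • r (I • w) = 0 := hz
    set y := r (-(I • w)) with hy
    have h2 : r w = -(I • y) := by
      rw [hy, map_neg, smul_neg, neg_neg, ← sub_eq_zero, h1]
    -- The inner product is conjugate linear in its first argument, so the imaginary part of `⟨-I y,
    -- y⟩` is `+‖y‖²`.
    have h3 : A.pairing (reCocycle w) (reCocycle (-(I • w))) = ‖y‖ ^ 2 := by
      rw [hpair, ← hr, ← hr, ← hy, h2, inner_neg_left, inner_smul_left, inner_self_eq_norm_sq_to_K]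
      simp [← ofReal_pow]
    have h4 : ‖y‖ ^ 2 ≤ 0 := by
      rw [← h3, pairing_reCocycle]
      exact mul_nonpos_of_nonneg_of_nonpos (by positivity) (hQ z.1 z.2).2.2
    have hy0 : y = 0 := by
      have : ‖y‖ = 0 := by nlinarith [norm_nonneg y]
      simpa using this
    have hw0 : r w = 0 := by rw [h2, hy0, smul_zero, neg_zero]
    have hcob (u : A.cocycles) (hu : e (Submodule.Quotient.mk u) = 0) : ∃ f, A.d f = u.1 := by
      rw [LinearEquiv.map_eq_zero_iff, Submodule.Quotient.mk_eq_zero] at hu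
      exact hu
    obtain ⟨f, hf⟩ := hcob _ hw0
    obtain ⟨f', hf'⟩ := hcob _ hy0
    rw [coe_reCocycle_I_smul] at hf'
    exact mem_span_of_coboundary w f f' hf hf'
  have hrk := LinearMap.finrank_range_add_finrank_ker E
  have h1 : Module.finrank ℂ (LinearMap.range E) ≤ multiplicity ρ χ⁻¹ :=
    Submodule.finrank_mono hrange
  have h2 : Module.finrank ℂ (LinearMap.ker E) ≤ if χ = 1 then 0 else 1 := by
    have hle : (LinearMap.ker E).map Q.subtype ≤ ℂ ∙ (fun x => χ.hom (A.val x) - 1) := by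
      rintro _ ⟨z, hz, rfl⟩
      exact hker z hz
    have h3 := Submodule.finrank_mono hle
    rw [Submodule.finrank_map_subtype_eq] at h3
    refine h3.trans ?_
    split_ifs with h
    · subst h
      have h0 : (fun x => (1 : Dual G).hom (A.val x) - 1) = 0 := by
        funext x
        rw [Dual.one_hom, sub_self, Pi.zero_apply]
      rw [h0, Submodule.span_zero_singleton, finrank_bot]
    · exact (finrank_span_le_card _).trans (by simp)
  have : Module.finrank ℂ Q ≤ multiplicity ρ χ⁻¹ + if χ = 1 then 0 else 1 := by omega
  exact_mod_cast this

end SurfaceAction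

end SingularOrbit

/-! ### Upper bound for the dimension of the first cohomology. -/

namespace SingularOrbit

open Complex
open scoped Real ComplexConjugate

universe u

namespace SurfaceAction

variable {G : Type u} [CommGroup G] (A : SurfaceAction G) (χ : Dual G)

/-! ### Dimensions of spaces of twisted cocycles -/

variable {A χ} {z : Gen A.h A.q → ℂ}

theorem disp_handles (l : List (Fin A.h)) :
    A.disp χ z (l.flatMap handleWord) = (l.map fun i =>
      (1 - χ.hom (A.val (Gen.b i))) * z (Gen.a i) -
        (1 - χ.hom (A.val (Gen.a i))) * z (Gen.b i)).sum := by
  induction l with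
  | nil => rfl
  | cons i l ih =>
    rw [List.flatMap_cons, disp_append, disp_handleWord, wordVal_handleWord, map_one, one_mul, ih,
      List.map_cons, List.sum_cons]

theorem disp_eq_zero {w : List (Gen A.h A.q × Bool)} (h : ∀ s ∈ w, z s.1 = 0) :
    A.disp χ z w = 0 :=
  (disp_congr (z' := 0) h).trans (A.dispL χ w).map_zero

theorem disp_xiWord_ne_zero {l : List (Fin A.q)} (hl : l.Nodup) {j : Fin A.q} (hj : j ∈ l)
    (hz : z (Gen.xi j) ≠ 0) (h : ∀ k ≠ j, z (Gen.xi k) = 0) : A.disp χ z (xiWord l) ≠ 0 := by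
  induction l with
  | nil => simp at hj
  | cons k l ih =>
    obtain ⟨hk, hl⟩ := List.nodup_cons.1 hl
    change z (Gen.xi k) + χ.hom (A.γ k) * A.disp χ z (xiWord l) ≠ 0
    by_cases hkj : k = j
    · subst hkj
      rw [disp_eq_zero, mul_zero, add_zero]
      · exact hz
      · intro s hs
        obtain ⟨m, hm, rfl⟩ := List.mem_map.1 hs
        exact h m fun e => hk (e ▸ hm)
    · rw [h k hkj, zero_add]
      exact mul_ne_zero (χ.hom_ne_zero _)
        (ih hl ((List.mem_cons.1 hj).resolve_left (Ne.symm hkj)))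

variable (A χ) in
/-- The twisted cochains that vanish on the generators `ξ_j` on which the character is trivial. -/
def twistedCochains : Submodule ℂ (Gen A.h A.q → ℂ) where
  carrier := {z | ∀ j, χ.hom (A.γ j) = 1 → z (Gen.xi j) = 0}
  zero_mem' := fun _ _ => rfl
  add_mem' hz hz' := fun j hj => by rw [Pi.add_apply, hz j hj, hz' j hj, add_zero]
  smul_mem' c z hz := fun j hj => by rw [Pi.smul_apply, hz j hj, smul_zero]

theorem twistedCocycles_le : A.twistedCocycles χ ≤ A.twistedCochains χ := fun _ hz => hz.1

open Classical in
theorem finrank_twistedCochains_le : Module.finrank ℂ (A.twistedCochains χ) ≤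
    2 * A.h + Fintype.card {j // χ.hom (A.γ j) ≠ 1} := by
  let f : A.twistedCochains χ →ₗ[ℂ]
      (Fin A.h → ℂ) × (Fin A.h → ℂ) × ({j // χ.hom (A.γ j) ≠ 1} → ℂ) :=
    { toFun := fun z => (fun i => z.1 (Gen.a i), fun i => z.1 (Gen.b i), fun j => z.1 (Gen.xi j.1))
      map_add' := fun _ _ => rfl
      map_smul' := fun _ _ => rfl }
  have hf : Function.Injective f := by
    rw [← LinearMap.ker_eq_bot, LinearMap.ker_eq_bot']
    intro z hz
    apply Subtype.ext
    funext x
    simp only [f, LinearMap.coe_mk, AddHom.coe_mk, Prod.mk_eq_zero] at hz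
    obtain ⟨h1, h2, h3⟩ := hz
    match x with
    | .a i => exact congrFun h1 i
    | .b i => exact congrFun h2 i
    | .xi j =>
      by_cases hj : χ.hom (A.γ j) = 1
      · exact z.2 j hj
      · exact congrFun h3 ⟨j, hj⟩
  refine (LinearMap.finrank_le_finrank_of_injective hf).trans ?_
  simp only [Module.finrank_prod, Module.finrank_pi, Fintype.card_fin]
  omega

theorem exists_val_ne_one (A : SurfaceAction G) (hχ : χ ≠ 1) : ∃ x, χ.hom (A.val x) ≠ 1 := by
  by_contra! h
  have h1 : χ.hom.ker = ⊤ := A.eq_top_of_val_mem h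
  apply hχ
  ext g
  have : Additive.toMul g ∈ χ.hom.ker := h1 ▸ Subgroup.mem_top _
  exact this

/-- Some generator is nontrivial under `χ` because `p` is surjective. If it is `a_i`, the unit
cochain at `b_i` violates the polygon condition, and conversely; if it is `ξ_j`, its own unit
cochain does. -/
theorem twistedCocycles_lt (hχ : χ ≠ 1) : A.twistedCocycles χ < A.twistedCochains χ := by
  classical
  refine lt_of_le_of_ne twistedCocycles_le fun heq => ?_
  suffices h : ∃ z ∈ A.twistedCochains χ, A.disp χ z (surfaceWord A.h A.q) ≠ 0 by
    obtain ⟨z, hz, h⟩ := h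
    rw [← heq] at hz
    exact h hz.2
  have hxi {y : Gen A.h A.q} (hy : ∀ j, Gen.xi j ≠ y) :
      (Pi.single y 1 : Gen A.h A.q → ℂ) ∈ A.twistedCochains χ ∧
        A.disp χ (Pi.single y 1) (xiWord (List.finRange A.q)) = 0 := by
    have h0 (j : Fin A.q) : (Pi.single y 1 : Gen A.h A.q → ℂ) (Gen.xi j) = 0 :=
      Pi.single_eq_of_ne (hy j) 1
    refine ⟨fun j _ => h0 j, disp_eq_zero fun s hs => ?_⟩
    obtain ⟨m, -, rfl⟩ := List.mem_map.1 hs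
    exact h0 m
  obtain ⟨x, hx⟩ := A.exists_val_ne_one hχ
  match x with
  | .a i =>
    obtain ⟨h1, h2⟩ := hxi (y := Gen.b i) (by simp)
    refine ⟨_, h1, ?_⟩
    rw [surfaceWord_eq, disp_append, h2, mul_zero, add_zero, disp_handles, ← List.ofFn_eq_map,
      List.sum_ofFn, Finset.sum_eq_single i]
    · simpa [sub_eq_zero] using hx
    · intro k _ hk
      simp [hk]
    · simp
  | .b i =>
    obtain ⟨h1, h2⟩ := hxi (y := Gen.a i) (by simp)
    refine ⟨_, h1, ?_⟩
    rw [surfaceWord_eq, disp_append, h2, mul_zero, add_zero, disp_handles, ← List.ofFn_eq_map,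
      List.sum_ofFn, Finset.sum_eq_single i]
    · simpa [sub_eq_zero] using Ne.symm hx
    · intro k _ hk
      simp [hk]
    · simp
  | .xi j =>
    refine ⟨Pi.single (Gen.xi j) 1, ?_, ?_⟩
    · intro k hk
      refine Pi.single_eq_of_ne ?_ 1
      rintro ⟨rfl⟩
      exact hx hk
    · rw [surfaceWord_eq, disp_append, wordVal_handles, map_one, one_mul, disp_eq_zero, zero_add]
      · refine disp_xiWord_ne_zero (List.nodup_finRange _) (List.mem_finRange j) (by simp) ?_
        intro k hk
        simp [hk]
      · intro s hs
        obtain ⟨i, -, h | h⟩ := fst_ne_of_mem_handles hs <;> simp [h]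

open Classical in
theorem finrank_twistedCocycles_le : Module.finrank ℂ (A.twistedCocycles χ) +
    (if χ = 1 then 0 else 1) ≤ 2 * A.h + Fintype.card {j // χ.hom (A.γ j) ≠ 1} := by
  refine le_trans ?_ finrank_twistedCochains_le
  split_ifs with h
  · exact Submodule.finrank_mono twistedCocycles_le
  · exact Submodule.finrank_lt_finrank_of_lt (twistedCocycles_lt h)

/-! ### Coboundaries -/

theorem pathSum_d (f : G → ℝ) (g : G) (w : List (Gen A.h A.q × Bool)) :
    A.pathSum (A.d f) g w = f (g * A.wordVal w) - f g := by
  induction w generalizing g with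
  | nil => simp [pathSum, wordVal]
  | cons s w ih =>
    rw [pathSum, ih, next_eq, wordVal_cons, mul_assoc]
    obtain ⟨x, _ | _⟩ := s
    · simp [step, d, letterVal]
    · simp [step, d, letterVal]

theorem wordVal_discWord (j : Fin A.q) : A.wordVal (A.discWord j) = 1 := by
  rw [wordVal, discWord, List.map_replicate, List.prod_replicate]
  exact pow_orderOf_eq_one _

theorem range_d_le : LinearMap.range A.d ≤ A.cocycles := by
  rintro _ ⟨f, rfl⟩
  exact ⟨fun g => by rw [pathSum_d, wordVal_surfaceWord, mul_one, sub_self],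
    fun j g => by rw [pathSum_d, wordVal_discWord, mul_one, sub_self]⟩

theorem eq_const_of_d_eq_zero {f : G → ℝ} (hf : A.d f = 0) (g : G) : f g = f 1 := by
  have h (g : G) (x) : f (g * A.val x) = f g := sub_eq_zero.1 (congrFun hf (g, x))
  let K : Subgroup G :=
    { carrier := {c | ∀ g, f (g * c) = f g}
      one_mem' := fun g => by rw [mul_one]
      mul_mem' := fun {a b} ha hb g => by rw [← mul_assoc, hb, ha]
      inv_mem' := fun {a} ha g => by rw [← ha, inv_mul_cancel_right] }
  have hK : K = ⊤ := A.eq_top_of_val_mem fun x g => h g x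
  have : g ∈ K := hK ▸ Subgroup.mem_top g
  simpa using this 1

theorem card_dual [Fintype G] : Fintype.card (Dual G) = Fintype.card G := by
  rw [AddChar.card_eq, Fintype.card_congr Additive.toMul]

open Classical in
theorem sum_ite_eq_one_add_one [Fintype G] :
    ∑ χ : Dual G, (if χ = 1 then 0 else 1) + 1 = Fintype.card G := by
  rw [← card_dual, ← Finset.card_univ, ← Finset.card_erase_add_one (Finset.mem_univ (1 : Dual G)),
    Finset.card_eq_sum_ones]
  refine congrArg (· + 1) ((Finset.sum_erase Finset.univ ?_).symm.trans
    (Finset.sum_congr rfl fun χ hχ => if_neg (Finset.ne_of_mem_erase hχ)))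
  exact if_pos rfl

/-! ### The Fourier transform of cochains -/

variable [Fintype G]

/-- The component of a complex cochain for a character. -/
noncomputable def fourier (χ : Dual G) (u v : A.Cochain) (x : Gen A.h A.q) : ℂ :=
  ∑ g, (χ.hom g)⁻¹ * (u (g, x) + v (g, x) * I)

theorem sum_inv_hom_mul (χ : Dual G) (F : G → ℂ) (c : G) :
    ∑ g, (χ.hom g)⁻¹ * F (g * c) = χ.hom c * ∑ g, (χ.hom g)⁻¹ * F g := by
  rw [← Equiv.sum_comp (Equiv.mulRight c) (fun g => (χ.hom g)⁻¹ * F g), Finset.mul_sum]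
  refine Finset.sum_congr rfl fun g _ => ?_
  have := χ.hom_ne_zero c
  rw [Equiv.coe_mulRight, map_mul, mul_inv]
  field_simp

theorem disp_fourier (u v : A.Cochain) (w : List (Gen A.h A.q × Bool)) :
    A.disp χ (fourier χ u v) w = ∑ g, (χ.hom g)⁻¹ * (A.pathSum u g w + A.pathSum v g w * I) := by
  induction w with
  | nil => simp [disp, pathSum]
  | cons s w ih =>
    have h1 : A.stepC χ (fourier χ u v) s =
        ∑ g, (χ.hom g)⁻¹ * (A.step u g s + A.step v g s * I) := by
      obtain ⟨x, _ | _⟩ := s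
      · have := sum_inv_hom_mul χ (fun g => (u (g, x) + v (g, x) * I : ℂ)) (A.val x)⁻¹
        simp only [stepC, step, cond, fourier, ← χ.hom_inv (A.val x), ← this]
        rw [← Finset.sum_neg_distrib]
        refine Finset.sum_congr rfl fun g _ => ?_
        push_cast
        ring
      · rfl
    rw [disp, h1, ih, ← sum_inv_hom_mul χ (fun g => (A.pathSum u g w + A.pathSum v g w * I : ℂ)),
      ← Finset.sum_add_distrib]
    refine Finset.sum_congr rfl fun g _ => ?_
    rw [pathSum, pathSum, next_eq]
    push_cast
    ring

theorem fourier_mem (u v : A.cocycles) : fourier χ u.1 v.1 ∈ A.twistedCocycles χ := by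
  refine ⟨fun j hj => ?_, ?_⟩
  · have h := disp_fourier (χ := χ) u.1 v.1 (A.discWord j)
    simp only [u.2.2, v.2.2, ofReal_zero, zero_mul, add_zero, mul_zero, Finset.sum_const_zero] at h
    rw [discWord, disp_replicate] at h
    change (∑ k ∈ Finset.range (orderOf (A.γ j)), χ.hom (A.γ j) ^ k) * _ = 0 at h
    have h0 : (orderOf (A.γ j) : ℂ) ≠ 0 := by exact_mod_cast (orderOf_pos (A.γ j)).ne'
    simpa [hj, h0] using h
  · rw [disp_fourier]
    simp [u.2.1, v.2.1]

variable (A) in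
/-- The Fourier transform of pairs of cocycles. -/
noncomputable def fourierL : (A.cocycles × A.cocycles) →ₗ[ℝ] Π χ : Dual G, A.twistedCocycles χ where
  toFun p χ := ⟨fourier χ p.1.1 p.2.1, fourier_mem p.1 p.2⟩
  map_add' p p' := by
    funext χ
    apply Subtype.ext
    funext x
    change fourier χ _ _ x = fourier χ _ _ x + fourier χ _ _ x
    simp only [fourier, ← Finset.sum_add_distrib]
    refine Finset.sum_congr rfl fun g _ => ?_
    simp
    ring
  map_smul' c p := by
    funext χ
    apply Subtype.ext
    funext x
    change fourier χ _ _ x = c * fourier χ _ _ x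
    simp only [fourier, Finset.mul_sum]
    refine Finset.sum_congr rfl fun g _ => ?_
    simp
    ring

theorem fourierL_injective : Function.Injective A.fourierL := by
  rw [← LinearMap.ker_eq_bot, LinearMap.ker_eq_bot']
  rintro ⟨u, v⟩ h
  have key (g : G) (x) : (u.1 (g, x) + v.1 (g, x) * I : ℂ) = 0 := by
    refine eq_zero_of_sum_mul_hom (d := fun g => (u.1 (g, x) + v.1 (g, x) * I : ℂ)) ?_ g
    intro χ
    have h1 := congrFun (congrArg Subtype.val (congrFun h χ⁻¹)) x
    change fourier χ⁻¹ u.1 v.1 x = 0 at h1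
    simpa [fourier, Dual.inv_hom, mul_comm] using h1
  have hu : u = 0 := by
    apply Subtype.ext; funext ⟨g, x⟩
    simpa using congrArg Complex.re (key g x)
  have hv : v = 0 := by
    apply Subtype.ext; funext ⟨g, x⟩
    simpa using congrArg Complex.im (key g x)
  rw [hu, hv]; rfl

open Classical in
-- A pair of cocycles stands for `u + i v`, so twice the real dimension is bounded by the real
-- dimensions of all twisted cocycle spaces. Each nontrivial character saves one complex dimension.
theorem finrank_cocycles_le : Module.finrank ℝ A.cocycles + Fintype.card G ≤
    ∑ χ : Dual G, (2 * A.h + Fintype.card {j // χ.hom (A.γ j) ≠ 1}) + 1 := by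
  have h1 := LinearMap.finrank_le_finrank_of_injective (A.fourierL_injective)
  rw [Module.finrank_prod, Module.finrank_pi_fintype] at h1
  simp only [finrank_real_of_complex] at h1
  rw [← Finset.mul_sum] at h1
  have h2 := Finset.sum_le_sum fun (χ : Dual G) (_ : χ ∈ Finset.univ) =>
    finrank_twistedCocycles_le (A := A) (χ := χ)
  rw [Finset.sum_add_distrib] at h2
  have h3 : ∑ χ : Dual G, (if χ = 1 then 0 else 1) + 1 = Fintype.card G := sum_ite_eq_one_add_one
  omega

/-! ### Dimension of the first cohomology -/

/-- Surjectivity of `p` makes the surface connected, so only constants have coboundary zero. -/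
theorem card_le_finrank_range_d : Fintype.card G ≤ Module.finrank ℝ (LinearMap.range A.d) + 1 := by
  have h1 := LinearMap.finrank_range_add_finrank_ker A.d
  have h2 : LinearMap.ker A.d ≤ ℝ ∙ (fun _ => 1 : G → ℝ) := fun f hf =>
    Submodule.mem_span_singleton.2 ⟨f 1, by
      funext g; rw [eq_const_of_d_eq_zero hf g]; simp⟩
  have h3 := (Submodule.finrank_mono h2).trans (finrank_span_le_card _)
  rw [Module.finrank_pi] at h1
  simp only [Set.toFinset_singleton, Finset.card_singleton] at h3
  omega

theorem finrank_H1_add : Module.finrank ℝ A.H1 + Module.finrank ℝ (LinearMap.range A.d) =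
    Module.finrank ℝ A.cocycles := by
  rw [← (Submodule.comapSubtypeEquivOfLe (range_d_le (A := A))).finrank_eq]
  exact Submodule.finrank_quotient_add_finrank _

open Classical in
theorem finrank_H1_le : Module.finrank ℝ A.H1 + 2 * Fintype.card G ≤
    ∑ χ : Dual G, (2 * A.h + Fintype.card {j // χ.hom (A.γ j) ≠ 1}) + 2 := by
  have h1 := A.finrank_cocycles_le
  have h2 := A.finrank_H1_add
  have h3 := A.card_le_finrank_range_d
  omega

end SurfaceAction

end SingularOrbit

/-! ### The Chevalley–Weil formula. -/

namespace SingularOrbit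

open Complex
open scoped Real ComplexConjugate

universe u

/-! ### The class of the unitary representation of an action -/

section

variable {G : Type u} [CommGroup G] [Fintype G]

theorem one_mem_indTrivial : (1 : G → ℂ) ∈ indTrivial G := by
  classical
  refine AddSubgroup.subset_closure ⟨⊤, ?_⟩
  funext g
  have : Subsingleton (G ⧸ (⊤ : Subgroup G)) := QuotientGroup.subsingleton_quotient_top
  have h (x : G ⧸ (⊤ : Subgroup G)) : g • x = x := Subsingleton.elim _ _
  rw [character_ofMulAction]
  simp only [h, Finset.filter_true, Finset.card_univ]
  rw [Fintype.card_eq_one_iff_nonempty_unique.2 ⟨⟨⟨1⟩, fun x => Subsingleton.elim _ _⟩⟩,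
    Nat.cast_one, Pi.one_apply]

theorem charSum_const_mem_indTrivial (k : ℤ) :
    charSum (fun _ : Dual G => (k : ℝ)) ∈ indTrivial G := by
  have : charSum (fun _ : Dual G => (k : ℝ)) = k • sumTrivialOn 1 := by
    funext g
    simp [charSum, sumTrivialOn, Finset.mul_sum]
  rw [this]
  exact zsmul_mem (sumTrivialOn_mem 1) k

theorem turn_add_turn_inv (χ : Dual G) (g : G) [Decidable (χ.hom g ≠ 1)] :
    turn (χ.hom g) + turn (χ⁻¹.hom g) = if χ.hom g ≠ 1 then 1 else 0 := by
  rw [Dual.inv_hom]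
  split_ifs with h
  · rw [turn_inv (χ.norm_hom g) h]; ring
  · rw [not_not.1 h, inv_one, turn_one, add_zero]

end

namespace SurfaceAction

variable {G : Type u} [CommGroup G] {A : SurfaceAction G}

theorem rotSum_classes (χ : Dual G) : rotSum A.classes χ = ∑ j, turn (χ⁻¹.hom (A.γ j)) := by
  have h (l : List (Fin A.q)) :
      rotSum ((l.map fun j => ConjClasses.mk (A.γ j) : List (ConjClasses G)) : Multiset _) χ =
        (l.map fun j => turn (χ⁻¹.hom (A.γ j))).sum := by
    induction l with
    | nil => simp
    | cons j l ih =>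
      rw [List.map_cons, ← Multiset.cons_coe, rotSum_cons, ih, conjElt_mk, List.map_cons,
        List.sum_cons]
  rw [classes, h, ← List.ofFn_eq_map, List.sum_ofFn]

variable [Fintype G]

open Classical in
/-- The multiplicities of the characters in the unitary representation of an action. -/
theorem multiplicity_inv_add {n : ℕ} {ρ : Representation ℂ G (EuclideanSpace ℂ (Fin n))}
    (hρ : A.IsUnitaryRep ρ) (χ : Dual G) :
    (A.h : ℝ) + ∑ j, turn (χ.hom (A.γ j)) =
      multiplicity ρ χ⁻¹ + (if χ = 1 then 0 else 1 : ℕ) := by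
  have hle (χ : Dual G) (_ : χ ∈ Finset.univ) := le_multiplicity hρ χ
  -- Inequalities that become an equality after summation over `χ` are all equalities, so a bound
  -- for the total dimension suffices.
  refine (Finset.sum_eq_sum_iff_of_le hle).1 (le_antisymm (Finset.sum_le_sum hle) ?_) χ
    (Finset.mem_univ χ)
  obtain ⟨-, e, -⟩ := hρ
  have h1 : Module.finrank ℝ A.H1 = 2 * n := by
    rw [e.finrank_eq, finrank_real_of_complex, finrank_euclideanSpace_fin]
  have h2 := A.finrank_H1_le
  have h3 : ∑ χ : Dual G, multiplicity ρ χ⁻¹ = n := by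
    rw [← Equiv.sum_comp (Equiv.inv (Dual G))]
    simp only [Equiv.inv_apply, inv_inv]
    rw [sum_multiplicity,
      finrank_euclideanSpace_fin]
  have h4 : ∑ χ : Dual G, (if χ = 1 then 0 else 1) + 1 = Fintype.card G := sum_ite_eq_one_add_one
  -- The terms for `χ` and `χ⁻¹` are added: rotation numbers of inverse values sum to `1`, or to `0`
  -- where `χ` is trivial.
  have h5 : 2 * ∑ χ : Dual G, ((A.h : ℝ) + ∑ j, turn (χ.hom (A.γ j))) =
      ((∑ χ : Dual G, (2 * A.h + Fintype.card {j // χ.hom (A.γ j) ≠ 1}) : ℕ) : ℝ) := by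
    rw [two_mul]
    conv_lhs => enter [2]; rw [← Equiv.sum_comp (Equiv.inv (Dual G))]
    rw [← Finset.sum_add_distrib]
    push_cast
    refine Finset.sum_congr rfl fun χ _ => ?_
    rw [Fintype.card_subtype, ← Finset.sum_boole, ← Finset.sum_congr rfl fun j _ =>
      turn_add_turn_inv χ (A.γ j), Finset.sum_add_distrib, Equiv.inv_apply]
    ring
  rw [Finset.sum_add_distrib, ← Nat.cast_sum, ← Nat.cast_sum, h3]
  have h6 : n + ∑ χ : Dual G, (if χ = 1 then 0 else 1) + n + ∑ χ : Dual G, (if χ = 1 then 0 else 1)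
      ≤ ∑ χ : Dual G, (2 * A.h + Fintype.card {j // χ.hom (A.γ j) ≠ 1}) := by omega
  have h7 : ((n + ∑ χ : Dual G, (if χ = 1 then 0 else 1) + n +
      ∑ χ : Dual G, (if χ = 1 then 0 else 1) : ℕ) : ℝ) ≤ _ := Nat.cast_le.2 h6
  rw [← h5] at h7
  rw [Nat.cast_add, Nat.cast_add, Nat.cast_add] at h7
  linarith

/-- The difference is `h - 1` times the regular character plus the trivial character. -/
theorem character_sub_mem_indTrivial {n : ℕ}
    {ρ : Representation ℂ G (EuclideanSpace ℂ (Fin n))} (hρ : A.IsUnitaryRep ρ) :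
    ρ.character - charSum (rotSum A.classes) ∈ indTrivial G := by
  classical
  have h : ρ.character = charSum (rotSum A.classes) +
      charSum (fun _ => (((A.h : ℤ) - 1 : ℤ) : ℝ)) + charSum (Pi.single 1 1) := by
    rw [character_eq_charSum, ← map_add, ← map_add]
    congr 1
    funext χ
    have h1 := multiplicity_inv_add hρ χ⁻¹
    rw [inv_inv] at h1
    rw [Pi.add_apply, Pi.add_apply, rotSum_classes, Pi.single_apply]
    simp only [inv_eq_one] at h1
    push_cast at h1 ⊢
    split_ifs at h1 ⊢ <;> linarith
  have h1 : charSum (Pi.single (1 : Dual G) 1) = 1 := by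
    funext g
    simp only [charSum, AddMonoidHom.coe_mk, ZeroHom.coe_mk]
    rw [Finset.sum_eq_single 1 (fun χ _ hχ => by simp [hχ]) (by simp)]
    simp [Dual.one_hom]
  rw [h, h1, add_sub_right_comm, add_sub_cancel_left]
  exact add_mem (charSum_const_mem_indTrivial _) one_mem_indTrivial

end SurfaceAction

end SingularOrbit

/-! ### Primitives along boundary paths; the pairing descends to cohomology. -/

namespace SingularOrbit

universe u

namespace SurfaceAction

variable {G : Type u} [CommGroup G] (A : SurfaceAction G)

/-! ### First moments of paths -/

/-- The value on an oriented edge as a linear functional. -/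
def stepL (g : G) (s : Gen A.h A.q × Bool) : A.Cochain →ₗ[ℝ] ℝ where
  toFun v := A.step v g s
  map_add' v v' := by obtain ⟨x, _ | _⟩ := s <;> simp only [step, cond, Pi.add_apply]; ring
  map_smul' c v := by
    obtain ⟨x, _ | _⟩ := s <;>
      simp only [step, cond, Pi.smul_apply, smul_eq_mul, RingHom.id_apply, mul_neg]

/-- The value on a path as a linear functional. -/
def pathSumL (g : G) (w : List (Gen A.h A.q × Bool)) : A.Cochain →ₗ[ℝ] ℝ where
  toFun v := A.pathSum v g w
  map_add' v v' := A.pathSum_add v v' g w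
  map_smul' c v := A.pathSum_smul c v g w

/-- The functional `v ↦ ∫ 2 U v` over the path that starts at `g` and spells out a word, for `U` the
primitive of `u` with the value `o` at the start. -/
def moment (u : A.Cochain) : ℝ → G → List (Gen A.h A.q × Bool) → A.Cochain →ₗ[ℝ] ℝ
  | _, _, [] => 0
  | o, g, s :: w => (2 * o + A.step u g s) • A.stepL g s +
      moment u (o + A.step u g s) (A.next g s) w

variable {A} {u v : A.Cochain}

theorem moment_nil (o : ℝ) (g : G) : A.moment u o g [] v = 0 := rfl

theorem moment_cons (o : ℝ) (g : G) (s) (w : List (Gen A.h A.q × Bool)) :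
    A.moment u o g (s :: w) v = (2 * o + A.step u g s) * A.step v g s +
      A.moment u (o + A.step u g s) (A.next g s) w v := rfl

/-- The initial value `o` enters only through the sum of `v` along the path. It is irrelevant for
cocycles on closed boundary paths, and for general cochains it can absorb Lagrange multipliers. -/
theorem moment_eq (o : ℝ) (g : G) (w : List (Gen A.h A.q × Bool)) :
    A.moment u o g w v =
      A.crossSum u v g w + (2 * o + A.pathSum u g w) * A.pathSum v g w := by
  induction w generalizing o g with
  | nil => simp [moment, crossSum, pathSum]
  | cons s w ih => rw [moment_cons, ih, crossSum, pathSum, pathSum]; ring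

theorem pathSum_append (g : G) (w w' : List (Gen A.h A.q × Bool)) :
    A.pathSum u g (w ++ w') = A.pathSum u g w + A.pathSum u (g * A.wordVal w) w' := by
  induction w generalizing g with
  | nil => simp [pathSum, wordVal]
  | cons s w ih => rw [List.cons_append, pathSum, ih, pathSum, wordVal_cons, next_eq, mul_assoc,
      add_assoc]

theorem moment_append (o : ℝ) (g : G) (w w' : List (Gen A.h A.q × Bool)) :
    A.moment u o g (w ++ w') v = A.moment u o g w v +
      A.moment u (o + A.pathSum u g w) (g * A.wordVal w) w' v := by
  induction w generalizing o g with
  | nil => simp [pathSum, wordVal, moment]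
  | cons s w ih =>
    rw [List.cons_append, moment_cons, ih, moment_cons, pathSum, wordVal_cons, next_eq, mul_assoc,
      add_assoc, add_assoc]

theorem step_congr {v' : A.Cochain} {s : Gen A.h A.q × Bool} (h : ∀ g, v (g, s.1) = v' (g, s.1))
    (g : G) : A.step v g s = A.step v' g s := by
  rw [step, step, h, h]

theorem moment_congr {v' : A.Cochain} {w : List (Gen A.h A.q × Bool)}
    (h : ∀ s ∈ w, ∀ g, v (g, s.1) = v' (g, s.1)) (o : ℝ) (g : G) :
    A.moment u o g w v = A.moment u o g w v' := by
  induction w generalizing o g with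
  | nil => rfl
  | cons s w ih =>
    rw [moment_cons, moment_cons, step_congr (h s List.mem_cons_self),
      ih fun t ht => h t (List.mem_cons_of_mem _ ht)]

theorem moment_eq_zero {w : List (Gen A.h A.q × Bool)} (h : ∀ s ∈ w, ∀ g, v (g, s.1) = 0)
    (o : ℝ) (g : G) : A.moment u o g w v = 0 :=
  (moment_congr (v' := 0) h o g).trans (map_zero _)

theorem crossSum_swap (g : G) (w : List (Gen A.h A.q × Bool)) :
    A.crossSum u v g w = -A.crossSum v u g w := by
  induction w generalizing g with
  | nil => simp [crossSum]
  | cons s w ih => rw [crossSum, crossSum, ih]; ring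

theorem crossSum_translate (c g : G) (w : List (Gen A.h A.q × Bool)) :
    A.crossSum (fun e => u (c * e.1, e.2)) (fun e => v (c * e.1, e.2)) g w =
      A.crossSum u v (c * g) w := by
  induction w generalizing g with
  | nil => rfl
  | cons s w ih =>
    have h (u : A.Cochain) : A.step (fun e => u (c * e.1, e.2)) g s = A.step u (c * g) s := by
      obtain ⟨x, _ | _⟩ := s <;> simp [step, mul_assoc]
    have hn : c * A.next g s = A.next (c * g) s := by rw [next_eq, next_eq, mul_assoc]
    rw [crossSum, crossSum, ih, pathSum_translate, pathSum_translate, h, h, hn]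

theorem crossSum_cocycle_eq_moment {u v : A.Cochain} {g : G} {w : List (Gen A.h A.q × Bool)}
    (hv : A.pathSum v g w = 0) (o : ℝ) : A.crossSum u v g w = A.moment u o g w v := by
  rw [moment_eq, hv, mul_zero, add_zero]

/-- With initial value `f g` the primitive is `f` itself, so each edge is weighted by the sum of `f`
at its ends, independently of the path. -/
theorem moment_d (f : G → ℝ) (g : G) (w : List (Gen A.h A.q × Bool)) :
    A.moment (A.d f) (f g) g w v =
      A.pathSum (fun e => (f e.1 + f (e.1 * A.val e.2)) * v e) g w := by
  induction w generalizing g with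
  | nil => rfl
  | cons s w ih =>
    have h : f g + A.step (A.d f) g s = f (A.next g s) := by
      obtain ⟨x, _ | _⟩ := s <;> simp [step, d, next]
    rw [moment_cons, h, ih, pathSum]
    congr 1
    obtain ⟨x, _ | _⟩ := s
    · simp only [step, d, cond, LinearMap.coe_mk, AddHom.coe_mk, inv_mul_cancel_right]
      ring
    · simp only [step, d, cond, LinearMap.coe_mk, AddHom.coe_mk]
      ring

/-! ### The pairing -/

variable [Fintype G]

variable (u) in
/-- The functional on cochains given by the pairing with a cochain. -/
noncomputable def pairingL : A.Cochain →ₗ[ℝ] ℝ :=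
  (1 / 2 : ℝ) • (∑ j, (1 / (orderOf (A.γ j) : ℝ)) • ∑ g, A.moment u 0 g (A.discWord j) -
    ∑ g, A.moment u 0 g (surfaceWord A.h A.q))

theorem pairing_eq_pairingL (u v : A.cocycles) : A.pairing u v = pairingL u.1 v.1 := by
  simp only [pairing, pairingL, LinearMap.smul_apply, LinearMap.sub_apply, LinearMap.sum_apply,
    smul_eq_mul, crossSum_cocycle_eq_moment (v.2.1 _) 0, crossSum_cocycle_eq_moment (v.2.2 _ _) 0]

theorem pairing_swap (u v : A.cocycles) : A.pairing u v = -A.pairing v u := by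
  have h (u v : A.cocycles) : A.pairing u v = (1 / 2) * (∑ j : Fin A.q,
      (1 / (orderOf (A.γ j) : ℝ)) * ∑ g : G, A.crossSum u.1 v.1 g (A.discWord j) -
    ∑ g : G, A.crossSum u.1 v.1 g (surfaceWord A.h A.q)) := rfl
  rw [h, h]
  simp only [crossSum_swap (u := u.1), Finset.sum_neg_distrib, mul_neg]
  ring

theorem pairing_translate (c : G) (u v : A.cocycles) :
    A.pairing (A.translate c u) (A.translate c v) = A.pairing u v := by
  have h (w) : ∑ g, A.crossSum u.1 v.1 (c⁻¹ * g) w = ∑ g, A.crossSum u.1 v.1 g w :=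
    Equiv.sum_comp (Equiv.mulLeft c⁻¹) (fun g => A.crossSum u.1 v.1 g w)
  simp only [pairing, translate, crossSum_translate, h]

/-- The pairing as a bilinear map. -/
noncomputable def pairingB : A.cocycles →ₗ[ℝ] A.cocycles →ₗ[ℝ] ℝ :=
  LinearMap.mk₂ ℝ A.pairing
    (fun u u' v => by
      rw [pairing_swap, pairing_swap u, pairing_swap u', pairing_eq_pairingL, pairing_eq_pairingL,
        pairing_eq_pairingL, Submodule.coe_add, map_add, neg_add])
    (fun c u v => by
      rw [pairing_swap, pairing_swap u, pairing_eq_pairingL, pairing_eq_pairingL,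
        Submodule.coe_smul, map_smul, smul_neg])
    (fun u v v' => by
      rw [pairing_eq_pairingL, pairing_eq_pairingL, pairing_eq_pairingL, Submodule.coe_add,
        map_add])
    (fun c u v => by
      rw [pairing_eq_pairingL, pairing_eq_pairingL, Submodule.coe_smul, map_smul])

/-! ### Coboundaries are in the kernel of the pairing -/

theorem sum_step (v : A.Cochain) (s : Gen A.h A.q × Bool) :
    ∑ g, A.step v g s = cond s.2 (∑ g, v (g, s.1)) (-∑ g, v (g, s.1)) := by
  obtain ⟨x, _ | _⟩ := s
  · simp only [step, cond, Finset.sum_neg_distrib]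
    rw [← Equiv.sum_comp (Equiv.mulRight (A.val x)⁻¹) (fun g => v (g, x))]
    rfl
  · rfl

theorem sum_pathSum (v : A.Cochain) (w : List (Gen A.h A.q × Bool)) :
    ∑ g, A.pathSum v g w =
      (w.map fun s => cond s.2 (∑ g, v (g, s.1)) (-∑ g, v (g, s.1))).sum := by
  induction w with
  | nil => simp [pathSum]
  | cons s w ih =>
    rw [List.map_cons, List.sum_cons, ← ih, ← sum_step,
      ← Equiv.sum_comp (Equiv.mulRight (A.letterVal s)) (fun g => A.pathSum v g w),
      ← Finset.sum_add_distrib]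
    simp only [pathSum, next_eq, Equiv.coe_mulRight]

theorem sum_pathSum_surfaceWord (v : A.Cochain) :
    ∑ g, A.pathSum v g (surfaceWord A.h A.q) = ∑ j, ∑ g, v (g, Gen.xi j) := by
  rw [sum_pathSum, surfaceWord_eq, List.map_append, List.sum_append]
  have h (l : List (Fin A.h)) : ((l.flatMap handleWord).map fun s : Gen A.h A.q × Bool =>
      cond s.2 (∑ g, v (g, s.1)) (-∑ g, v (g, s.1))).sum = 0 := by
    induction l with
    | nil => rfl
    | cons i l ih =>
      rw [List.flatMap_cons, List.map_append, List.sum_append, ih]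
      simp [handleWord]
  rw [h, zero_add, xiWord, List.map_map, ← List.ofFn_eq_map, List.sum_ofFn]
  rfl

theorem sum_pathSum_discWord (v : A.Cochain) (j : Fin A.q) :
    ∑ g, A.pathSum v g (A.discWord j) = orderOf (A.γ j) * ∑ g, v (g, Gen.xi j) := by
  rw [sum_pathSum, discWord, List.map_replicate, List.sum_replicate, nsmul_eq_mul]
  rfl

/-- After the choice of `f` as primitive, the weighted `a_i` and `b_i` edges cancel within the
polygons. Each `ξ_j` edge counts once in the polygons and `ν_j` times, with weight `1 / ν_j`, in the
discs. -/
theorem pairing_d (f : G → ℝ) (v : A.cocycles) :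
    A.pairing ⟨A.d f, range_d_le ⟨f, rfl⟩⟩ v = 0 := by
  have h1 (g : G) := crossSum_cocycle_eq_moment (u := A.d f) (v.2.1 g) (f g)
  have h2 (j) (g : G) := crossSum_cocycle_eq_moment (u := A.d f) (v.2.2 j g) (f g)
  rw [pairing]
  simp only [h1, h2, moment_d, sum_pathSum_surfaceWord, sum_pathSum_discWord]
  rw [mul_eq_zero, sub_eq_zero]
  refine .inr (Finset.sum_congr rfl fun j _ => ?_)
  have : (orderOf (A.γ j) : ℝ) ≠ 0 := by exact_mod_cast (orderOf_pos (A.γ j)).ne'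
  field_simp

end SurfaceAction

end SingularOrbit

/-! ### Cocycles in the radical of the pairing. -/

namespace SingularOrbit

universe u

theorem eq_zero_of_forall_sum_mul_eq_zero {G : Type*} [Fintype G] {F : G → ℝ} (h : ∀ c : G → ℝ, ∑ g, F g * c g = 0)
    (g : G) : F g = 0 := by
  classical
  simpa [Pi.single_apply] using h (Pi.single g 1)

namespace SurfaceAction

variable {G : Type u} [CommGroup G] {A : SurfaceAction G} {u v : A.Cochain}

/-! ### Nondegeneracy of the pairing -/

theorem pathSum_replicate (x : Gen A.h A.q) (n : ℕ) (g : G) :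
    A.pathSum u g (List.replicate n (x, true)) =
      ∑ i ∈ Finset.range n, u (g * A.val x ^ i, x) := by
  induction n with
  | zero => simp [pathSum]
  | succ n ih =>
    rw [List.replicate_succ', pathSum_append, ih, Finset.sum_range_succ]
    simp [pathSum, step, wordVal, letterVal]

theorem moment_replicate (x : Gen A.h A.q) (n : ℕ) (o : ℝ) (g : G) :
    A.moment u o g (List.replicate n (x, true)) v =
      ∑ k ∈ Finset.range n, (2 * (o + ∑ i ∈ Finset.range k, u (g * A.val x ^ i, x)) +
        u (g * A.val x ^ k, x)) * v (g * A.val x ^ k, x) := by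
  induction n with
  | zero => simp [moment]
  | succ n ih =>
    rw [List.replicate_succ', moment_append, ih, Finset.sum_range_succ, pathSum_replicate]
    simp [moment_cons, moment_nil, step, wordVal, letterVal]

/-- If the values of `u` on the generators in a word are those of a coboundary, then so is the value
on the path. -/
theorem pathSum_eq_sub {o : G → ℝ} {w : List (Gen A.h A.q × Bool)}
    (h : ∀ s ∈ w, ∀ g, u (g, s.1) = o (g * A.val s.1) - o g) (g : G) :
    A.pathSum u g w = o (g * A.wordVal w) - o g := by
  rw [← pathSum_d]
  induction w generalizing g with
  | nil => rfl
  | cons s w ih =>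
    rw [pathSum, pathSum, ih fun t ht => h t (List.mem_cons_of_mem _ ht),
      step_congr (v' := A.d o) (h s List.mem_cons_self)]

variable [Fintype G]

theorem add_eq_zero_of_forall_sum_mul_eq_zero {F F' : G → ℝ} {b : G}
    (h : ∀ c : G → ℝ, ∑ g, (F g * c g + F' g * c (g * b)) = 0) (g : G) :
    F (g * b) + F' g = 0 := by
  have h1 := eq_zero_of_forall_sum_mul_eq_zero (F := fun g => F g + F' (g * b⁻¹)) (fun c => by
    rw [← h c, Finset.sum_add_distrib,
      ← Equiv.sum_comp (Equiv.mulRight b⁻¹) (fun g => F' g * c (g * b)), ← Finset.sum_add_distrib]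
    refine Finset.sum_congr rfl fun g _ => ?_
    rw [Equiv.coe_mulRight, inv_mul_cancel_right, add_mul]) (g * b)
  rwa [mul_inv_cancel_right] at h1

/-- Each `a_i` or `b_i` edge occurs twice, with opposite directions, in the boundaries of the
polygons. Comparing the coefficients of `v` there makes the primitives from both sides agree (`hA`,
`hB`), and these equations solve to `u = d o`. -/
theorem eq_sub_of_sum_moment_handleWord_eq_zero {o : G → ℝ} {i : Fin A.h}
    (h : ∀ v, ∑ g, A.moment u (o g) g (handleWord i) v = 0) (g : G) :
    u (g, Gen.a i) = o (g * A.val (Gen.a i)) - o g ∧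
      u (g, Gen.b i) = o (g * A.val (Gen.b i)) - o g := by
  classical
  set a := A.val (Gen.a i) with ha
  set b := A.val (Gen.b i) with hb
  have e1 (g : G) : g * a * b * a⁻¹ = g * b := by rw [mul_right_comm g a b, mul_inv_cancel_right]
  have e2 (g : G) : g * b * b⁻¹ = g := mul_inv_cancel_right g b
  simp only [handleWord, moment_cons, moment_nil, add_zero, step, next, cond,
    ← ha, ← hb, e1, e2] at h
  have hA (g : G) : o g + u (g, .a i) + u (g * a, .b i) = o (g * b) + u (g * b, .a i) := by
    have h1 := add_eq_zero_of_forall_sum_mul_eq_zero (b := b) (F := fun g => 2 * o g + u (g, .a i))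
      (F' := fun g => -(2 * (o g + u (g, .a i) + u (g * a, .b i)) + -u (g * b, .a i)))
      (fun c => by
        rw [← h fun e => if e.2 = .a i then c e.1 else 0]
        refine Finset.sum_congr rfl fun g _ => ?_
        simp
        ring) g
    linarith
  have hB (g : G) : o g + u (g, .a i) + u (g * a, .b i) = o (g * a * b) := by
    have h1 := add_eq_zero_of_forall_sum_mul_eq_zero (b := a)
      (F := fun g => -(2 * (o g + u (g, .a i) + u (g * a, .b i) + -u (g * b, .a i)) +
        -u (g, .b i)))
      (F' := fun g => 2 * (o g + u (g, .a i)) + u (g * a, .b i))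
      (fun c => by
        rw [← h fun e => if e.2 = .b i then c e.1 else 0]
        refine Finset.sum_congr rfl fun g _ => ?_
        simp
        ring) g
    have h2 := hA (g * a)
    linarith
  have hu (g : G) : u (g, .a i) = o (g * a) - o g := by
    have h1 := hA (g * b⁻¹)
    have h2 := hB (g * b⁻¹)
    rw [inv_mul_cancel_right] at h1
    rw [show g * b⁻¹ * a * b = g * a by rw [mul_right_comm g b⁻¹ a, inv_mul_cancel_right]] at h2
    linarith
  refine ⟨hu g, ?_⟩
  have h1 := hB (g * a⁻¹)
  have h2 := hu (g * a⁻¹)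
  rw [inv_mul_cancel_right] at h1 h2
  linarith

open Classical in
-- Test cochains supported on the first handle isolate it. As `u = d o` there, the primitive returns
-- to `o g` after it, and the remaining handles satisfy the same hypothesis.
theorem eq_sub_of_sum_moment_handles_eq_zero {o : G → ℝ} {l : List (Fin A.h)} (hl : l.Nodup)
    (h : ∀ v : A.Cochain, (∀ g j, v (g, Gen.xi j) = 0) →
      ∑ g, A.moment u (o g) g (l.flatMap handleWord) v = 0) :
    ∀ s ∈ l.flatMap handleWord, ∀ g, u (g, s.1) = o (g * A.val s.1) - o g := by
  induction l with
  | nil => simp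
  | cons i l ih =>
    obtain ⟨hi, hl⟩ := List.nodup_cons.1 hl
    have h1 : ∀ v, ∑ g, A.moment u (o g) g (handleWord i) v = 0 := by
      intro v
      rw [← h (fun e => if e.2 = .a i ∨ e.2 = .b i then v e else 0) (by simp)]
      refine Finset.sum_congr rfl fun g _ => ?_
      rw [List.flatMap_cons, moment_append, moment_eq_zero (w := l.flatMap handleWord), add_zero]
      · refine moment_congr (fun s hs g => ?_) _ _
        simp only [handleWord, List.mem_cons, List.not_mem_nil, or_false] at hs
        obtain rfl | rfl | rfl | rfl := hs <;> simp
      · intro s hs g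
        obtain ⟨k, hk, hs⟩ := fst_ne_of_mem_handles hs
        have : k ≠ i := fun e => hi (e ▸ hk)
        obtain hs | hs := hs <;> simp [hs, this]
    have h2 : ∀ s ∈ handleWord i, ∀ g, u (g, s.1) = o (g * A.val s.1) - o g := by
      intro s hs g
      simp only [handleWord, List.mem_cons, List.not_mem_nil, or_false] at hs
      obtain ⟨ha, hb⟩ := eq_sub_of_sum_moment_handleWord_eq_zero h1 g
      obtain rfl | rfl | rfl | rfl := hs <;> assumption
    intro s hs
    rw [List.flatMap_cons, List.mem_append] at hs
    obtain hs | hs := hs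
    · exact h2 s hs
    · refine ih hl (fun v hv => ?_) s hs
      have h3 := h v hv
      simp only [List.flatMap_cons, moment_append, Finset.sum_add_distrib, h1, zero_add] at h3
      simpa [wordVal_handleWord, pathSum_eq_sub h2] using h3

/-- The values on the edges around the discs are determined by the moments of the discs. -/
theorem eq_sub_of_moment_disc {o μ : G → ℝ} {x : Gen A.h A.q} {n : ℕ} (hn : n ≠ 0)
    (hx : A.val x ^ n = 1) (hu : ∀ g, A.pathSum u g (List.replicate n (x, true)) = 0)
    (h : ∀ v : A.Cochain, (∀ g, ∀ y ≠ x, v (g, y) = 0) → ∑ g, (2 * o g + u (g, x)) * v (g, x) =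
      1 / (n : ℝ) * ∑ g, A.moment u (μ g) g (List.replicate n (x, true)) v) (g : G) :
    u (g, x) = o (g * A.val x) - o g := by
  classical
  set γ := A.val x with hγ
  -- The value at the vertex `g` of the primitive along the disc path that reaches `g` after `k`
  -- edges.
  let N (k : ℕ) (g : G) : ℝ := μ (g * (γ ^ k)⁻¹) +
    ∑ i ∈ Finset.range k, u (g * (γ ^ k)⁻¹ * γ ^ i, x)
  have hn' : (n : ℝ) ≠ 0 := by exact_mod_cast hn
  -- Comparing the coefficients of `v (g, x)`: `o` is the mean of the primitives over all starting
  -- points of the disc.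
  have h1 (g : G) : n * o g = ∑ k ∈ Finset.range n, N k g := by
    have h2 := eq_zero_of_forall_sum_mul_eq_zero
      (F := fun g => n * (2 * o g + u (g, x)) - ∑ k ∈ Finset.range n, (2 * N k g + u (g, x)))
      (fun c => by
        have h3 := h (fun e => if e.2 = x then c e.1 else 0) (fun g y hy => by simp [hy])
        rw [one_div, eq_inv_mul_iff_mul_eq₀ hn'] at h3
        simp only [moment_replicate, if_true, ← hγ] at h3
        rw [Finset.sum_comm] at h3
        simp only [sub_mul, Finset.sum_sub_distrib, mul_assoc, ← Finset.mul_sum, h3, Finset.sum_mul]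
        rw [sub_eq_zero, eq_comm, Finset.sum_comm]
        refine Finset.sum_congr rfl fun k _ => ?_
        rw [← Equiv.sum_comp (Equiv.mulRight (γ ^ k)) (fun g => (2 * N k g + u (g, x)) * c g)]
        refine Finset.sum_congr rfl fun g _ => ?_
        simp only [Equiv.coe_mulRight, N, mul_inv_cancel_right]) g
    rw [Finset.sum_add_distrib, ← Finset.mul_sum, Finset.sum_const, Finset.card_range,
      nsmul_eq_mul] at h2
    linarith
  have h2 (k : ℕ) : N (k + 1) (g * γ) = N k g + u (g, x) := by
    have e : g * γ * (γ ^ (k + 1))⁻¹ = g * (γ ^ k)⁻¹ := by rw [pow_succ]; group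
    simp only [N, e]
    rw [Finset.sum_range_succ, inv_mul_cancel_right, add_assoc]
  have h3 : N n (g * γ) = N 0 (g * γ) := by
    have := hu (g * γ)
    rw [pathSum_replicate, ← hγ] at this
    simp [N, hx, this]
  -- Since the disc path closes up, the index `k` is cyclic.
  have h4 : ∑ k ∈ Finset.range n, N (k + 1) (g * γ) = ∑ k ∈ Finset.range n, N k (g * γ) := by
    have := (Finset.sum_range_succ' (fun k => N k (g * γ)) n).symm.trans
      (Finset.sum_range_succ (fun k => N k (g * γ)) n)
    rw [h3] at this
    exact add_right_cancel this
  simp only [h2, Finset.sum_add_distrib, ← h1, Finset.sum_const, Finset.card_range,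
    nsmul_eq_mul] at h4
  have h5 : (n : ℝ) * (u (g, x) - (o (g * γ) - o g)) = 0 := by linarith
  exact sub_eq_zero.1 ((mul_eq_zero.1 h5).resolve_left hn')

open Classical in
-- The loops are peeled off one at a time: test cochains on the first loop compare the polygons with
-- its discs, and those vanishing there give the hypothesis for the remaining word.
theorem eq_sub_of_sum_moment_xiWord {o : G → ℝ} {μ : Fin A.q → G → ℝ} (hu : u ∈ A.cocycles)
    {l : List (Fin A.q)} (hl : l.Nodup)
    (h : ∀ v : A.Cochain, ∑ g, A.moment u (o g) g (xiWord l) v = (l.map fun j =>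
      1 / (orderOf (A.γ j) : ℝ) * ∑ g, A.moment u (μ j g) g (A.discWord j) v).sum) :
    ∀ j ∈ l, ∀ g, u (g, Gen.xi j) = o (g * A.γ j) - o g := by
  induction l with
  | nil => simp
  | cons j l ih =>
    obtain ⟨hj, hl⟩ := List.nodup_cons.1 hl
    have hmem : ∀ s ∈ (xiWord l : List (Gen A.h A.q × Bool)), s.1 ≠ .xi j := by
      rintro s hs
      obtain ⟨k, hk, rfl⟩ := List.mem_map.1 hs
      rintro ⟨⟩
      exact hj hk
    have hdisc {k : Fin A.q} {s} (hs : s ∈ A.discWord k) : s.1 = .xi k := by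
      rw [discWord, List.mem_replicate] at hs
      rw [hs.2]
    have h1 (v : A.Cochain) : ∑ g, A.moment u (o g) g (xiWord (j :: l)) v =
        ∑ g, (2 * o g + u (g, .xi j)) * v (g, .xi j) +
          ∑ g, A.moment u (o g + u (g, .xi j)) (g * A.γ j) (xiWord l) v := by
      rw [← Finset.sum_add_distrib]
      rfl
    have h2 (v : A.Cochain) (hv : ∀ g, ∀ y ≠ .xi j, v (g, y) = 0) :
        ∑ g, (2 * o g + u (g, .xi j)) * v (g, .xi j) =
          1 / (orderOf (A.γ j) : ℝ) * ∑ g, A.moment u (μ j g) g (A.discWord j) v := by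
      have h3 := h v
      rw [h1, List.map_cons, List.sum_cons] at h3
      have h4 : (l.map fun j => 1 / (orderOf (A.γ j) : ℝ) *
          ∑ g, A.moment u (μ j g) g (A.discWord j) v).sum = 0 := by
        refine List.sum_eq_zero fun x hx => ?_
        obtain ⟨k, hk, rfl⟩ := List.mem_map.1 hx
        refine mul_eq_zero_of_right _ (Finset.sum_eq_zero fun g _ => moment_eq_zero ?_ _ _)
        intro s hs g
        refine hv g _ ?_
        rw [hdisc hs]
        rintro ⟨⟩
        exact hj hk
      rwa [h4, add_zero, Finset.sum_eq_zero (s := Finset.univ)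
        (f := fun g => A.moment u (o g + u (g, .xi j)) (g * A.γ j) (xiWord l) v), add_zero] at h3
      exact fun g _ => moment_eq_zero (fun s hs g => hv g _ (hmem s hs)) _ _
    have h5 := eq_sub_of_moment_disc (x := .xi j) (orderOf_pos (A.γ j)).ne'
      (pow_orderOf_eq_one (A.γ j)) (hu.2 j) h2
    intro k hk
    obtain rfl | hk := List.mem_cons.1 hk
    · exact h5
    · refine ih hl (fun v => ?_) k hk
      set v' : A.Cochain := fun e => if e.2 = .xi j then 0 else v e with hv'
      have h6 := h v'
      rw [h1, List.map_cons, List.sum_cons, Finset.sum_eq_zero (s := Finset.univ)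
        (f := fun g => (2 * o g + u (g, .xi j)) * v' (g, .xi j)), zero_add,
        Finset.sum_eq_zero (s := Finset.univ)
        (f := fun g => A.moment u (μ j g) g (A.discWord j) v'), mul_zero, zero_add] at h6
      · have h7 (g : G) : A.moment u (o g) g (xiWord l) v = A.moment u (o g) g (xiWord l) v' :=
          moment_congr (fun s hs g => by simp [hv', hmem s hs]) _ _
        have h8 : (l.map fun j => 1 / (orderOf (A.γ j) : ℝ) *
            ∑ g, A.moment u (μ j g) g (A.discWord j) v) = l.map fun j =>
            1 / (orderOf (A.γ j) : ℝ) * ∑ g, A.moment u (μ j g) g (A.discWord j) v' := by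
          refine List.map_congr_left fun k hk => ?_
          congr 1
          refine Finset.sum_congr rfl fun g _ => moment_congr (fun s hs g => ?_) _ _
          have : k ≠ j := fun e => hj (e ▸ hk)
          simp [hv', hdisc hs, this]
        -- As `u = d o` on `ξ_j`, the path arrives at `g * γ_j` with the value `o (g * γ_j)`; a
        -- translation of the sum over `g` restores the induction hypothesis.
        rw [h8, ← h6, ← Equiv.sum_comp (Equiv.mulRight (A.γ j))]
        refine Finset.sum_congr rfl fun g _ => ?_
        rw [Equiv.coe_mulRight, h7, h5, show A.val (Gen.xi j) = A.γ j from rfl, add_sub_cancel]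
      · exact fun g _ => moment_eq_zero (fun s hs g => by simp [hv', hdisc hs]) _ _
      · exact fun g _ => by simp [hv']

/-- A cocycle in the kernel of the pairing is a coboundary. -/
theorem exists_d_eq_of_pairing_eq_zero {u : A.cocycles} (h : ∀ v, A.pairing u v = 0) :
    ∃ f, A.d f = u.1 := by
  classical
  let L : G ⊕ (Fin A.q × G) → (A.Cochain →ₗ[ℝ] ℝ) :=
    Sum.elim (fun g => A.pathSumL g (surfaceWord A.h A.q)) fun p => A.pathSumL p.2 (A.discWord p.1)
  -- Lagrange multipliers: a functional that vanishes on all cocycles is a combination of the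
  -- conditions that define them.
  have hK : pairingL u.1 ∈ Submodule.span ℝ (Set.range L) := by
    refine mem_span_of_iInf_ker_le_ker fun v hv => ?_
    simp only [Submodule.mem_iInf, LinearMap.mem_ker] at hv
    have := h ⟨v, fun g => hv (.inl g), fun j g => hv (.inr (j, g))⟩
    rwa [pairing_eq_pairingL] at this
  obtain ⟨c, hc⟩ := (Submodule.mem_span_range_iff_exists_fun ℝ).1 hK
  have hν (j : Fin A.q) : (orderOf (A.γ j) : ℝ) ≠ 0 := by
    exact_mod_cast (orderOf_pos (A.γ j)).ne'
  let o (g : G) : ℝ := c (.inl g)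
  -- Polygons enter the pairing with weight `-1` and discs with weight `1 / ν_j`. With these factors
  -- the multipliers become the initial values of primitives, and `o` turns out to be a primitive of
  -- `u`.
  let μ (j : Fin A.q) (g : G) : ℝ := -(orderOf (A.γ j) * c (.inr (j, g)))
  have hshift (x : ℝ) (g : G) (w) (v : A.Cochain) (hw : A.pathSum u.1 g w = 0) :
      A.moment u.1 x g w v = A.moment u.1 0 g w v + 2 * x * A.pathSum v g w := by
    rw [moment_eq, moment_eq, hw]; ring
  have key (v : A.Cochain) : ∑ g, A.moment u.1 (o g) g (surfaceWord A.h A.q) v =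
      ∑ j, 1 / (orderOf (A.γ j) : ℝ) * ∑ g, A.moment u.1 (μ j g) g (A.discWord j) v := by
    have h1 := LinearMap.congr_fun hc v
    rw [LinearMap.sum_apply, Fintype.sum_sum_type, Fintype.sum_prod_type] at h1
    simp only [pairingL, LinearMap.smul_apply, LinearMap.sub_apply, LinearMap.sum_apply,
      smul_eq_mul, L, Sum.elim_inl, Sum.elim_inr] at h1
    have h2 (g : G) := hshift (o g) g _ v (u.2.1 g)
    have h3 (j) (g : G) := hshift (μ j g) g _ v (u.2.2 j g)
    have h4 (j) : 1 / (orderOf (A.γ j) : ℝ) * ∑ g, 2 * μ j g * A.pathSum v g (A.discWord j) =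
        -2 * ∑ g, c (.inr (j, g)) * A.pathSum v g (A.discWord j) := by
      rw [Finset.mul_sum, Finset.mul_sum]
      refine Finset.sum_congr rfl fun g _ => ?_
      have := hν j
      simp only [μ]
      field_simp
    simp only [h2, h3, Finset.sum_add_distrib, mul_add, h4]
    simp only [mul_assoc, ← Finset.mul_sum]
    change ∑ g, c (.inl g) * A.pathSum v g _ + ∑ j, ∑ g, c (.inr (j, g)) * A.pathSum v g _ = _
      at h1
    linarith
  have hword (s : Gen A.h A.q × Bool) (j : Fin A.q) (hs : s ∈ A.discWord j) : s.1 = .xi j := by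
    rw [discWord, List.mem_replicate] at hs
    rw [hs.2]
  have hhand := eq_sub_of_sum_moment_handles_eq_zero (u := u.1) (o := o)
    (List.nodup_finRange A.h) (fun v hv => by
      have h1 := key v
      rw [Finset.sum_eq_zero (s := Finset.univ) (f := fun j => 1 / (orderOf (A.γ j) : ℝ) *
        ∑ g, A.moment u.1 (μ j g) g (A.discWord j) v)] at h1
      · rw [← h1]
        refine Finset.sum_congr rfl fun g _ => ?_
        rw [surfaceWord_eq, moment_append, moment_eq_zero (w := xiWord _), add_zero]
        intro s hs g
        obtain ⟨k, -, rfl⟩ := List.mem_map.1 hs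
        exact hv g k
      · refine fun j _ => mul_eq_zero_of_right _ (Finset.sum_eq_zero fun g _ => ?_)
        exact moment_eq_zero (fun s hs g => by rw [hword s j hs]; exact hv g j) _ _)
  have hxi := eq_sub_of_sum_moment_xiWord (o := o) (μ := μ) u.2 (List.nodup_finRange A.q)
    (fun v => by
      let v' : A.Cochain := fun e => if ∃ j, e.2 = .xi j then v e else 0
      have h1 := key v'
      rw [← List.ofFn_eq_map, List.sum_ofFn]
      have h2 (j) (g : G) : A.moment u.1 (μ j g) g (A.discWord j) v' =
          A.moment u.1 (μ j g) g (A.discWord j) v :=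
        moment_congr (fun s hs g => by simp [v', hword s j hs]) _ _
      simp only [h2] at h1
      rw [← h1]
      refine Finset.sum_congr rfl fun g _ => ?_
      rw [surfaceWord_eq, moment_append, moment_eq_zero (w := List.flatMap _ _), zero_add,
        pathSum_eq_sub hhand, wordVal_handles, mul_one, sub_self, add_zero]
      · refine moment_congr (fun s hs g => ?_) _ _
        obtain ⟨k, -, rfl⟩ := List.mem_map.1 hs
        simp [v']
      · intro s hs g
        obtain ⟨k, -, hs⟩ := fst_ne_of_mem_handles hs
        obtain hs | hs := hs <;> simp [v', hs])
  refine ⟨o, ?_⟩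
  funext ⟨g, x⟩
  have hmem (i : Fin A.h) {s : Gen A.h A.q × Bool} (hs : s ∈ handleWord i) :
      s ∈ (List.finRange A.h).flatMap handleWord :=
    List.mem_flatMap.2 ⟨i, List.mem_finRange i, hs⟩
  match x with
  | .a i => exact (hhand _ (hmem i (s := (.a i, true)) (by simp [handleWord])) g).symm
  | .b i => exact (hhand _ (hmem i (s := (.b i, true)) (by simp [handleWord])) g).symm
  | .xi j => exact (hxi j (List.mem_finRange j) g).symm

end SurfaceAction

end SingularOrbit

/-! ### Invariant complex structures by polar decomposition. -/

namespace SingularOrbit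

open scoped ComplexConjugate

universe u

/-! ### Unitary structures on symplectic representations -/

section Unitary

open Polynomial

theorem commute_aeval {K R : Type*} [CommSemiring K] [Semiring R] [Algebra K R] {C T : R}
    (h : Commute C T) (p : K[X]) : Commute C (aeval T p) := by
  induction p using Polynomial.induction_on' with
  | add p q hp hq => rw [map_add]; exact hp.add_right hq
  | monomial n a =>
    rw [aeval_monomial]
    exact (Algebra.commute_algebraMap_right a C).mul_right (h.pow_right n)

variable {V : Type*} [NormedAddCommGroup V] [InnerProductSpace ℝ V]

theorem isSymmetric_aeval {T : V →ₗ[ℝ] V} (hT : T.IsSymmetric) (p : ℝ[X]) :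
    (aeval T p).IsSymmetric := by
  induction p using Polynomial.induction_on' with
  | add p q hp hq => rw [map_add]; exact hp.add hq
  | monomial n a =>
    rw [aeval_monomial, ← Algebra.smul_def]
    exact (hT.pow n).smul (by simp)

variable [FiniteDimensional ℝ V]

/-- The inverse fourth root of a positive operator. -/
theorem exists_fourth_root {T : V →ₗ[ℝ] V} (hT : T.IsSymmetric)
    (hpos : ∀ u ≠ 0, 0 < inner ℝ (T u) u) :
    ∃ R : V →ₗ[ℝ] V, R.IsSymmetric ∧ (∀ C, Commute C T → Commute C R) ∧ R ^ 4 * T = 1 := by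
  classical
  let b := hT.eigenvectorBasis rfl
  let ev := hT.eigenvalues rfl
  have hb (i) : T (b i) = ev i • b i := hT.apply_eigenvectorBasis rfl i
  have hev (i) : 0 < ev i := by
    have h := hpos (b i) (b.toBasis.ne_zero i ∘ fun h => by simpa using h)
    rw [hb, inner_smul_left, real_inner_self_eq_norm_sq, b.norm_eq_one i] at h
    simpa using h
  -- A polynomial in `T` is symmetric and commutes with everything that commutes with `T`.
  let p : ℝ[X] := Lagrange.interpolate (Finset.univ.image ev) id fun x => (√√x)⁻¹
  have hp (i) : p.eval (ev i) = (√√(ev i))⁻¹ :=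
    Lagrange.eval_interpolate_at_node (v := id) _ (Function.injective_id.injOn)
      (Finset.mem_image_of_mem ev (Finset.mem_univ i))
  refine ⟨aeval T p, isSymmetric_aeval hT p, fun C hC => commute_aeval hC p,
    b.toBasis.ext fun i => ?_⟩
  have hR : aeval T p (b i) = (√√(ev i))⁻¹ • b i := by
    rw [Module.End.aeval_apply_of_hasEigenvector (hT.hasEigenvector_eigenvectorBasis rfl i), ← hp]
    rfl
  have h4 : (√√(ev i)) ^ 4 = ev i := by
    rw [show 4 = 2 * 2 from rfl, pow_mul, Real.sq_sqrt (Real.sqrt_nonneg _),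
      Real.sq_sqrt (hev i).le]
  have h0 : √√(ev i) ≠ 0 := (Real.sqrt_pos.2 (Real.sqrt_pos.2 (hev i))).ne'
  rw [OrthonormalBasis.coe_toBasis, Module.End.mul_apply, hb, map_smul, pow_succ, pow_succ, pow_two]
  simp only [Module.End.mul_apply, hR, map_smul, smul_smul, Module.End.one_apply]
  conv_rhs => rw [← one_smul ℝ (b i)]
  congr 1
  generalize √√(ev i) = r at h4 h0 ⊢
  rw [← h4]
  field_simp

/-- The complex structure in the polar decomposition of a skew-adjoint operator. -/
theorem exists_complexStructure {A : V →ₗ[ℝ] V} (hA : ∀ u v, inner ℝ (A u) v = -inner ℝ u (A v))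
    (hinj : Function.Injective A) :
    ∃ J : V →ₗ[ℝ] V, J * J = -1 ∧ (∀ C, Commute C A → Commute C J) ∧
      (∀ u v, inner ℝ (A u) (J v) = inner ℝ (A v) (J u)) ∧
      ∀ u ≠ 0, 0 < inner ℝ (A u) (J u) := by
  -- The complex structure is `A (-A²)^(-1/2)`. Writing the inverse square root as `R ^ 2` allows
  -- one factor `R` to be moved to each argument (`e1`), which gives symmetry and positivity
  -- together.
  have hT : (-(A * A)).IsSymmetric := by
    intro u v
    simp only [LinearMap.neg_apply, Module.End.mul_apply, inner_neg_left, inner_neg_right, hA]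
    rw [neg_neg]
  obtain ⟨R, hR, hcomm, h4⟩ := exists_fourth_root hT fun u hu => by
    rw [LinearMap.neg_apply, Module.End.mul_apply, inner_neg_left, hA, neg_neg,
      real_inner_self_eq_norm_sq]
    have : A u ≠ 0 := fun h => hu (hinj (h.trans (map_zero A).symm))
    positivity
  have hAR : Commute A R := hcomm A ((Commute.refl A).mul_right (Commute.refl A)).neg_right
  have e1 (u v) : inner ℝ (A u) ((A * R ^ 2) v) = inner ℝ (A (R u)) (A (R v)) := by
    have h : A * R ^ 2 = R * (A * R) := by
      rw [← mul_assoc, ← hAR.eq, pow_two, mul_assoc]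
    rw [h, Module.End.mul_apply, ← hR, ← Module.End.mul_apply, ← hAR.eq]
    rfl
  refine ⟨A * R ^ 2, ?_, fun C hC => ?_, fun u v => ?_, fun u hu => ?_⟩
  · have h : A * R ^ 2 * (A * R ^ 2) = -(R ^ 4 * -(A * A)) := by
      rw [mul_neg, neg_neg, ← (hAR.pow_right 4).mul_left (hAR.pow_right 4) |>.eq, mul_assoc,
        ← mul_assoc (R ^ 2), ← (hAR.pow_right 2).eq, mul_assoc A (R ^ 2), ← pow_add, ← mul_assoc]
    rw [h, h4]
  · exact hC.mul_right ((hcomm C (hC.mul_right hC).neg_right).pow_right 2)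
  · rw [e1, e1, real_inner_comm]
  · rw [e1, real_inner_self_eq_norm_sq]
    have h : A (R u) ≠ 0 := by
      intro h
      apply hu
      have h1 : R u = 0 := hinj (h.trans (map_zero A).symm)
      have h2 : (R ^ 4 * -(A * A)) u = 0 := by
        have : R ^ 4 * -(A * A) = -(A * A) * R ^ 3 * R := by
          rw [mul_assoc, ← pow_succ]
          exact ((hAR.pow_right 4).mul_left (hAR.pow_right 4)).neg_left.symm.eq
        rw [this, Module.End.mul_apply, h1, map_zero]
      rwa [h4] at h2
    positivity

/-- An invariant inner product on a representation of a finite group. -/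
theorem exists_invariant_core {G W : Type*} [Group G] [Fintype G] [AddCommGroup W] [Module ℝ W]
    [FiniteDimensional ℝ W] (τ : Representation ℝ G W) :
    ∃ c : InnerProductSpace.Core ℝ W, ∀ g x y, c.inner (τ g x) (τ g y) = c.inner x y := by
  let e : W ≃ₗ[ℝ] EuclideanSpace ℝ (Fin (Module.finrank ℝ W)) :=
    LinearEquiv.ofFinrankEq _ _ (by rw [finrank_euclideanSpace_fin])
  refine ⟨{ inner := fun x y => ∑ g, inner ℝ (e (τ g x)) (e (τ g y))
            conj_inner_symm := fun x y => by simp [real_inner_comm]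
            re_inner_nonneg := fun x => Finset.sum_nonneg fun g _ => real_inner_self_nonneg
            add_left := fun x y z => by simp [inner_add_left, Finset.sum_add_distrib]
            smul_left := fun x y r => by simp [inner_smul_left, Finset.mul_sum]
            definite := fun x h => ?_ }, fun g x y => ?_⟩
  · have h1 := (Finset.sum_eq_zero_iff_of_nonneg fun g _ => real_inner_self_nonneg).1 h 1
      (Finset.mem_univ 1)
    simpa using h1
  · change ∑ k, inner ℝ (e (τ k (τ g x))) (e (τ k (τ g y))) = _
    refine Eq.trans ?_ (Equiv.sum_comp (Equiv.mulRight g)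
      fun k => inner ℝ (e (τ k x)) (e (τ k y)))
    simp

/-- An invariant compatible complex structure on a symplectic representation. -/
theorem exists_invariant_complexStructure {G W : Type*} [Group G] [Fintype G] [AddCommGroup W]
    [Module ℝ W] [FiniteDimensional ℝ W] (τ : Representation ℝ G W) (B : W →ₗ[ℝ] W →ₗ[ℝ] ℝ)
    (hB : ∀ u v, B u v = -B v u) (hinv : ∀ g u v, B (τ g u) (τ g v) = B u v)
    (hnd : ∀ u, (∀ v, B u v = 0) → u = 0) :
    ∃ J : W →ₗ[ℝ] W, J * J = -1 ∧ (∀ g, Commute (τ g) J) ∧ (∀ u v, B u (J v) = B v (J u)) ∧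
      ∀ u ≠ 0, 0 < B u (J u) := by
  obtain ⟨c, hc⟩ := exists_invariant_core τ
  let _ : NormedAddCommGroup W := c.toNormedAddCommGroup
  let _ : InnerProductSpace ℝ W := InnerProductSpace.ofCore c.toCore
  have hc (g x y) : inner ℝ (τ g x) (τ g y) = inner ℝ x y := hc g x y
  let A : W →ₗ[ℝ] W :=
    (InnerProductSpace.toDual ℝ W).symm.toLinearEquiv.toLinearMap ∘ₗ
      LinearMap.toContinuousLinearMap.toLinearMap ∘ₗ B
  have hA (u v) : inner ℝ (A u) v = B u v := InnerProductSpace.toDual_symm_apply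
  obtain ⟨J, h1, h2, h3, h4⟩ := exists_complexStructure (A := A)
    (fun u v => by rw [hA, real_inner_comm, hA, hB])
    (by
      rw [← LinearMap.ker_eq_bot, LinearMap.ker_eq_bot']
      intro u hu
      exact hnd u fun v => by rw [← hA, hu, inner_zero_left])
  simp only [hA] at h3 h4
  refine ⟨J, h1, fun g => h2 _ (LinearMap.ext fun u => ext_inner_right ℝ fun v => ?_), h3, h4⟩
  have hv : τ g (τ g⁻¹ v) = v := by rw [← Module.End.mul_apply, ← map_mul]; simp
  rw [Module.End.mul_apply, Module.End.mul_apply, hA, ← hv, hc, hA, hinv]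

/-- A symplectic representation of a finite group comes from a unitary representation. -/
theorem exists_unitary {G W : Type*} [Group G] [Fintype G] [AddCommGroup W]
    [Module ℝ W] [FiniteDimensional ℝ W] (τ : Representation ℝ G W) (B : W →ₗ[ℝ] W →ₗ[ℝ] ℝ)
    (hB : ∀ u v, B u v = -B v u) (hinv : ∀ g u v, B (τ g u) (τ g v) = B u v)
    (hnd : ∀ u, (∀ v, B u v = 0) → u = 0) :
    ∃ (n : ℕ) (ρ : Representation ℂ G (EuclideanSpace ℂ (Fin n)))
      (e : W ≃ₗ[ℝ] EuclideanSpace ℂ (Fin n)),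
      (∀ g x y, inner ℂ (ρ g x) (ρ g y) = inner ℂ x y) ∧ (∀ g u, e (τ g u) = ρ g (e u)) ∧
        ∀ u v, B u v = (inner ℂ (e u) (e v)).im := by
  obtain ⟨J, hJ, hτ, hsymm, hpos⟩ := exists_invariant_complexStructure τ B hB hinv hnd
  have hJJ (u) : J (J u) = -u := LinearMap.congr_fun hJ u
  let _ : Module ℂ W := Module.compHom W (Complex.liftAux J hJ).toRingHom
  have hsmul (z : ℂ) (u : W) : z • u = z.re • u + z.im • J u := by
    change Complex.liftAux J hJ z u = _
    rw [Complex.liftAux_apply]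
    rfl
  have : IsScalarTower ℝ ℂ W := ⟨fun r z u => by
    rw [hsmul, hsmul, smul_add, smul_smul, smul_smul]; simp⟩
  -- The imaginary part is prescribed, and complex linearity in the second argument then forces the
  -- real part to be `B u (J v)`.
  let c : InnerProductSpace.Core ℂ W :=
    { inner := fun u v => ⟨B u (J v), B u v⟩
      conj_inner_symm := fun u v => by
        apply Complex.ext
        · exact hsymm v u
        · simp [hB v u]
      re_inner_nonneg := fun u => by
        by_cases h : u = 0
        · simp [h]
        · exact (hpos u h).le
      add_left := fun u v w => by apply Complex.ext <;> simp
      smul_left := fun u v z => by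
        have h1 : B (J u) (J v) = B u v := by rw [hsymm, hJJ, hB]; simp
        have h2 : B (J u) v = -B u (J v) := by rw [hB, hsymm]
        apply Complex.ext
        · simp [hsmul, h1]
        · simp [hsmul, h2]
      definite := fun u h => by
        by_contra hu
        exact (hpos u hu).ne' (congrArg Complex.re h) }
  let _ : NormedAddCommGroup W := c.toNormedAddCommGroup
  let _ : InnerProductSpace ℂ W := InnerProductSpace.ofCore c.toCore
  have : FiniteDimensional ℂ W := Module.Finite.of_restrictScalars_finite ℝ ℂ W
  have hin (u v : W) : inner ℂ u v = ⟨B u (J v), B u v⟩ := rfl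
  let b := stdOrthonormalBasis ℂ W
  have hτJ (g u) : τ g (J u) = J (τ g u) := LinearMap.congr_fun (hτ g).eq u
  let τ' : Representation ℂ G W :=
    { toFun := fun g =>
        { toFun := τ g
          map_add' := map_add _
          map_smul' := fun z u => by
            rw [RingHom.id_apply, hsmul, hsmul, map_add, map_smul, map_smul, hτJ] }
      map_one' := by ext u; simp
      map_mul' := fun g k => by ext u; simp }
  have hτ' (g u) : τ' g u = τ g u := rfl
  let ρ : Representation ℂ G (EuclideanSpace ℂ (Fin (Module.finrank ℂ W))) :=
    { toFun := fun g => b.repr.toLinearEquiv.conj (τ' g)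
      map_one' := by rw [map_one]; exact LinearEquiv.conj_id _
      map_mul' := fun g k => by rw [map_mul]; exact LinearEquiv.conj_comp _ _ _ }
  have hρ (g x) : ρ g x = b.repr (τ g (b.repr.symm x)) := rfl
  refine ⟨_, ρ, b.repr.toLinearEquiv.restrictScalars ℝ, fun g x y => ?_, fun g u => ?_,
    fun u v => ?_⟩
  · rw [hρ, hρ, b.repr.inner_map_map, hin, ← hτJ, hinv, hinv, ← hin,
      b.repr.symm.inner_map_map]
  · change b.repr (τ g u) = ρ g (b.repr u)
    rw [hρ, LinearIsometryEquiv.symm_apply_apply]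
  · change _ = (inner ℂ (b.repr u) (b.repr v)).im
    rw [b.repr.inner_map_map]
    rfl

end Unitary

end SingularOrbit

/-! ### Every action has a unitary representation, and every class comes from an action. -/

namespace SingularOrbit

universe u

namespace SurfaceAction

variable {G : Type u} [CommGroup G] {A : SurfaceAction G}

/-! ### Existence of the unitary representation of an action -/

variable (A) in
/-- The action of `G` on cocycles. -/
def cocycleRep : Representation ℝ G A.cocycles where
  toFun c :=
    { toFun := A.translate c
      map_add' := fun _ _ => rfl
      map_smul' := fun _ _ => rfl }
  map_one' := by
    refine LinearMap.ext fun u => Subtype.ext (funext fun e => ?_)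
    change u.1 (1⁻¹ * e.1, e.2) = u.1 e
    rw [inv_one, one_mul]
  map_mul' c c' := by
    refine LinearMap.ext fun u => Subtype.ext (funext fun e => ?_)
    change u.1 ((c * c')⁻¹ * e.1, e.2) = u.1 (c'⁻¹ * (c⁻¹ * e.1), e.2)
    rw [mul_inv_rev, mul_assoc]

theorem comap_le_comap_cocycleRep (c : G) :
    (LinearMap.range A.d).comap A.cocycles.subtype ≤
      ((LinearMap.range A.d).comap A.cocycles.subtype).comap (A.cocycleRep c) := by
  rintro u ⟨f, hf⟩
  refine ⟨fun g => f (c⁻¹ * g), funext fun e => ?_⟩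
  change f (c⁻¹ * (e.1 * A.val e.2)) - f (c⁻¹ * e.1) = u.1 (c⁻¹ * e.1, e.2)
  rw [← mul_assoc]
  exact congrFun hf (c⁻¹ * e.1, e.2)

variable (A) in
/-- The action of `G` on the first cohomology. -/
def cohomologyRep : Representation ℝ G A.H1 where
  toFun c := Submodule.mapQ _ _ (A.cocycleRep c) (comap_le_comap_cocycleRep c)
  map_one' := by
    refine Submodule.linearMap_qext _ (LinearMap.ext fun u => ?_)
    simp
  map_mul' c c' := by
    refine Submodule.linearMap_qext _ (LinearMap.ext fun u => ?_)
    simp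

variable [Fintype G]

theorem exists_pairing_H1 : ∃ B : A.H1 →ₗ[ℝ] A.H1 →ₗ[ℝ] ℝ, ∀ u v : A.cocycles,
    B (Submodule.Quotient.mk u) (Submodule.Quotient.mk v) = A.pairing u v := by
  have h (u v : A.cocycles) (hu : u ∈ (LinearMap.range A.d).comap A.cocycles.subtype) :
      A.pairing u v = 0 := by
    obtain ⟨f, hf⟩ := hu
    obtain rfl : (⟨A.d f, range_d_le ⟨f, rfl⟩⟩ : A.cocycles) = u := Subtype.ext hf
    exact pairing_d f v
  let B₁ : A.H1 →ₗ[ℝ] A.cocycles →ₗ[ℝ] ℝ := Submodule.liftQ _ A.pairingB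
    fun u hu => LinearMap.ext fun v => h u v hu
  refine ⟨(Submodule.liftQ _ B₁.flip fun v hv => ?_).flip, fun u v => rfl⟩
  refine Submodule.linearMap_qext _ (LinearMap.ext fun u => ?_)
  change A.pairing u v = 0
  rw [pairing_swap, h v u hv, neg_zero]

theorem exists_isUnitaryRep (A : SurfaceAction G) :
    ∃ (n : ℕ) (ρ : Representation ℂ G (EuclideanSpace ℂ (Fin n))), A.IsUnitaryRep ρ := by
  obtain ⟨B, hB⟩ := A.exists_pairing_H1
  obtain ⟨n, ρ, e, h1, h2, h3⟩ := exists_unitary A.cohomologyRep B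
    (fun u v => by
      obtain ⟨u, rfl⟩ := Submodule.Quotient.mk_surjective _ u
      obtain ⟨v, rfl⟩ := Submodule.Quotient.mk_surjective _ v
      rw [hB, hB, pairing_swap])
    (fun g u v => by
      obtain ⟨u, rfl⟩ := Submodule.Quotient.mk_surjective _ u
      obtain ⟨v, rfl⟩ := Submodule.Quotient.mk_surjective _ v
      rw [hB, ← pairing_translate g u v]
      exact hB _ _)
    (fun u hu => by
      obtain ⟨u, rfl⟩ := Submodule.Quotient.mk_surjective _ u
      rw [Submodule.Quotient.mk_eq_zero]
      exact exists_d_eq_of_pairing_eq_zero fun v => by rw [← hB, hu])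
  exact ⟨n, ρ, h1, e, fun c u => h2 c (Submodule.Quotient.mk u), fun u v => by rw [← hB, h3]⟩

end SurfaceAction

/-! ### Existence of actions with given singular orbit data -/

variable {G : Type u} [CommGroup G] [Fintype G]

/-- With all `b_i = 1` the commutators impose nothing, so the `a_i` may enumerate `G`; this ensures
surjectivity at the cost of taking `h` to be the order of `G`. -/
theorem exists_surfaceAction (l : List G) (hl : l.prod = 1) :
    ∃ A : SurfaceAction G, A.classes = (l.map ConjClasses.mk : List (ConjClasses G)) := by
  let f : Gen (Fintype.card G) l.length → G := fun x =>
    match x with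
    | .a i => (Fintype.equivFin G).symm i
    | .b _ => 1
    | .xi j => l.get j
  have hrel : ∀ r ∈ ({FreeGroup.mk (surfaceWord (Fintype.card G) l.length)} : Set _),
      FreeGroup.lift f r = 1 := by
    rintro _ rfl
    rw [FreeGroup.lift_mk, surfaceWord, List.map_append, List.prod_append, List.map_map]
    have h1 (l' : List (Fin (Fintype.card G))) : (List.map (fun x => cond x.2 (f x.1) (f x.1)⁻¹)
        (l'.flatMap fun i => [(Gen.a i, true), (Gen.b i, true), (Gen.a i, false),
          (Gen.b i, false)])).prod = 1 := by
      induction l' with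
      | nil => rfl
      | cons i l' ih =>
        rw [List.flatMap_cons, List.map_append, List.prod_append, ih]
        simp [f]
    rw [h1, one_mul]
    have h2 : List.map ((fun x => cond x.2 (f x.1) (f x.1)⁻¹) ∘ fun j => (Gen.xi j, true))
        (List.finRange l.length) = l := List.map_get_finRange l
    rw [h2, hl]
  refine ⟨⟨_, _, PresentedGroup.toGroup hrel, fun g =>
    ⟨PresentedGroup.of (Gen.a (Fintype.equivFin G g)), ?_⟩⟩, ?_⟩
  · rw [PresentedGroup.toGroup.of]
    simp [f]
  · have h : (List.finRange l.length).map l.get = l := List.map_get_finRange l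
    conv_rhs => rw [← h, List.map_map]
    refine congrArg _ (List.map_congr_left fun j _ => ?_)
    change ConjClasses.mk (PresentedGroup.toGroup hrel (PresentedGroup.of _)) = _
    rw [PresentedGroup.toGroup.of]
    rfl

theorem exists_surfaceAction_data (α : OrbitData G) : ∃ A : SurfaceAction G, A.data = α := by
  obtain ⟨⟨s, hs⟩, rfl⟩ := OrbitData.mk_surjective G α
  obtain ⟨t, rfl⟩ : ∃ t : Multiset G, t.map ConjClasses.mk = s :=
    ⟨s.map conjElt, by simp [mk_conjElt]⟩
  induction t using Quotient.inductionOn with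
  | h l =>
    rw [AddMonoidHom.mem_mker, psi_eq_zero_iff] at hs
    obtain ⟨A, hA⟩ := exists_surfaceAction l (by simpa [Function.comp_def, conjElt_mk] using hs)
    exact ⟨A, congrArg (OrbitData.mk G) (Subtype.ext hA)⟩

end SingularOrbit

theorem mainTheorem10 {G : Type*} [CommGroup G] [Fintype G]
    (hG : ¬ ∃ f : Multiplicative (ZMod 2 × ZMod 2) →* G, Function.Injective f) :
    IsAddTorsionFree (SingularOrbit.OrbitData G) ∧
      ∃ θ : SingularOrbit.OrbitData G →+ SingularOrbit.RepQuot G,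
        SingularOrbit.IsTheta θ ∧ Function.Injective θ := by
  have hinv : ∀ σ τ : G, σ ^ 2 = 1 → τ ^ 2 = 1 → σ ≠ 1 → τ ≠ 1 → σ = τ := by
    intro σ τ h1 h2 h3 h4
    by_contra h
    exact hG (SingularOrbit.exists_injective_of_involutions h1 h2 h3 h4 h)
  refine ⟨SingularOrbit.isAddTorsionFree_orbitData hinv, ?_⟩
  obtain ⟨θ, hθ⟩ := SingularOrbit.exists_theta (G := G)
  have hclass {A : SingularOrbit.SurfaceAction G} {n : ℕ}
      {ρ : Representation ℂ G (EuclideanSpace ℂ (Fin n))} (hρ : A.IsUnitaryRep ρ) :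
      θ A.data = SingularOrbit.repClass ρ := by
    obtain ⟨h, hs⟩ := hθ ⟨A.classes, A.psi_classes⟩
    rw [SingularOrbit.SurfaceAction.data, hs, SingularOrbit.repClass, QuotientAddGroup.eq, AddSubgroup.mem_addSubgroupOf,
      AddSubgroup.coe_add, AddSubgroup.coe_neg, neg_add_eq_sub]
    exact SingularOrbit.SurfaceAction.character_sub_mem_indTrivial hρ
  refine ⟨θ, fun α c => ⟨?_, ?_⟩, (injective_iff_map_eq_zero θ).2 fun α hα => ?_⟩
  · rintro rfl
    obtain ⟨A, rfl⟩ := SingularOrbit.exists_surfaceAction_data α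
    obtain ⟨n, ρ, hρ⟩ := A.exists_isUnitaryRep
    exact ⟨A, n, ρ, hρ, rfl, (hclass hρ).symm⟩
  · rintro ⟨A, n, ρ, hρ, rfl, rfl⟩
    exact hclass hρ
  · obtain ⟨s, rfl⟩ := SingularOrbit.OrbitData.mk_surjective G α
    obtain ⟨h, hs⟩ := hθ s
    rw [hs, QuotientAddGroup.eq_zero_iff, AddSubgroup.mem_addSubgroupOf] at hα
    exact SingularOrbit.mk_eq_zero_of_rotSum_symm hinv s (SingularOrbit.symm_of_charSum_mem_indTrivial hα)
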